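/- Let $k$ be an algebraically closed field, $N$ a lattice (a free abelian group of finite rank), $M=\operatorname{Hom}(N,\mathbb Z)$, $N_{\mathbb R}=N\otimes_{\mathbb Z}\mathbb R$. Let $\Delta$ be a fan in $N$: a finite non-empty set of strongly convex rational polyhedral cones in $N_{\mathbb R}$, closed under taking faces, any two of which meet in a common face. Assume that $\Delta$ is non-degenerate, i.e. not contained in a proper linear subspace of $N_{\mathbb R}$. Let $X=X(\Delta)$ be the toric variety over $k$ obtained by glueing the affine schemes $U_\sigma=\operatorname{Spec} k[\sigma^\vee\cap M]$, $\sigma\in\Delta$, along the open immersions $U_\tau\subseteq U_\sigma$ for the faces $\tau$ of $\sigma$. Let $\operatorname{Cl}(X)$ be the group of Weil divisors of $X$ modulo principal divisors, let $\Delta(1)$ be the set of rays of $\Delta$, each given by its primitive generator $v\in N$, and let $Y(v)\subset X$ be the prime divisor whose ideal in the chart $U_{\mathbb R_{\ge 0}v}$ is generated by the $x^u$ with $\langle u,v\rangle>0$. Let $\operatorname{Cox}(X)=k[v\mid v\in\Delta(1)]$ be the polynomial ring on the rays, graded by $\operatorname{Cl}(X)$ through $\deg v=[Y(v)]$. For $\sigma\in\Delta$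 let $v^{\bar\sigma}$ be the product of the variables $v$ of the rays not contained in $\sigma$, and let $J_X$ be the ideal generated by all $v^{\bar\sigma}$, $\sigma\in\Delta$. Let $G=\operatorname{Hom}(\operatorname{Cl}(X),k^*)$ be the diagonalizable group scheme $\operatorname{Spec} k[\operatorname{Cl}(X)]$ over $k$. It acts on $\operatorname{Spec}(\operatorname{Cox}(X))$ through the coaction $v\mapsto [Y(v)]\otimes v$ and this action restricts to the open subset $\operatorname{Spec}(\operatorname{Cox}(X))\setminus V(J_X)$. Then $X$ is the categorical quotient of $\operatorname{Spec}(\operatorname{Cox}(X))\setminus V(J_X)$ by $G$. More precisely, there is a morphism of $k$-schemes $$\pi:\operatorname{Spec}(\operatorname{Cox}(X))\setminus V(J_X)\to X$$ which is $G$-invariant and through which every $G$-invariant morphism from $\operatorname{Spec}(\operatorname{Cox}(X))\setminus V(J_X)$ to a $k$-scheme factors in a unique way, and such that for every $\sigma\in\Delta$ the assignment $x^u\mapsto\prod_{v\in\Delta(1)}v^{\langle u,v\rangle}$ defines an isomorphism of $k[\sigma^\vee\cap M]$ onto the degree-$0$ part $(\operatorname{Cox}(X)_{v^{\bar\sigma}})_0$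 of the localization, and the restriction of $\pi$ to $\operatorname{Spec}(\operatorname{Cox}(X)_{v^{\bar\sigma}})$ is the composite $$\operatorname{Spec}(\operatorname{Cox}(X)_{v^{\bar\sigma}})\to\operatorname{Spec}\bigl((\operatorname{Cox}(X)_{v^{\bar\sigma}})_0\bigr)\cong U_\sigma\subseteq X .$$ -/

import Mathlib

open CategoryTheory CategoryTheory.Limits AlgebraicGeometry TensorProduct
universe u

namespace Toric

section Fans

variable {N : Type u} [AddCommGroup N]

/-- A rational polyhedral cone in `N_ℝ = ℝ ⊗ N`: the positive span of finitely many vectors of the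
lattice `N`. -/
def IsRationalPolyhedral (σ : PointedCone ℝ (ℝ ⊗[ℤ] N)) : Prop :=
  ∃ S : Finset N, σ = PointedCone.hull ℝ ((fun n : N ↦ (1 : ℝ) ⊗ₜ[ℤ] n) '' (S : Set N))

/-- `τ` is a face of `σ`: it is cut out of `σ` by the hyperplane `w = 0` of a linear form `w` that is
nonnegative on `σ` (`w = 0` is allowed, so that `σ` is a face of itself). -/
def IsFace (τ σ : PointedCone ℝ (ℝ ⊗[ℤ] N)) : Prop :=
  ∃ w : Module.Dual ℝ (ℝ ⊗[ℤ] N), (∀ x ∈ σ, 0 ≤ w x) ∧ ∀ x, x ∈ τ ↔ x ∈ σ ∧ w x = 0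

variable (N) in
/-- A (finite, rational, strongly convex, polyhedral) fan in the lattice `N`. -/
structure Fan where
  /-- The cones of the fan. -/
  cones : Set (PointedCone ℝ (ℝ ⊗[ℤ] N))
  finite : cones.Finite
  nonempty : cones.Nonempty
  rational : ∀ σ ∈ cones, IsRationalPolyhedral σ
  stronglyConvex : ∀ σ ∈ cones, ∀ x ∈ σ, -x ∈ σ → x = 0
  face_mem : ∀ σ ∈ cones, ∀ τ, IsFace τ σ → τ ∈ cones
  inter_isFace : ∀ σ ∈ cones, ∀ τ ∈ cones, IsFace (σ ⊓ τ) σ ∧ IsFace (σ ⊓ τ) τ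

/-- A fan is non-degenerate if it is not contained in a proper subspace of `N_ℝ`. -/
def Fan.IsNondegenerate (Δ : Fan N) : Prop :=
  ∀ V : Submodule ℝ (ℝ ⊗[ℤ] N), (∀ σ ∈ Δ.cones, ∀ x ∈ σ, x ∈ V) → V = ⊤

/-- The monoid `σ^∨ ∩ M` of the integral linear forms that are nonnegative on the cone `σ`. -/
def dualMonoid (σ : PointedCone ℝ (ℝ ⊗[ℤ] N)) : AddSubmonoid (Module.Dual ℤ N) where
  carrier := {u | ∀ x ∈ σ, 0 ≤ u.baseChange ℝ x}
  zero_mem' := by simp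
  add_mem' {a b} ha hb x hx := by
    rw [map_add, LinearMap.add_apply]; exact add_nonneg (ha x hx) (hb x hx)

lemma mem_dualMonoid {σ : PointedCone ℝ (ℝ ⊗[ℤ] N)} {u : Module.Dual ℤ N} :
    u ∈ dualMonoid σ ↔ ∀ x ∈ σ, 0 ≤ u.baseChange ℝ x := Iff.rfl

lemma dualMonoid_anti {σ τ : PointedCone ℝ (ℝ ⊗[ℤ] N)} (h : τ ≤ σ) :
    dualMonoid σ ≤ dualMonoid τ := fun _ hu x hx ↦ hu x (h hx)

lemma nonneg_on_hull {S : Set N} {w : Module.Dual ℝ (ℝ ⊗[ℤ] N)}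
    (h : ∀ s ∈ S, 0 ≤ w (1 ⊗ₜ s)) :
    ∀ x ∈ PointedCone.hull ℝ ((fun n : N ↦ (1 : ℝ) ⊗ₜ[ℤ] n) '' S), 0 ≤ w x := by
  intro x hx
  induction hx using Submodule.span_induction with
  | mem x hx => obtain ⟨s, hs, rfl⟩ := hx; exact h s hs
  | zero => simp
  | add x y _ _ hx hy => rw [map_add]; exact add_nonneg hx hy
  | smul a x _ hx =>
    rw [← Nonneg.coe_smul, map_smul]; exact mul_nonneg a.2 hx

lemma zero_of_hull {S : Set N} {w w' : Module.Dual ℝ (ℝ ⊗[ℤ] N)}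
    (h : ∀ s ∈ S, 0 ≤ w (1 ⊗ₜ s))
    (h' : ∀ s ∈ S, w (1 ⊗ₜ s) = 0 → w' (1 ⊗ₜ s) = 0) :
    ∀ x ∈ PointedCone.hull ℝ ((fun n : N ↦ (1 : ℝ) ⊗ₜ[ℤ] n) '' S), w x = 0 → w' x = 0 := by
  intro x hx
  induction hx using Submodule.span_induction with
  | mem x hx => obtain ⟨s, hs, rfl⟩ := hx; exact h' s hs
  | zero => simp
  | add x y hx' hy' hx hy =>
    intro h0
    have h1 := nonneg_on_hull h x hx'
    have h2 := nonneg_on_hull h y hy'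
    rw [map_add] at h0
    rw [map_add, hx (by linarith), hy (by linarith), add_zero]
  | smul a x _ hx =>
    rw [← Nonneg.coe_smul, map_smul, map_smul, smul_eq_mul, smul_eq_mul]
    intro h0
    rcases mul_eq_zero.mp h0 with h0 | h0
    · simp [h0]
    · simp [hx h0]

/-- A real linear form can be replaced by an integral one without changing its zeros and its positive
values on a finite set. -/
lemma exists_integral [Module.Finite ℤ N] (S : Finset N) (w : N →+ ℝ) :
    ∃ u : Module.Dual ℤ N, ∀ s ∈ S, (w s = 0 → u s = 0) ∧ (0 < w s → 0 < u s) := by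
  classical
  let A := LinearMap.range w.toIntLinearMap
  have : Module.Finite ℤ A := inferInstance
  have : Module.Free ℤ A := inferInstance
  let b := Module.finBasis ℤ A
  let a : Fin (Module.finrank ℤ A) → ℝ := fun i ↦ (b i : ℝ)
  let wA : N →ₗ[ℤ] A := w.toIntLinearMap.rangeRestrict
  have hw : ∀ s, w s = ∑ i, (b.repr (wA s) i : ℝ) * a i := by
    intro s
    have := congrArg (fun z : A ↦ (z : ℝ)) (b.sum_repr (wA s))
    simp only [AddSubmonoidClass.coe_finsetSum, Submodule.coe_smul,
      zsmul_eq_mul] at this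
    rw [this]; rfl
  let O : Set (Fin (Module.finrank ℤ A) → ℝ) :=
    ⋂ s ∈ S.filter (fun s ↦ 0 < w s), {c | 0 < ∑ i, (b.repr (wA s) i : ℝ) * c i}
  have hO : IsOpen O := by
    refine isOpen_biInter_finset fun s _ ↦ ?_
    exact isOpen_lt continuous_const (by fun_prop)
  have haO : a ∈ O := by
    simp only [O, Set.mem_iInter, Finset.mem_filter, and_imp]
    intro s _ hs
    rw [hw] at hs; exact hs
  have hd : DenseRange (fun (q : Fin (Module.finrank ℤ A) → ℚ) i ↦ (q i : ℝ)) :=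
    DenseRange.piMap (fun _ ↦ Rat.denseRange_cast)
  obtain ⟨q, hq⟩ := hd.exists_mem_open hO ⟨a, haO⟩
  obtain ⟨⟨d, hd0⟩, hd⟩ := IsLocalization.exist_integer_multiples_of_finset (nonZeroDivisors ℤ)
    (Finset.univ.image q)
  have hd0' : d ≠ 0 := nonZeroDivisors.ne_zero hd0
  have hz : ∀ i, ∃ z : ℤ, (z : ℚ) = (d ^ 2 : ℤ) * q i := by
    intro i
    obtain ⟨z, hz⟩ := hd (q i) (by simp)
    refine ⟨d * z, ?_⟩
    have : (z : ℚ) = d * q i := by simpa [Algebra.smul_def] using hz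
    push_cast; rw [this]; ring
  choose z hz using hz
  refine ⟨(b.constr ℤ z) ∘ₗ wA, fun s hs ↦ ⟨fun h0 ↦ ?_, fun hpos ↦ ?_⟩⟩
  · have : wA s = 0 := Subtype.ext h0
    simp [this]
  · have h1 : 0 < ∑ i, (b.repr (wA s) i : ℝ) * (q i : ℝ) := by
      simp only [O, Set.mem_iInter, Finset.mem_filter, and_imp] at hq
      exact hq s hs hpos
    have h2 : (((b.constr ℤ z) (wA s) : ℤ) : ℝ) =
        (d : ℝ) ^ 2 * ∑ i, (b.repr (wA s) i : ℝ) * (q i : ℝ) := by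
      rw [Module.Basis.constr_apply_fintype, Finset.mul_sum]
      push_cast
      refine Finset.sum_congr rfl fun i _ ↦ ?_
      have : (z i : ℝ) = (d : ℝ) ^ 2 * q i := by exact_mod_cast congrArg (Rat.cast : ℚ → ℝ) (hz i)
      simp [this]; ring
    have h3 : (0 : ℝ) < (((b.constr ℤ z) (wA s) : ℤ) : ℝ) := by
      rw [h2]
      have : (d : ℝ) ≠ 0 := by exact_mod_cast hd0'
      positivity
    exact_mod_cast h3

/-- A face of a rational polyhedral cone is cut out by an integral linear form. -/
lemma IsFace.exists_integral [Module.Finite ℤ N] {σ τ : PointedCone ℝ (ℝ ⊗[ℤ] N)}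
    (hσ : IsRationalPolyhedral σ) (h : IsFace τ σ) :
    ∃ u ∈ dualMonoid σ, ∀ x, x ∈ τ ↔ x ∈ σ ∧ u.baseChange ℝ x = 0 := by
  classical
  obtain ⟨S, rfl⟩ := hσ
  obtain ⟨w, hw, hτ⟩ := h
  have hw' : ∀ s ∈ S, 0 ≤ w (1 ⊗ₜ s) :=
    fun s hs ↦ hw _ (Submodule.subset_span ⟨s, hs, rfl⟩)
  obtain ⟨u, hu⟩ := Toric.exists_integral S
    ((w : (ℝ ⊗[ℤ] N) →+ ℝ).comp ((TensorProduct.mk ℤ ℝ N 1 : N →ₗ[ℤ] ℝ ⊗[ℤ] N) : N →+ ℝ ⊗[ℤ] N))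
  replace hu : ∀ s ∈ S, (w (1 ⊗ₜ s) = 0 → u s = 0) ∧ (0 < w (1 ⊗ₜ s) → 0 < u s) := hu
  have hub : ∀ s, u.baseChange ℝ ((1 : ℝ) ⊗ₜ[ℤ] s) = u s := by
    intro s; simp
  have hu0 : ∀ s ∈ S, 0 ≤ u.baseChange ℝ ((1 : ℝ) ⊗ₜ[ℤ] s) := by
    intro s hs
    rw [hub]
    rcases (hw' s hs).eq_or_lt with h | h
    · simp [(hu s hs).1 h.symm]
    · exact_mod_cast ((hu s hs).2 h).le
  have hiff : ∀ s ∈ S, u.baseChange ℝ ((1 : ℝ) ⊗ₜ[ℤ] s) = 0 ↔ w (1 ⊗ₜ s) = 0 := by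
    intro s hs
    rw [hub]
    refine ⟨fun h ↦ ?_, fun h ↦ by simp [(hu s hs).1 h]⟩
    by_contra hne
    have := (hu s hs).2 (lt_of_le_of_ne (hw' s hs) (Ne.symm hne))
    have h' : u s = 0 := by exact_mod_cast h
    omega
  refine ⟨u, nonneg_on_hull hu0, fun x ↦ ?_⟩
  rw [hτ]
  refine and_congr_right fun hx ↦ ⟨?_, ?_⟩
  · exact zero_of_hull hw' (fun s hs ↦ (hiff s hs).2) x hx
  · exact zero_of_hull hu0 (fun s hs ↦ (hiff s hs).1) x hx

/-- If `u` cuts out `τ` in `σ`, every form in the dual monoid of `τ` becomes nonnegative on `σ` after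
adding a multiple of `u`. -/
lemma exists_add_nsmul_mem {σ τ : PointedCone ℝ (ℝ ⊗[ℤ] N)}
    (hσ : IsRationalPolyhedral σ) {u : Module.Dual ℤ N} (hu : u ∈ dualMonoid σ)
    (hτ : ∀ x, x ∈ τ ↔ x ∈ σ ∧ u.baseChange ℝ x = 0) {m : Module.Dual ℤ N}
    (hm : m ∈ dualMonoid τ) : ∃ n : ℕ, m + n • u ∈ dualMonoid σ := by
  obtain ⟨S, rfl⟩ := hσ
  refine ⟨∑ s ∈ S, (m s).natAbs, nonneg_on_hull fun s (hs : s ∈ S) ↦ ?_⟩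
  have hs' : (1 : ℝ) ⊗ₜ[ℤ] s ∈
      PointedCone.hull ℝ ((fun n : N ↦ (1 : ℝ) ⊗ₜ[ℤ] n) '' (S : Set N)) :=
    Submodule.subset_span ⟨s, hs, rfl⟩
  have hb : ∀ u : Module.Dual ℤ N, u.baseChange ℝ ((1 : ℝ) ⊗ₜ[ℤ] s) = u s := by
    intro u; simp
  have hus : 0 ≤ u s := by exact_mod_cast hb u ▸ hu _ hs'
  have : (m + (∑ s ∈ S, (m s).natAbs) • u).baseChange ℝ ((1 : ℝ) ⊗ₜ[ℤ] s) =
      ((m s + (∑ s ∈ S, ((m s).natAbs : ℤ)) * u s : ℤ) : ℝ) := by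
    simp
  rw [this]
  rcases hus.eq_or_lt with h | h
  · have h1 : (1 : ℝ) ⊗ₜ[ℤ] s ∈ τ := (hτ _).2 ⟨hs', by rw [hb, ← h]; simp⟩
    have h2 := hm _ h1
    rw [hb] at h2
    rw [← h]
    simpa using h2
  · have h2 : ((m s).natAbs : ℤ) ≤ ∑ s ∈ S, ((m s).natAbs : ℤ) :=
      Finset.single_le_sum (f := fun s ↦ ((m s).natAbs : ℤ)) (fun _ _ ↦ by positivity) hs
    have h3 : -(m s) ≤ ((m s).natAbs : ℤ) := by omega
    have : 0 ≤ m s + (∑ s ∈ S, ((m s).natAbs : ℤ)) * u s := by nlinarith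
    exact_mod_cast this

/-- Gordan's lemma. -/
lemma IsRationalPolyhedral.fg [Module.Free ℤ N] [Module.Finite ℤ N]
    {σ : PointedCone ℝ (ℝ ⊗[ℤ] N)} (hσ : IsRationalPolyhedral σ) :
    AddMonoid.FG (dualMonoid σ) := by
  classical
  obtain ⟨S, rfl⟩ := hσ
  let b := Module.finBasis ℤ (Module.Dual ℤ N)
  let n := Module.finrank ℤ (Module.Dual ℤ N)
  let P := (Fin n → ℕ) × (Fin n → ℕ) × (S → ℕ)
  let c : P →+ Module.Dual ℤ N :=
    { toFun p := ∑ i, ((p.1 i : ℤ) - (p.2.1 i : ℤ)) • b i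
      map_zero' := by simp
      map_add' p q := by
        rw [← Finset.sum_add_distrib]
        refine Finset.sum_congr rfl fun i _ ↦ ?_
        rw [← add_smul]; congr 1
        change ((p.1 i + q.1 i : ℕ) : ℤ) - ((p.2.1 i + q.2.1 i : ℕ) : ℤ) = _
        push_cast; ring }
  let f : P →+ (S → ℤ) :=
    { toFun p s := c p s
      map_zero' := by ext; simp
      map_add' p q := by ext; simp }
  let g : P →+ (S → ℤ) :=
    { toFun p s := p.2.2 s
      map_zero' := by ext; simp
      map_add' p q := by
        ext s; exact Nat.cast_add (p.2.2 s) (q.2.2 s) }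
  have hfg := (AddSubmonoid.fg_eqLocusM f g).map c
  have : (f.eqLocusM g).map c =
      dualMonoid (PointedCone.hull ℝ ((fun n : N ↦ (1 : ℝ) ⊗ₜ[ℤ] n) '' (S : Set N))) := by
    ext u
    constructor
    · rintro ⟨p, hp, rfl⟩
      refine nonneg_on_hull fun s hs ↦ ?_
      have h1 := congrFun (show f p = g p from hp) ⟨s, hs⟩
      have h2 : c p s = (p.2.2 ⟨s, hs⟩ : ℤ) := h1
      simp [h2]
    · intro hu
      have hu' : ∀ s ∈ S, 0 ≤ u s := by
        intro s hs
        have := hu _ (Submodule.subset_span ⟨s, hs, rfl⟩)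
        have h3 : u.baseChange ℝ ((1 : ℝ) ⊗ₜ[ℤ] s) = u s := by simp
        exact_mod_cast h3 ▸ this
      let p : P := (fun i ↦ (b.repr u i).toNat, fun i ↦ (-(b.repr u i)).toNat,
        fun s ↦ (u s).toNat)
      have hc : c p = u := by
        change ∑ i, (((b.repr u i).toNat : ℤ) - ((-(b.repr u i)).toNat : ℤ)) • b i = u
        conv_rhs => rw [← b.sum_repr u]
        refine Finset.sum_congr rfl fun i _ ↦ ?_
        congr 1; omega
      refine ⟨p, ?_, hc⟩
      change f p = g p
      ext s
      change c p s = ((u s).toNat : ℤ)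
      rw [hc, Int.toNat_of_nonneg (hu' s s.2)]
  rw [this] at hfg
  exact (AddMonoid.fg_iff_addSubmonoid_fg _).2 hfg

end Fans
end Toric

namespace Toric
section Charts

variable (k : Type u) [Field k] {N : Type u} [AddCommGroup N]

/-- The coordinate ring `k[σ^∨ ∩ M]` of the affine chart `U_σ`. -/
abbrev ChartRing (σ : PointedCone ℝ (ℝ ⊗[ℤ] N)) : Type u := AddMonoidAlgebra k (dualMonoid σ)

/-- The inclusion `k[σ^∨ ∩ M] → k[τ^∨ ∩ M]` for `τ ⊆ σ`. -/
noncomputable def chartRes {σ τ : PointedCone ℝ (ℝ ⊗[ℤ] N)} (h : τ ≤ σ) :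
    ChartRing k σ →ₐ[k] ChartRing k τ :=
  AddMonoidAlgebra.mapDomainAlgHom k k (AddSubmonoid.inclusion (dualMonoid_anti h))

lemma chartRes_injective {σ τ : PointedCone ℝ (ℝ ⊗[ℤ] N)} (h : τ ≤ σ) :
    Function.Injective (chartRes k h) :=
  AddMonoidAlgebra.mapDomain_injective (AddSubmonoid.inclusion_injective _)

lemma chartRes_single {σ τ : PointedCone ℝ (ℝ ⊗[ℤ] N)} (h : τ ≤ σ) (m : dualMonoid σ) (c : k) :
    chartRes k h (AddMonoidAlgebra.single m c) =
      AddMonoidAlgebra.single (AddSubmonoid.inclusion (dualMonoid_anti h) m) c := by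
  simp [chartRes]

lemma isLocalizationAway_chartRes {σ τ : PointedCone ℝ (ℝ ⊗[ℤ] N)} (h : τ ≤ σ)
    (hσ : IsRationalPolyhedral σ) {u : Module.Dual ℤ N} (hu : u ∈ dualMonoid σ)
    (hτ : ∀ x, x ∈ τ ↔ x ∈ σ ∧ u.baseChange ℝ x = 0) :
    letI := (chartRes k h).toRingHom.toAlgebra
    IsLocalization.Away (AddMonoidAlgebra.single (⟨u, hu⟩ : dualMonoid σ) (1 : k))
      (ChartRing k τ) := by
  let := (chartRes k h).toRingHom.toAlgebra
  have hneg : -u ∈ dualMonoid τ := fun x hx ↦ by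
    rw [map_neg, LinearMap.neg_apply, ((hτ x).1 hx).2, neg_zero]
  have halg : ∀ a, algebraMap (ChartRing k σ) (ChartRing k τ) a = chartRes k h a := fun _ ↦ rfl
  have hpow : ∀ n : ℕ, chartRes k h (AddMonoidAlgebra.single (⟨u, hu⟩ : dualMonoid σ) (1 : k)) ^ n =
      AddMonoidAlgebra.single (n • AddSubmonoid.inclusion (dualMonoid_anti h) ⟨u, hu⟩) (1 : k) := by
    intro n
    rw [chartRes_single, AddMonoidAlgebra.single_pow, one_pow]
  refine IsLocalization.Away.mk _ ?_ ?_ ?_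
  · rw [halg, chartRes_single]
    refine IsUnit.of_mul_eq_one (AddMonoidAlgebra.single ⟨-u, hneg⟩ 1) ?_
    rw [AddMonoidAlgebra.single_mul_single, AddMonoidAlgebra.one_def, one_mul]
    congr 1
    ext1
    simp
  · intro f
    induction f using AddMonoidAlgebra.induction_linear with
    | zero => exact ⟨0, 0, by simp⟩
    | add f g hf hg =>
      obtain ⟨n, a, ha⟩ := hf
      obtain ⟨m, b, hb⟩ := hg
      refine ⟨n + m, a * AddMonoidAlgebra.single (⟨u, hu⟩ : dualMonoid σ) (1 : k) ^ m +
        b * AddMonoidAlgebra.single (⟨u, hu⟩ : dualMonoid σ) (1 : k) ^ n, ?_⟩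
      rw [map_add, map_mul, map_mul, map_pow, map_pow, ← ha, ← hb]
      ring
    | single m c =>
      obtain ⟨n, hn⟩ := exists_add_nsmul_mem hσ hu hτ m.2
      refine ⟨n, AddMonoidAlgebra.single ⟨_, hn⟩ c, ?_⟩
      rw [halg, halg, hpow, chartRes_single, AddMonoidAlgebra.single_mul_single, mul_one]
      congr 1
  · intro a b hab
    exact ⟨0, by rw [chartRes_injective k h hab]⟩

/-- The open immersion `U_τ → U_σ` for `τ ⊆ σ`. -/
noncomputable def chartMap {σ τ : PointedCone ℝ (ℝ ⊗[ℤ] N)} (h : τ ≤ σ) :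
    Spec (.of (ChartRing k τ)) ⟶ Spec (.of (ChartRing k σ)) :=
  Spec.map (CommRingCat.ofHom (chartRes k h).toRingHom)

lemma isOpenImmersion_chartMap [Module.Finite ℤ N] {σ τ : PointedCone ℝ (ℝ ⊗[ℤ] N)} (h : τ ≤ σ)
    (hσ : IsRationalPolyhedral σ) (hτ : IsFace τ σ) : IsOpenImmersion (chartMap k h) := by
  obtain ⟨u, hu, hτ⟩ := hτ.exists_integral hσ
  let := (chartRes k h).toRingHom.toAlgebra
  have := isLocalizationAway_chartRes k h hσ hu hτ
  exact IsOpenImmersion.of_isLocalization (AddMonoidAlgebra.single (⟨u, hu⟩ : dualMonoid σ) (1 : k))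

lemma mem_range_chartMap {σ τ : PointedCone ℝ (ℝ ⊗[ℤ] N)} (h : τ ≤ σ)
    (hσ : IsRationalPolyhedral σ) {u : Module.Dual ℤ N} (hu : u ∈ dualMonoid σ)
    (hτ : ∀ x, x ∈ τ ↔ x ∈ σ ∧ u.baseChange ℝ x = 0) (p : Spec (.of (ChartRing k σ))) :
    p ∈ Set.range (chartMap k h) ↔
      AddMonoidAlgebra.single (⟨u, hu⟩ : dualMonoid σ) (1 : k) ∉ p.asIdeal := by
  let := (chartRes k h).toRingHom.toAlgebra
  have := isLocalizationAway_chartRes k h hσ hu hτ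
  have e := PrimeSpectrum.localization_away_comap_range (ChartRing k τ)
    (AddMonoidAlgebra.single (⟨u, hu⟩ : dualMonoid σ) (1 : k))
  exact Set.ext_iff.mp e p

end Charts

namespace Fan

variable (k : Type u) [Field k] {N : Type u} [AddCommGroup N] (Δ : Fan N)

/-- The cones of a fan, ordered by inclusion (equivalently, by the face relation). -/
abbrev Cone : Type u := {σ : PointedCone ℝ (ℝ ⊗[ℤ] N) // σ ∈ Δ.cones}

variable {Δ} in
lemma isFace_of_le {σ τ : Δ.Cone} (h : τ ≤ σ) : IsFace τ.1 σ.1 := by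
  have := (Δ.inter_isFace σ.1 σ.2 τ.1 τ.2).1
  rwa [inf_eq_right.mpr (show τ.1 ≤ σ.1 from h)] at this

variable {Δ} in
/-- The intersection of two cones of a fan. -/
def Cone.inter (σ τ : Δ.Cone) : Δ.Cone :=
  ⟨σ.1 ⊓ τ.1, Δ.face_mem σ.1 σ.2 _ (Δ.inter_isFace σ.1 σ.2 τ.1 τ.2).1⟩

/-- The diagram of the affine charts `U_σ = Spec k[σ^∨ ∩ M]` and the open immersions `U_τ → U_σ`,
`τ` a face of `σ`. -/
noncomputable def chartDiagram : Δ.Cone ⥤ Scheme.{u} where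
  obj σ := Spec (.of (ChartRing k σ.1))
  map {τ σ} f := chartMap k (show τ.1 ≤ σ.1 from leOfHom f)
  map_id σ := by
    rw [chartMap, ← Spec.map_id]
    congr 1
    ext1
    refine RingHom.ext fun a ↦ ?_
    exact DFunLike.congr_fun (AddMonoidAlgebra.mapDomainAlgHom_id (R := k) (A := k)) a
  map_comp {ρ τ σ} f g := by
    rw [chartMap, chartMap, chartMap, ← Spec.map_comp]
    congr 1
    ext1
    refine RingHom.ext fun a ↦ ?_
    exact DFunLike.congr_fun (AddMonoidAlgebra.mapDomainAlgHom_comp (R := k) (A := k)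
      (AddSubmonoid.inclusion (dualMonoid_anti (leOfHom g)))
      (AddSubmonoid.inclusion (dualMonoid_anti (leOfHom f)))) a

variable [Module.Finite ℤ N]

instance {τ σ : Δ.Cone} (f : τ ⟶ σ) : IsOpenImmersion ((Δ.chartDiagram k).map f) :=
  isOpenImmersion_chartMap k _ (Δ.rational σ.1 σ.2) (isFace_of_le (leOfHom f))

instance : (Δ.chartDiagram k ⋙ Scheme.forget).IsLocallyDirected where
  cond {i j l} fi fj xi xj hij := by
    have hij' : (Δ.chartDiagram k).map fi xi = (Δ.chartDiagram k).map fj xj := hij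
    obtain ⟨u, hu, hi⟩ := (isFace_of_le (leOfHom fi)).exists_integral (Δ.rational l.1 l.2)
    obtain ⟨v, hv, hj⟩ := (isFace_of_le (leOfHom fj)).exists_integral (Δ.rational l.1 l.2)
    have hle : (Cone.inter i j).1 ≤ l.1 := inf_le_left.trans (leOfHom fi)
    have huv : ∀ x, x ∈ (Cone.inter i j).1 ↔ x ∈ l.1 ∧ (u + v).baseChange ℝ x = 0 := by
      intro x
      rw [map_add, LinearMap.add_apply]
      change x ∈ i.1 ∧ x ∈ j.1 ↔ _
      rw [hi, hj]
      constructor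
      · rintro ⟨⟨h1, h2⟩, -, h3⟩
        exact ⟨h1, by rw [h2, h3, add_zero]⟩
      · rintro ⟨h1, h2⟩
        have h3 := hu x h1
        have h4 := hv x h1
        exact ⟨⟨h1, by linarith⟩, h1, by linarith⟩
    have hmem : (Δ.chartDiagram k).map fi xi ∈ Set.range (chartMap k hle) := by
      refine (mem_range_chartMap k hle (Δ.rational l.1 l.2) (add_mem hu hv) huv _).2 ?_
      have e : AddMonoidAlgebra.single (⟨u + v, add_mem hu hv⟩ : dualMonoid l.1) (1 : k) =
          AddMonoidAlgebra.single ⟨u, hu⟩ 1 * AddMonoidAlgebra.single ⟨v, hv⟩ 1 := by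
        rw [AddMonoidAlgebra.single_mul_single, one_mul]; rfl
      rw [e]
      refine fun hp ↦ ((PrimeSpectrum.isPrime
        (R := ChartRing k l.1) ((Δ.chartDiagram k).map fi xi)).mem_or_mem hp).elim ?_ ?_
      · exact (mem_range_chartMap k (leOfHom fi) (Δ.rational l.1 l.2) hu hi _).1 ⟨xi, rfl⟩
      · rw [hij']
        exact (mem_range_chartMap k (leOfHom fj) (Δ.rational l.1 l.2) hv hj _).1 ⟨xj, rfl⟩
    obtain ⟨x, hx⟩ := hmem
    let gi : Cone.inter i j ⟶ i := homOfLE (show (Cone.inter i j).1 ≤ i.1 from inf_le_left)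
    let gj : Cone.inter i j ⟶ j := homOfLE (show (Cone.inter i j).1 ≤ j.1 from inf_le_right)
    have comp {a b c : Δ.Cone} (f : a ⟶ b) (g : b ⟶ c) (x : (Δ.chartDiagram k).obj a) :
        (Δ.chartDiagram k).map (f ≫ g) x = (Δ.chartDiagram k).map g ((Δ.chartDiagram k).map f x) := by
      rw [Functor.map_comp]; rfl
    refine ⟨_, gi, gj, x, ?_, ?_⟩
    · apply ((Δ.chartDiagram k).map fi).isOpenEmbedding.injective
      exact (comp gi fi x).symm.trans hx
    · apply ((Δ.chartDiagram k).map fj).isOpenEmbedding.injective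
      exact (comp gj fj x).symm.trans (hx.trans hij')

/-- The toric variety `X(Δ)`: the scheme obtained by gluing the affine charts `U_σ`, `σ ∈ Δ`, along
the open subschemes `U_{σ ∩ τ}`. It is the colimit of the diagram of the charts and the open
immersions between them. -/
noncomputable def toricVariety : Scheme.{u} := colimit (Δ.chartDiagram k)

/-- The inclusion of the chart `U_σ` into the toric variety. -/
noncomputable def chartι (σ : Δ.Cone) : Spec (.of (ChartRing k σ.1)) ⟶ Δ.toricVariety k :=
  colimit.ι (Δ.chartDiagram k) σ

instance (σ : Δ.Cone) : IsOpenImmersion (Δ.chartι k σ) :=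
  inferInstanceAs (IsOpenImmersion (colimit.ι (Δ.chartDiagram k) σ))

/-- The affine open cover of the toric variety by its charts. -/
noncomputable def chartCover : (Δ.toricVariety k).OpenCover :=
  Scheme.IsLocallyDirected.openCover (Δ.chartDiagram k)

/-- The structure morphism of the toric variety. -/
noncomputable def toricVarietyStr : Δ.toricVariety k ⟶ Spec (.of k) :=
  colimit.desc (Δ.chartDiagram k)
    { pt := Spec (.of k)
      ι :=
        { app σ := Spec.map (CommRingCat.ofHom (algebraMap k (ChartRing k σ.1)))
          naturality {τ σ} f := by
            change chartMap k _ ≫ _ = _ ≫ 𝟙 _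
            rw [Category.comp_id, chartMap, ← Spec.map_comp, ← CommRingCat.ofHom_comp]
            congr 2
            exact (chartRes k (leOfHom f)).comp_algebraMap } }

lemma exists_chartι_eq (x : Δ.toricVariety k) : ∃ σ y, Δ.chartι k σ y = x :=
  Scheme.IsLocallyDirected.ι_jointly_surjective (Δ.chartDiagram k) x

lemma chartMap_chartι {σ τ : Δ.Cone} (h : τ ≤ σ) :
    chartMap k (show τ.1 ≤ σ.1 from h) ≫ Δ.chartι k σ = Δ.chartι k τ :=
  colimit.w (Δ.chartDiagram k) (homOfLE h)

variable [Module.Free ℤ N]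

variable (N) in
instance : TwoUniqueSums (Module.Dual ℤ N) :=
  TwoUniqueSums.of_injective_addHom
    (AddHomClass.toAddHom (Module.finBasis ℤ (Module.Dual ℤ N)).repr)
    (Module.finBasis ℤ (Module.Dual ℤ N)).repr.injective inferInstance

instance (σ : PointedCone ℝ (ℝ ⊗[ℤ] N)) : IsDomain (ChartRing k σ) := by
  have : TwoUniqueSums (dualMonoid σ) :=
    TwoUniqueSums.of_injective_addHom (AddHomClass.toAddHom (dualMonoid σ).subtype)
      Subtype.val_injective inferInstance
  infer_instance

lemma isNoetherianRing_chartRing {σ : PointedCone ℝ (ℝ ⊗[ℤ] N)} (hσ : IsRationalPolyhedral σ) :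
    IsNoetherianRing (ChartRing k σ) := by
  have := hσ.fg
  exact Algebra.FiniteType.isNoetherianRing k _

lemma chartι_genericPoint (σ τ : Δ.Cone) (h : τ ≤ σ) :
    Δ.chartι k τ (genericPoint (Spec (.of (ChartRing k τ.1)))) =
      Δ.chartι k σ (genericPoint (Spec (.of (ChartRing k σ.1)))) := by
  have := isOpenImmersion_chartMap k (show τ.1 ≤ σ.1 from h) (Δ.rational σ.1 σ.2) (isFace_of_le h)
  rw [← chartMap_chartι k Δ h, ← genericPoint_eq_of_isOpenImmersion (chartMap k h)]
  rfl

instance : IsIntegral (Δ.toricVariety k) := by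
  have hred : IsReduced (Δ.toricVariety k) := by
    have : ∀ i, IsReduced ((Δ.chartCover k).X i) := fun i ↦
      inferInstanceAs (IsReduced (Spec (.of (ChartRing k (Subtype.val i)))))
    exact IsReduced.of_openCover _ (Δ.chartCover k)
  obtain ⟨σ₀, hσ₀⟩ := Δ.nonempty
  let η := Δ.chartι k ⟨σ₀, hσ₀⟩ (genericPoint (Spec (.of (ChartRing k σ₀))))
  have hη : ∀ σ : Δ.Cone, Δ.chartι k σ (genericPoint (Spec (.of (ChartRing k σ.1)))) = η := by
    intro σ
    rw [← chartι_genericPoint k Δ σ (Cone.inter σ ⟨σ₀, hσ₀⟩)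
      (inf_le_left : σ.1 ⊓ σ₀ ≤ σ.1)]
    exact chartι_genericPoint k Δ ⟨σ₀, hσ₀⟩ (Cone.inter σ ⟨σ₀, hσ₀⟩)
      (inf_le_right : σ.1 ⊓ σ₀ ≤ σ₀)
  have hcl : closure {η} = Set.univ := by
    refine Set.eq_univ_of_forall fun x ↦ ?_
    obtain ⟨σ, y, rfl⟩ := exists_chartι_eq k Δ x
    rw [← specializes_iff_mem_closure, ← hη σ]
    exact (genericPoint_specializes y).map (Δ.chartι k σ).continuous
  have hirr : IrreducibleSpace (Δ.toricVariety k) := by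
    have h : IsIrreducible (Set.univ : Set (Δ.toricVariety k)) := by
      rw [← hcl]; exact isIrreducible_singleton.closure
    have : PreirreducibleSpace (Δ.toricVariety k) := ⟨h.isPreirreducible⟩
    exact ⟨⟨η⟩⟩
  exact isIntegral_of_irreducibleSpace_of_isReduced _

instance : IsLocallyNoetherian (Δ.toricVariety k) := by
  rw [isLocallyNoetherian_iff_openCover (Δ.chartCover k)]
  intro σ
  have := isNoetherianRing_chartRing k (Δ.rational _ σ.2)
  exact inferInstanceAs (IsLocallyNoetherian (Spec (.of (ChartRing k (Subtype.val σ)))))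

end Fan
end Toric

namespace Toric

section ClassGroup

/-- The prime divisors of a scheme, given by their generic points: the points of codimension one. -/
abbrev PrimeDivisor (X : Scheme.{u}) : Type u := {x : X // Order.coheight x = 1}

/-- The group of Weil divisors. -/
abbrev WeilDivisor (X : Scheme.{u}) : Type u := PrimeDivisor X →₀ ℤ

variable (X : Scheme.{u}) [IsIntegral X] [IsLocallyNoetherian X]

/-- The subgroup of the principal divisors `div f = ∑ ord_x(f) x`, `f` a nonzero rational function. -/
noncomputable def principalDivisors : AddSubgroup (WeilDivisor X) where
  carrier := {D | ∃ f : X.functionField, f ≠ 0 ∧ ∀ x : PrimeDivisor X, D x = Scheme.ord f x.1}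
  zero_mem' := ⟨1, one_ne_zero, fun x ↦ by
    have h := Scheme.ord_mul (x := x.1) (f := (1 : X.functionField)) one_ne_zero one_ne_zero
    rw [mul_one] at h
    rw [Finsupp.zero_apply]; omega⟩
  add_mem' := by
    rintro D E ⟨f, hf, hD⟩ ⟨g, hg, hE⟩
    exact ⟨f * g, mul_ne_zero hf hg, fun x ↦ by
      rw [Finsupp.add_apply, hD, hE, Scheme.ord_mul hf hg]⟩
  neg_mem' := by
    rintro D ⟨f, hf, hD⟩
    refine ⟨f⁻¹, inv_ne_zero hf, fun x ↦ ?_⟩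
    have h := Scheme.ord_mul (x := x.1) hf (inv_ne_zero hf)
    have h1 := Scheme.ord_mul (x := x.1) (f := (1 : X.functionField)) one_ne_zero one_ne_zero
    rw [mul_inv_cancel₀ hf] at h
    rw [mul_one] at h1
    rw [Finsupp.neg_apply, hD]
    omega

/-- The divisor class group `Cl(X)`: Weil divisors modulo principal divisors. -/
abbrev DivisorClassGroup : Type u := WeilDivisor X ⧸ principalDivisors X

end ClassGroup

section Rays

variable {N : Type u} [AddCommGroup N]

/-- A lattice vector is primitive if it is not a proper multiple of another lattice vector. -/
def IsPrimitive (v : N) : Prop := ∀ (n : ℤ) (w : N), v = n • w → IsUnit n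

/-- The half-line `ℝ≥0 v`. -/
def ray (v : N) : PointedCone ℝ (ℝ ⊗[ℤ] N) := PointedCone.hull ℝ {(1 : ℝ) ⊗ₜ[ℤ] v}

lemma isRationalPolyhedral_ray (v : N) : IsRationalPolyhedral (ray v) :=
  ⟨{v}, by simp [ray]⟩

lemma mem_ray {v : N} {x : ℝ ⊗[ℤ] N} : x ∈ ray v ↔ ∃ c : ℝ, 0 ≤ c ∧ x = c • ((1 : ℝ) ⊗ₜ[ℤ] v) := by
  rw [ray, Submodule.mem_span_singleton]
  constructor
  · rintro ⟨c, rfl⟩; exact ⟨c, c.2, rfl⟩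
  · rintro ⟨c, hc, rfl⟩; exact ⟨⟨c, hc⟩, rfl⟩

lemma mem_dualMonoid_ray {v : N} {u : Module.Dual ℤ N} : u ∈ dualMonoid (ray v) ↔ 0 ≤ u v := by
  rw [mem_dualMonoid]
  constructor
  · intro h
    have := h _ (mem_ray.2 ⟨1, zero_le_one, (one_smul _ _).symm⟩)
    simpa using this
  · intro h x hx
    obtain ⟨c, hc, rfl⟩ := mem_ray.1 hx
    have : (0 : ℝ) ≤ u v := by exact_mod_cast h
    simpa using mul_nonneg hc this

lemma IsPrimitive.exists_eq_one [Module.Free ℤ N] [Module.Finite ℤ N] {v : N} (hv : IsPrimitive v) :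
    ∃ u : Module.Dual ℤ N, u v = 1 := by
  obtain ⟨d, hd⟩ := (IsPrincipalIdealRing.principal
    (LinearMap.range (LinearMap.applyₗ (R := ℤ) (M₂ := ℤ) v))).principal
  let b := Module.finBasis ℤ N
  have hb : ∀ i, ∃ z : ℤ, z * d = b.coord i v := by
    intro i
    have : b.coord i v ∈ LinearMap.range (LinearMap.applyₗ (R := ℤ) (M₂ := ℤ) v) := ⟨b.coord i, rfl⟩
    rw [hd] at this
    obtain ⟨z, hz⟩ := Submodule.mem_span_singleton.1 this
    exact ⟨z, hz⟩
  choose z hz using hb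
  have hu := hv d (∑ i, z i • b i) (by
    conv_lhs => rw [← b.sum_repr v]
    rw [Finset.smul_sum]
    refine Finset.sum_congr rfl fun i _ ↦ ?_
    rw [smul_smul, mul_comm, hz i]; rfl)
  have h1 : (1 : ℤ) ∈ LinearMap.range (LinearMap.applyₗ (R := ℤ) (M₂ := ℤ) v) := by
    rw [hd]
    obtain ⟨e, he⟩ := hu.exists_left_inv
    exact Submodule.mem_span_singleton.2 ⟨e, he⟩
  obtain ⟨u, hu⟩ := h1
  exact ⟨u, hu⟩

lemma ray_injective [Module.Free ℤ N] [Module.Finite ℤ N] {v w : N} (hv : IsPrimitive v)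
    (hw : IsPrimitive w) (h : ray v = ray w) : v = w := by
  obtain ⟨u, hu⟩ := hw.exists_eq_one
  have h1 : (1 : ℝ) ⊗ₜ[ℤ] v ∈ ray w := h ▸ mem_ray.2 ⟨1, zero_le_one, (one_smul _ _).symm⟩
  obtain ⟨c, hc, hvw⟩ := mem_ray.1 h1
  have key : ∀ m : Module.Dual ℤ N, (m v : ℝ) = c * m w := by
    intro m
    simpa using congrArg (m.baseChange ℝ) hvw
  have hcu : c = u v := by rw [key u, hu]; simp
  have hvw' : v = u v • w := by
    let b := Module.finBasis ℤ N
    refine b.ext_elem fun i ↦ ?_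
    have := key (b.coord i)
    rw [hcu] at this
    rw [map_smul]
    have h2 : b.coord i v = u v * b.coord i w := by exact_mod_cast this
    exact h2
  have h0 : 0 ≤ u v := by
    rw [hcu] at hc; exact_mod_cast hc
  rcases Int.isUnit_iff.1 (hv _ _ hvw') with h3 | h3
  · rw [h3, one_smul] at hvw'; exact hvw'
  · omega

variable (k : Type u) [Field k]

/-- The ideal of the divisor `Y(v)` in the chart of the ray through `v`: it is generated by the
characters `x^u` with `⟨u, v⟩ > 0`. -/
noncomputable def rayIdeal (v : N) : Ideal (ChartRing k (ray v)) :=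
  Ideal.span {f | ∃ u : dualMonoid (ray v), 0 < u.1 v ∧ f = AddMonoidAlgebra.single u 1}

open Classical in
/-- The restriction of functions to the divisor `Y(v)`. -/
noncomputable def rayRes (v : N) : ChartRing k (ray v) →ₐ[k] AddMonoidAlgebra k (Module.Dual ℤ N) :=
  AddMonoidAlgebra.lift k _ (dualMonoid (ray v))
    { toFun u := if u.toAdd.1 v = 0 then AddMonoidAlgebra.single u.toAdd.1 1 else 0
      map_one' := by simp [AddMonoidAlgebra.one_def]
      map_mul' a b := by
        have ha := mem_dualMonoid_ray.1 a.toAdd.2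
        have hb := mem_dualMonoid_ray.1 b.toAdd.2
        simp only [toAdd_mul, AddSubmonoid.coe_add, LinearMap.add_apply]
        by_cases h1 : a.toAdd.1 v = 0
        · by_cases h2 : b.toAdd.1 v = 0
          · simp [h1, h2, AddMonoidAlgebra.single_mul_single]
          · simp [h1, h2]
        · rw [if_neg (by omega), if_neg h1, zero_mul] }

lemma ker_rayRes (v : N) : RingHom.ker (rayRes k v) = rayIdeal k v := by
  classical
  have hs : ∀ (u : dualMonoid (ray v)) (c : k), rayRes k v (AddMonoidAlgebra.single u c) =
      if u.1 v = 0 then AddMonoidAlgebra.single u.1 c else 0 := by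
    intro u c
    simp [rayRes]
  apply le_antisymm
  · intro f hf
    have hc : ∀ u : dualMonoid (ray v), u.1 v = 0 → f.coeff u = 0 := by
      intro u hu
      have h1 : ∀ g : ChartRing k (ray v), (rayRes k v g).coeff u.1 = g.coeff u := by
        intro g
        induction g using AddMonoidAlgebra.induction_linear with
        | zero => simp
        | add f g hf hg => simp [hf, hg]
        | single m c =>
          rw [hs]
          split_ifs with hm
          · rw [AddMonoidAlgebra.coeff_single, AddMonoidAlgebra.coeff_single,
              Finsupp.single_apply, Finsupp.single_apply]
            simp only [Subtype.ext_iff]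
          · have : m ≠ u := fun h ↦ hm (h ▸ hu)
            simp [AddMonoidAlgebra.coeff_single, this]
      rw [← h1, (RingHom.mem_ker).1 hf]; simp
    have hsum : f = ∑ u ∈ f.coeff.support, AddMonoidAlgebra.single u (f.coeff u) :=
      f.sum_coeff_single.symm
    rw [hsum]
    refine Ideal.sum_mem _ fun u hu ↦ ?_
    have hpos : 0 < u.1 v := by
      refine lt_of_le_of_ne (mem_dualMonoid_ray.1 u.2) fun h ↦ ?_
      exact (Finsupp.mem_support_iff.1 hu) (hc u h.symm)
    have : AddMonoidAlgebra.single u (f.coeff u) =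
        AddMonoidAlgebra.single 0 (f.coeff u) * AddMonoidAlgebra.single u (1 : k) := by
      rw [AddMonoidAlgebra.single_mul_single, zero_add, mul_one]
    rw [this]
    exact Ideal.mul_mem_left _ _ (Ideal.subset_span ⟨u, hpos, rfl⟩)
  · refine Ideal.span_le.2 ?_
    rintro f ⟨u, hu, rfl⟩
    exact (hs u 1).trans (if_neg hu.ne')

instance isPrime_rayIdeal [Module.Free ℤ N] [Module.Finite ℤ N] (v : N) :
    (rayIdeal k v).IsPrime := by
  rw [← ker_rayRes]
  exact RingHom.ker_isPrime _

lemma height_rayIdeal [Module.Free ℤ N] [Module.Finite ℤ N] {v : N} (hv : IsPrimitive v) :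
    (rayIdeal k v).height = 1 := by
  have := Fan.isNoetherianRing_chartRing k (isRationalPolyhedral_ray v)
  obtain ⟨u, hu⟩ := hv.exists_eq_one
  let u' : dualMonoid (ray v) := ⟨u, mem_dualMonoid_ray.2 (by omega)⟩
  have hspan : rayIdeal k v = Ideal.span {AddMonoidAlgebra.single u' (1 : k)} := by
    apply le_antisymm
    · refine Ideal.span_le.2 ?_
      rintro f ⟨m, hm, rfl⟩
      have hm' : m.1 - u ∈ dualMonoid (ray v) := by
        rw [mem_dualMonoid_ray, LinearMap.sub_apply]; omega
      refine Ideal.mem_span_singleton.2 ⟨AddMonoidAlgebra.single ⟨_, hm'⟩ 1, ?_⟩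
      rw [AddMonoidAlgebra.single_mul_single, one_mul]
      congr 1
      ext1
      simp [u']
    · refine Ideal.span_le.2 ?_
      rintro f rfl
      exact Ideal.subset_span ⟨u', by simp [u', hu], rfl⟩
  apply le_antisymm
  · have : (rayIdeal k v).IsPrincipal := ⟨_, hspan⟩
    exact Ideal.height_le_one_of_isPrincipal_of_mem_minimalPrimes (rayIdeal k v) (rayIdeal k v)
      (by rw [Ideal.minimalPrimes_eq_subsingleton_self]; rfl)
  · have hne : rayIdeal k v ≠ ⊥ := by
      rw [hspan, Ne, Ideal.span_singleton_eq_bot]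
      simp
    rw [Order.one_le_iff_ne_zero]
    exact fun h0 ↦ hne (Ideal.height_eq_zero_iff_eq_bot.1 h0)

end Rays

namespace Fan

variable (k : Type u) [Field k] {N : Type u} [AddCommGroup N] (Δ : Fan N)

/-- The set `Δ(1)` of the rays of a fan, each given by its primitive generator `v`. -/
abbrev Ray : Type u := {v : N // IsPrimitive v ∧ ray v ∈ Δ.cones}

variable {Δ} in
/-- The cone `ℝ≥0 v` of the fan. -/
abbrev Ray.cone (v : Δ.Ray) : Δ.Cone := ⟨ray v.1, v.2.2⟩

variable [Module.Free ℤ N] [Module.Finite ℤ N]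

instance : Finite Δ.Ray := by
  have := Δ.finite.to_subtype
  refine Finite.of_injective (fun v : Δ.Ray ↦ v.cone) fun v w h ↦ ?_
  exact Subtype.ext (ray_injective v.2.1 w.2.1 (congrArg Subtype.val h))

/-- The torus-invariant prime divisor `Y(v)` of the ray `v`. -/
noncomputable def rayDivisor (v : Δ.Ray) : PrimeDivisor (Δ.toricVariety k) :=
  ⟨Δ.chartι k v.cone (⟨rayIdeal k v.1, inferInstance⟩ : PrimeSpectrum (ChartRing k (ray v.1))), by
    exact (coheight_eq_of_isOpenImmersion (Δ.chartι k v.cone)).trans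
      ((idealHeight_eq_coheight (.of (ChartRing k (ray v.1))) _).symm.trans
        (height_rayIdeal k v.2.1))⟩

/-- The divisor class group `Cl(X)` of the toric variety `X(Δ)`. -/
abbrev Cl : Type u := DivisorClassGroup (Δ.toricVariety k)

/-- The class `[Y(v)]` in `Cl(X)`. -/
noncomputable def rayClass (v : Δ.Ray) : Δ.Cl k :=
  QuotientAddGroup.mk (Finsupp.single (Δ.rayDivisor k v) 1)

/-- The Cox ring of the toric variety: the polynomial ring in the rays. -/
abbrev CoxRing : Type u := MvPolynomial Δ.Ray k

/-- The grading of the Cox ring by `Cl(X)`, in which `deg v = [Y(v)]`. -/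
noncomputable abbrev coxGrading : Δ.Cl k → Submodule k (Δ.CoxRing k) :=
  MvPolynomial.weightedHomogeneousSubmodule k (Δ.rayClass k)

noncomputable instance : DecidableEq (Δ.Cl k) := Classical.decEq _

noncomputable instance : GradedAlgebra (Δ.coxGrading k) :=
  MvPolynomial.weightedGradedAlgebra k (Δ.rayClass k)

open Classical in
/-- The monomial `v^σ̄`: the product of the variables of the rays that are not contained in `σ`. -/
noncomputable def coxMonomial (σ : Δ.Cone) : Δ.CoxRing k :=
  letI := Fintype.ofFinite Δ.Ray
  ∏ v : Δ.Ray with ¬ ray v.1 ≤ σ.1, MvPolynomial.X v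

/-- The irrelevant ideal `J_X` of the Cox ring. -/
noncomputable def irrelevantIdeal : Ideal (Δ.CoxRing k) :=
  Ideal.span (Set.range (Δ.coxMonomial k))

/-- The open subset `Spec Cox(X) ∖ V(J_X)`. -/
noncomputable def coxOpen : (Spec (.of (Δ.CoxRing k))).Opens :=
  ⟨(PrimeSpectrum.zeroLocus (R := Δ.CoxRing k) (Δ.irrelevantIdeal k))ᶜ,
    (PrimeSpectrum.isClosed_zeroLocus _).isOpen_compl⟩

/-- The open immersion of `Spec Cox(X)_{v^σ̄}` into `Spec Cox(X) ∖ V(J_X)`. -/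
noncomputable def coxChart (σ : Δ.Cone) :
    Spec (.of (Localization.Away (Δ.coxMonomial k σ))) ⟶ (Δ.coxOpen k).toScheme :=
  IsOpenImmersion.lift (Δ.coxOpen k).ι
    (Spec.map (CommRingCat.ofHom
      (algebraMap (Δ.CoxRing k) (Localization.Away (Δ.coxMonomial k σ))))) (by
    rintro _ ⟨p, rfl⟩
    rw [Scheme.Opens.range_ι]
    intro hp
    have h1 : Δ.coxMonomial k σ ∈ (Spec.map (CommRingCat.ofHom
      (algebraMap (Δ.CoxRing k) (Localization.Away (Δ.coxMonomial k σ)))) p).asIdeal :=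
      hp (Ideal.subset_span ⟨σ, rfl⟩)
    have h2 : algebraMap _ (Localization.Away (Δ.coxMonomial k σ)) (Δ.coxMonomial k σ) ∈
      p.asIdeal := h1
    exact (PrimeSpectrum.isPrime (R := Localization.Away (Δ.coxMonomial k σ)) p).ne_top
      (Ideal.eq_top_of_isUnit_mem _ h2 (IsLocalization.Away.algebraMap_isUnit _)))

end Fan
end Toric

namespace Toric

open MonoidalCategory CartesianMonoidalCategory
open scoped MonObj

section Quotients

universe v₁ v₂ u₁ u₂

/-- Let the group object `G` act on `U`. A morphism `π : U ⟶ X` is a categorical quotient of `U` by `G`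
if it is `G`-invariant, i.e. equalizes the action and the projection `G × U ⟶ U`, and every
`G`-invariant morphism from `U` factors through it in a unique way. -/
structure IsCategoricalQuotient {C : Type u₁} [Category.{v₁} C] [CartesianMonoidalCategory C]
    (G : C) [GrpObj G] {U X : C} [ModObj G U] (π : U ⟶ X) : Prop where
  invariant : γ[G, U] ≫ π = snd G U ≫ π
  universal : ∀ {Z : C} (f : U ⟶ Z), γ[G, U] ≫ f = snd G U ≫ f → ∃! g : X ⟶ Z, π ≫ g = f

open Functor.LaxMonoidal in
/-- A lax monoidal functor maps an action of a monoid object to an action. -/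
@[reducible] def modObjMap {C : Type u₁} [Category.{v₁} C] [MonoidalCategory C]
    {D : Type u₂} [Category.{v₂} D] [MonoidalCategory D] (F : C ⥤ D) [F.LaxMonoidal]
    (M : C) [MonObj M] (X : C) [ModObj M X] :
    letI := F.monObjObj M
    ModObj (F.obj M) (F.obj X) :=
  letI := F.monObjObj M
  { smul := Functor.LaxMonoidal.μ F M X ≫ F.map γ[M, X]
    one_smul := by
      change (ε F ≫ F.map η) ▷ F.obj X ≫ Functor.LaxMonoidal.μ F M X ≫ F.map γ[M, X] =
        (λ_ (F.obj X)).hom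
      rw [comp_whiskerRight, Category.assoc, μ_natural_left_assoc, ← F.map_comp,
        ModObj.one_smul_self, left_unitality]
    mul_smul := by
      change (Functor.LaxMonoidal.μ F M M ≫ F.map μ) ▷ F.obj X ≫
          Functor.LaxMonoidal.μ F M X ≫ F.map γ[M, X] =
        (α_ _ _ _).hom ≫ F.obj M ◁ (Functor.LaxMonoidal.μ F M X ≫ F.map γ[M, X]) ≫
          Functor.LaxMonoidal.μ F M X ≫ F.map γ[M, X]
      rw [comp_whiskerRight, Category.assoc, μ_natural_left_assoc, ← F.map_comp,
        ModObj.mul_smul_self, F.map_comp, F.map_comp, MonoidalCategory.whiskerLeft_comp,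
        Category.assoc, μ_natural_right_assoc, associativity_assoc] }

end Quotients

namespace Fan

variable (k : Type u) [Field k] {N : Type u} [AddCommGroup N] [Module.Free ℤ N] [Module.Finite ℤ N]
  (Δ : Fan N)

/-- The coaction of `k[Cl(X)]` on the Cox ring that belongs to the grading: `v ↦ [Y(v)] ⊗ v`. -/
noncomputable def coaction : Δ.CoxRing k →ₐ[k] AddMonoidAlgebra k (Δ.Cl k) ⊗[k] Δ.CoxRing k :=
  MvPolynomial.aeval fun v ↦
    AddMonoidAlgebra.single (Δ.rayClass k v) (1 : k) ⊗ₜ[k] (MvPolynomial.X v : Δ.CoxRing k)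

open Opposite in
noncomputable instance : ModObj (op (CommAlgCat.of k (AddMonoidAlgebra k (Δ.Cl k))))
    (op (CommAlgCat.of k (Δ.CoxRing k))) where
  smul := (CommAlgCat.ofHom (Δ.coaction k)).op
  one_smul := by
    apply Quiver.Hom.unop_inj
    refine CommAlgCat.hom_ext (MvPolynomial.algHom_ext fun v ↦ ?_)
    change Algebra.TensorProduct.map (Bialgebra.counitAlgHom k (AddMonoidAlgebra k (Δ.Cl k)))
      (AlgHom.id k (Δ.CoxRing k)) (Δ.coaction k (MvPolynomial.X v)) = 1 ⊗ₜ[k] MvPolynomial.X v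
    simp [coaction]
  mul_smul := by
    apply Quiver.Hom.unop_inj
    refine CommAlgCat.hom_ext (MvPolynomial.algHom_ext fun v ↦ ?_)
    change Algebra.TensorProduct.map (Bialgebra.comulAlgHom k (AddMonoidAlgebra k (Δ.Cl k)))
      (AlgHom.id k (Δ.CoxRing k)) (Δ.coaction k (MvPolynomial.X v)) =
      (Algebra.TensorProduct.assoc k k k _ _ _).symm
        (Algebra.TensorProduct.map (AlgHom.id k (AddMonoidAlgebra k (Δ.Cl k))) (Δ.coaction k)
          (Δ.coaction k (MvPolynomial.X v)))
    simp [coaction]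

/-- The group scheme `G = Hom(Cl(X), k^*)`, i.e. the diagonalizable group scheme `Spec k[Cl(X)]` with
character group `Cl(X)`. -/
noncomputable abbrev group : Over (Spec (.of k)) :=
  (Spec (.of (AddMonoidAlgebra k (Δ.Cl k)))).asOver (Spec (.of k))

/-- `Spec Cox(X)` as a scheme over `k`. -/
noncomputable abbrev coxSpec : Over (Spec (.of k)) :=
  (Spec (.of (Δ.CoxRing k))).asOver (Spec (.of k))

noncomputable instance : ModObj (Δ.group k) (Δ.coxSpec k) :=
  letI : (algSpec (.of k)).Braided := braidedAlgSpec
  letI : (algSpec (.of k)).LaxMonoidal := inferInstance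
  modObjMap (algSpec (.of k)) (.op (CommAlgCat.of k (AddMonoidAlgebra k (Δ.Cl k))))
    (.op (CommAlgCat.of k (Δ.CoxRing k)))


lemma smul_coxSpec_left : (γ[Δ.group k, Δ.coxSpec k]).left =
    (pullbackSpecIso k (AddMonoidAlgebra k (Δ.Cl k)) (Δ.CoxRing k)).hom ≫
      Spec.map (CommRingCat.ofHom (Δ.coaction k).toRingHom) := rfl

/-- `Spec Cox(X) ∖ V(J_X)` as a scheme over `k`. -/
noncomputable abbrev coxU : Over (Spec (.of k)) :=
  Over.mk ((Δ.coxOpen k).ι ≫ (Δ.coxSpec k).hom)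

/-- The inclusion of `Spec Cox(X) ∖ V(J_X)` into `Spec Cox(X)`. -/
noncomputable abbrev coxUι : Δ.coxU k ⟶ Δ.coxSpec k := Over.homMk (Δ.coxOpen k).ι

instance : Mono (Δ.coxUι k) := by
  have : Mono (Δ.coxUι k).left := inferInstanceAs (Mono (Δ.coxOpen k).ι)
  exact Over.mono_of_mono_left _

lemma coaction_coxMonomial (σ : Δ.Cone) : ∃ e : AddMonoidAlgebra k (Δ.Cl k) ⊗[k] Δ.CoxRing k,
    IsUnit e ∧ Δ.coaction k (Δ.coxMonomial k σ) = e * (1 ⊗ₜ Δ.coxMonomial k σ) := by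
  classical
  let := Fintype.ofFinite Δ.Ray
  refine ⟨∏ v : Δ.Ray with ¬ ray v.1 ≤ σ.1,
    AddMonoidAlgebra.single (Δ.rayClass k v) (1 : k) ⊗ₜ[k] (1 : Δ.CoxRing k), ?_, ?_⟩
  · refine IsUnit.prod_iff.2 fun v _ ↦ ?_
    refine IsUnit.of_mul_eq_one (AddMonoidAlgebra.single (-Δ.rayClass k v) (1 : k) ⊗ₜ[k] 1) ?_
    rw [Algebra.TensorProduct.tmul_mul_tmul, AddMonoidAlgebra.single_mul_single, add_neg_cancel,
      _root_.mul_one, _root_.mul_one]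
    rfl
  · have h : (1 : AddMonoidAlgebra k (Δ.Cl k)) ⊗ₜ[k] Δ.coxMonomial k σ =
        ∏ v : Δ.Ray with ¬ ray v.1 ≤ σ.1, (1 ⊗ₜ[k] MvPolynomial.X v) :=
      map_prod (Algebra.TensorProduct.includeRight :
        Δ.CoxRing k →ₐ[k] AddMonoidAlgebra k (Δ.Cl k) ⊗[k] Δ.CoxRing k) _ _
    have h' : Δ.coaction k (Δ.coxMonomial k σ) =
        ∏ v : Δ.Ray with ¬ ray v.1 ≤ σ.1, Δ.coaction k (MvPolynomial.X v) :=
      map_prod (Δ.coaction k).toRingHom _ _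
    rw [h, h', ← Finset.prod_mul_distrib]
    refine Finset.prod_congr rfl fun v _ ↦ ?_
    simp [coaction]

lemma exists_coxMonomial_notMem (p : Spec (.of (Δ.CoxRing k))) :
    p ∈ Δ.coxOpen k ↔ ∃ σ, Δ.coxMonomial k σ ∉ p.asIdeal := by
  change ¬ ((Δ.irrelevantIdeal k : Set (Δ.CoxRing k)) ⊆ p.asIdeal) ↔ _
  rw [irrelevantIdeal, SetLike.coe_subset_coe, Ideal.span_le, Set.range_subset_iff]
  simp

/-- The open set `Spec Cox(X) ∖ V(J_X)` is stable under `G`. -/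
lemma range_smul_coxU : Set.range ((Δ.group k ◁ Δ.coxUι k) ≫ γ[Δ.group k, Δ.coxSpec k]).left ⊆
    Set.range (Δ.coxOpen k).ι := by
  rintro _ ⟨z, rfl⟩
  refine (Set.ext_iff.mp (Scheme.Opens.range_ι (Δ.coxOpen k)) _).2 ?_
  let z₁ : (Δ.group k ⊗ Δ.coxSpec k).left := (Δ.group k ◁ Δ.coxUι k).left z
  let P : Spec (.of (AddMonoidAlgebra k (Δ.Cl k) ⊗[k] Δ.CoxRing k)) :=
    (pullbackSpecIso k (AddMonoidAlgebra k (Δ.Cl k)) (Δ.CoxRing k)).hom z₁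
  have hsnd : (snd (Δ.group k) (Δ.coxSpec k)).left z₁ = (Δ.coxOpen k).ι
      ((snd (Δ.group k) (Δ.coxU k)).left z) := by
    have := congr(($(whiskerLeft_snd (Δ.group k) (Δ.coxUι k))).left z)
    exact this
  have hP : (snd (Δ.group k) (Δ.coxSpec k)).left z₁ = Spec.map (CommRingCat.ofHom
      (Algebra.TensorProduct.includeRight :
        Δ.CoxRing k →ₐ[k] AddMonoidAlgebra k (Δ.Cl k) ⊗[k] Δ.CoxRing k).toRingHom) P := by
    have := congr(($(pullbackSpecIso_hom_snd k (AddMonoidAlgebra k (Δ.Cl k)) (Δ.CoxRing k))) z₁)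
    exact this.symm
  have hmem : (snd (Δ.group k) (Δ.coxSpec k)).left z₁ ∈ Δ.coxOpen k := by
    rw [hsnd]; exact Subtype.property _
  obtain ⟨σ, hσ⟩ := (Δ.exists_coxMonomial_notMem k _).1 hmem
  refine (Δ.exists_coxMonomial_notMem k _).2 ⟨σ, fun h ↦ hσ ?_⟩
  rw [hP]
  have h' : Δ.coaction k (Δ.coxMonomial k σ) ∈ P.asIdeal := h
  obtain ⟨e, he, h2⟩ := Δ.coaction_coxMonomial k σ
  rw [h2] at h'
  exact (((PrimeSpectrum.isPrime P).mem_or_mem h').resolve_left fun h3 ↦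
    (PrimeSpectrum.isPrime P).ne_top (Ideal.eq_top_of_isUnit_mem _ h3 he))

/-- The action of `G` on the open set `Spec Cox(X) ∖ V(J_X)`, restricted from `Spec Cox(X)`. -/
noncomputable def actU : Δ.group k ⊗ Δ.coxU k ⟶ Δ.coxU k :=
  Over.homMk (IsOpenImmersion.lift (Δ.coxOpen k).ι
    ((Δ.group k ◁ Δ.coxUι k) ≫ γ[Δ.group k, Δ.coxSpec k]).left (Δ.range_smul_coxU k))
    ((IsOpenImmersion.lift_fac_assoc (Δ.coxOpen k).ι _ (Δ.range_smul_coxU k) _).trans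
      (Over.w ((Δ.group k ◁ Δ.coxUι k) ≫ γ[Δ.group k, Δ.coxSpec k])))

lemma actU_coxUι : Δ.actU k ≫ Δ.coxUι k = (Δ.group k ◁ Δ.coxUι k) ≫ γ[Δ.group k, Δ.coxSpec k] := by
  ext1
  exact IsOpenImmersion.lift_fac (Δ.coxOpen k).ι _ (Δ.range_smul_coxU k)

noncomputable instance : ModObj (Δ.group k) (Δ.coxU k) where
  smul := Δ.actU k
  one_smul := by
    change η ▷ Δ.coxU k ≫ Δ.actU k = (λ_ _).hom
    rw [← cancel_mono (Δ.coxUι k), Category.assoc, actU_coxUι, ← whisker_exchange_assoc,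
      ModObj.one_smul_self, leftUnitor_naturality]
  mul_smul := by
    change μ ▷ Δ.coxU k ≫ Δ.actU k = (α_ _ _ _).hom ≫ Δ.group k ◁ Δ.actU k ≫ Δ.actU k
    rw [← cancel_mono (Δ.coxUι k), Category.assoc, actU_coxUι, ← whisker_exchange_assoc,
      ModObj.mul_smul_self]
    simp only [Category.assoc, actU_coxUι]
    rw [← MonoidalCategory.whiskerLeft_comp_assoc, actU_coxUι]
    simp

/-- The toric variety as a scheme over `k`. -/
noncomputable abbrev toricVarietyOver : Over (Spec (.of k)) := Over.mk (Δ.toricVarietyStr k)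

/-- The isomorphism `φ : k[σ^∨ ∩ M] ≅ (Cox(X)_{v^σ̄})_0` is given by `x^u ↦ ∏ v ^ ⟨u, v⟩`, the product
over all rays. The factors with `⟨u, v⟩ < 0` (which occur for rays outside `σ` only) are cleared from
the right side. -/
def IsMonomialIso (σ : Δ.Cone) (φ : ChartRing k σ.1 ≃+*
    HomogeneousLocalization.Away (Δ.coxGrading k) (Δ.coxMonomial k σ)) : Prop :=
  letI := Fintype.ofFinite Δ.Ray
  ∀ (u : dualMonoid σ.1) (c : k),
    (φ (AddMonoidAlgebra.single u c)).val *
        algebraMap (Δ.CoxRing k) (Localization.Away (Δ.coxMonomial k σ))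
          (∏ v : Δ.Ray, MvPolynomial.X v ^ (-(u.1 v.1)).toNat) =
      algebraMap (Δ.CoxRing k) (Localization.Away (Δ.coxMonomial k σ))
        (MvPolynomial.C c * ∏ v : Δ.Ray, MvPolynomial.X v ^ (u.1 v.1).toNat)

/-- The inclusion of the part of degree `0` of `Cox(X)_{v^σ̄}`. -/
noncomputable def degreeZeroIncl (σ : Δ.Cone) :
    HomogeneousLocalization.Away (Δ.coxGrading k) (Δ.coxMonomial k σ) →+*
      Localization.Away (Δ.coxMonomial k σ) :=
  algebraMap _ _

end Fan
end Toric

/-! Everything is reduced to one cone `σ` at a time. Localizing the Cox ring at `v^σ̄` gives the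
monoid algebra of the exponent vectors `s ∈ ℤ^Δ(1)` with `s_v ≥ 0` for the rays `v` in `σ`
(`coxEquiv`), and the monomial of `s` has degree `∑ s_v [Y(v)]`. The sequence `M → ℤ^Δ(1) → Cl(X)`
is exact in the middle (`sum_smul_rayClass_eq_zero_iff`), so the exponents of degree `0` are the
vectors `(⟨u, v⟩)_v`. As `σ` is generated by its rays (`eq_hull_rays`), the sign conditions on such
a vector say that `u ∈ σ^∨`; non-degeneracy makes `u` unique. Hence the part of degree `0` is `k[σ^∨
∩ M]`.

Exactness rests on three facts: `x^u` has order `⟨u, v⟩` along `Y(v)` (`characterOrd_rayDivisor`);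
every prime divisor other than the `Y(v)` meets the torus (`eq_rayDivisor_or_mem_torus`); and a
rational function without zeros and poles on the torus is a constant times a character
(`exists_character_of_ord_eq_zero`), because Laurent rings are factorial with monomial units.

For the quotient property, projection to degree `0` is a Reynolds operator `E : A → B` on a chart
(`isReynolds_degCoaction`). It makes `Spec A → Spec B` surjective, hence an epimorphism, `Spec B`
being integral. The target `Z` of an invariant morphism is an arbitrary scheme, so `Spec B` must
first be covered by basic open sets whose preimages land in affine open subsets of `Z`
(`exists_basicOpen_le`). There the morphism is a ring homomorphism with invariant values and
descends. The local factorizations glue because surjections to integral schemes remain epimorphisms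
over open subschemes (`exists_factorization_of_local`).

The chart quotients are compatible with passage to faces and glue to `quotientMap`. Since `X` is the
colimit of its charts, factorizations on the charts assemble to one on `X`, again by the epimorphism
property. -/

namespace Toric

/-! ### Separation for strongly convex cones. -/

section Cones

variable {V : Type*} [AddCommGroup V] [Module ℝ V]

/-- A finitely generated strongly convex cone whose generators are nonzero lies in an open half
space. -/
lemma exists_dual_pos [FiniteDimensional ℝ V] (T : Set V) (hT : T.Finite) (h0 : (0 : V) ∉ T)
    (hsc : ∀ x ∈ PointedCone.hull ℝ T, -x ∈ PointedCone.hull ℝ T → x = 0) :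
    ∃ w : Module.Dual ℝ V, ∀ t ∈ T, 0 < w t := by
  let e : V ≃ₗ[ℝ] (Fin (Module.finrank ℝ V) → ℝ) := (Module.finBasis ℝ V).equivFun
  -- Strong convexity makes the nonzero points of the cone a convex set, so the convex hull of `T`
  -- misses `0`. The hull of a finite set is closed and can be strictly separated from `0`; this is
  -- done in coordinates, since `V` has no topology.
  have hc : Convex ℝ {x : V | x ∈ PointedCone.hull ℝ T ∧ x ≠ 0} := by
    intro x hx y hy a b ha hb hab
    refine ⟨(PointedCone.hull ℝ T).convex hx.1 hy.1 ha hb hab, fun h ↦ ?_⟩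
    have hax : a • x ∈ PointedCone.hull ℝ T := PointedCone.smul_mem _ ha hx.1
    have hby : b • y ∈ PointedCone.hull ℝ T := PointedCone.smul_mem _ hb hy.1
    have h1 : a • x = 0 := hsc _ hax (by rwa [neg_eq_of_add_eq_zero_right h])
    have h2 : b • y = 0 := by rwa [h1, zero_add] at h
    have h3 : a = 0 := (smul_eq_zero.1 h1).resolve_right hx.2
    have h4 : b = 0 := (smul_eq_zero.1 h2).resolve_right hy.2
    rw [h3, h4] at hab
    norm_num at hab
  have hsub : convexHull ℝ T ⊆ {x : V | x ∈ PointedCone.hull ℝ T ∧ x ≠ 0} :=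
    convexHull_min (fun t ht ↦ ⟨Submodule.subset_span ht, fun h ↦ h0 (h ▸ ht)⟩) hc
  have h0' : (0 : Fin (Module.finrank ℝ V) → ℝ) ∉ convexHull ℝ (e '' T) := by
    have : (e : V →ₗ[ℝ] (Fin (Module.finrank ℝ V) → ℝ)) '' convexHull ℝ T = convexHull ℝ (e '' T) :=
      LinearMap.image_convexHull _ _
    rw [← this]
    rintro ⟨x, hx, hx0⟩
    exact (hsub hx).2 (e.map_eq_zero_iff.1 hx0)
  obtain ⟨f, c, hf0, hf⟩ := geometric_hahn_banach_point_closed (convex_convexHull ℝ (e '' T))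
    ((hT.image e).isClosed_convexHull ..) h0'
  refine ⟨(f : (Fin (Module.finrank ℝ V) → ℝ) →ₗ[ℝ] ℝ) ∘ₗ (e : V →ₗ[ℝ] _), fun t ht ↦ ?_⟩
  have := hf (e t) (subset_convexHull ℝ _ ⟨t, ht, rfl⟩)
  rw [map_zero] at hf0
  exact hf0.trans this

/-- A sum of nonnegative terms vanishes only if each term does. Thus `w` exhibits `0` as a face. -/
lemma nonneg_and_eq_zero_of_mem_hull {T : Set V} {w : Module.Dual ℝ V} (hw : ∀ t ∈ T, 0 < w t)
    {x : V} (hx : x ∈ PointedCone.hull ℝ T) : 0 ≤ w x ∧ (w x = 0 → x = 0) := by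
  induction hx using Submodule.span_induction with
  | mem x hx => exact ⟨(hw x hx).le, fun h ↦ absurd h (hw x hx).ne'⟩
  | zero => simp
  | add x y _ _ hx hy =>
    rw [map_add]
    exact ⟨add_nonneg hx.1 hy.1, fun h ↦ by
      rw [hx.2 (by linarith [hx.1, hy.1]), hy.2 (by linarith [hx.1, hy.1]), add_zero]⟩
  | smul a x _ hx =>
    rw [← Nonneg.coe_smul, map_smul, smul_eq_mul]
    refine ⟨mul_nonneg a.2 hx.1, fun h ↦ ?_⟩
    rcases mul_eq_zero.1 h with h | h
    · rw [h, zero_smul]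
    · rw [hx.2 h, smul_zero]

/-- If `s` is not redundant among the generators of a strongly convex cone, it spans an exposed
ray. -/
lemma exists_dual_of_notMem_hull [FiniteDimensional ℝ V] {T : Set V} (hT : T.Finite) {s : V}
    (hs : s ∉ PointedCone.hull ℝ T)
    (hsc : ∀ x ∈ PointedCone.hull ℝ (insert s T), -x ∈ PointedCone.hull ℝ (insert s T) → x = 0) :
    ∃ w : Module.Dual ℝ V, w s = 0 ∧ ∀ t ∈ T, 0 < w t ∨ t = 0 := by
  -- Modulo the line of `s`, the image of the cone of `T` is again strongly convex. A form that is
  -- positive on its nonzero generators pulls back to one that kills `s`.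
  let q := (ℝ ∙ s).mkQ
  have hle : PointedCone.hull ℝ T ≤ PointedCone.hull ℝ (insert s T) :=
    Submodule.span_mono (Set.subset_insert _ _)
  have hsm : s ∈ PointedCone.hull ℝ (insert s T) := Submodule.subset_span (Set.mem_insert _ _)
  -- The cone of `T` meets the line of `s` only in `0`: for `c ≤ 0` by strong convexity, for `c > 0`
  -- because `s` would be redundant.
  have key : ∀ x ∈ PointedCone.hull ℝ T, ∀ c : ℝ, x = c • s → x = 0 := by
    intro x hx c hxc
    rcases le_or_gt c 0 with hc | hc
    · refine hsc x (hle hx) ?_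
      rw [hxc, ← neg_smul]
      exact PointedCone.smul_mem _ (by linarith) hsm
    · refine absurd ?_ hs
      have : s = c⁻¹ • x := by rw [hxc, smul_smul, inv_mul_cancel₀ hc.ne', one_smul]
      rw [this]
      exact PointedCone.smul_mem _ (by positivity) hx
  have hmap : PointedCone.hull ℝ (q '' (T \ {0})) = (PointedCone.hull ℝ T).map q := by
    have : PointedCone.hull ℝ T = PointedCone.hull ℝ (T \ {0}) :=
      (Submodule.span_sdiff_singleton_zero ..).symm
    rw [this]
    rw [PointedCone.map, Submodule.map_span]
    rfl
  obtain ⟨w, hw⟩ := exists_dual_pos (q '' (T \ {0})) ((hT.subset Set.sdiff_subset).image q) (by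
      rintro ⟨t, ht, ht0⟩
      obtain ⟨c, hc⟩ := Submodule.mem_span_singleton.1 ((Submodule.Quotient.mk_eq_zero _).1 ht0)
      exact ht.2 (key t (Submodule.subset_span ht.1) c hc.symm)) (by
      intro x hx hnx
      rw [hmap] at hx hnx
      obtain ⟨a, ha, rfl⟩ := PointedCone.mem_map.1 hx
      obtain ⟨b, hb, hab⟩ := PointedCone.mem_map.1 hnx
      have h0 : q (a + b) = 0 := by rw [map_add, hab, add_neg_cancel]
      obtain ⟨c, hc⟩ := Submodule.mem_span_singleton.1 ((Submodule.Quotient.mk_eq_zero _).1 h0)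
      have h1 := key (a + b) (add_mem ha hb) c hc.symm
      have h2 := hsc a (hle ha) (by rw [neg_eq_of_add_eq_zero_right h1]; exact hle hb)
      rw [h2, map_zero])
  refine ⟨w ∘ₗ q, ?_, fun t ht ↦ ?_⟩
  · have : q s = 0 := (Submodule.Quotient.mk_eq_zero _).2 (Submodule.mem_span_singleton_self s)
    rw [LinearMap.comp_apply, this, map_zero]
  · by_cases h : t = 0
    · exact Or.inr h
    · exact Or.inl (hw _ ⟨t, ⟨ht, h⟩, rfl⟩)

end Cones

/-! ### Primitive vectors and generators of rational cones. -/

section Lattice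

variable {N : Type u} [AddCommGroup N] [Module.Free ℤ N] [Module.Finite ℤ N]

/-- The values at `s` of all integral forms make up an ideal `dℤ`, so `d` divides every coordinate
of `s`. A form with value `d` at `s` has value `1` at `s / d`, which forces primitivity. A negative
`d` is repaired by changing both signs. -/
lemma exists_pos_smul_primitive {s : N} (hs : s ≠ 0) :
    ∃ (d : ℤ) (v : N), 0 < d ∧ IsPrimitive v ∧ s = d • v := by
  obtain ⟨d, hd⟩ := (IsPrincipalIdealRing.principal
    (LinearMap.range (LinearMap.applyₗ (R := ℤ) (M₂ := ℤ) s))).principal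
  let b := Module.finBasis ℤ N
  have hb : ∀ i, ∃ z : ℤ, z * d = b.coord i s := by
    intro i
    have : b.coord i s ∈ LinearMap.range (LinearMap.applyₗ (R := ℤ) (M₂ := ℤ) s) := ⟨b.coord i, rfl⟩
    rw [hd] at this
    exact Submodule.mem_span_singleton.1 this
  choose z hz using hb
  obtain ⟨m, hm⟩ : d ∈ LinearMap.range (LinearMap.applyₗ (R := ℤ) (M₂ := ℤ) s) := by
    rw [hd]; exact Submodule.mem_span_singleton_self d
  replace hm : m s = d := hm
  have hsd : s = d • ∑ i, z i • b i := by
    conv_lhs => rw [← b.sum_repr s]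
    rw [Finset.smul_sum]
    refine Finset.sum_congr rfl fun i _ ↦ ?_
    rw [smul_smul, mul_comm, hz i]; rfl
  set v := ∑ i, z i • b i
  have hd0 : d ≠ 0 := by rintro rfl; exact hs (by rw [hsd, zero_smul])
  have hmv : m v = 1 := by
    have : d * m v = d * 1 := by rw [mul_one, ← smul_eq_mul, ← map_smul, ← hsd, hm]
    exact mul_left_cancel₀ hd0 this
  have hprim : ∀ (m : Module.Dual ℤ N) (v : N), m v = 1 → IsPrimitive v := by
    intro m v hmv n w hvw
    rw [hvw, map_smul, smul_eq_mul] at hmv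
    exact IsUnit.of_mul_eq_one _ hmv
  rcases lt_or_gt_of_ne hd0 with h | h
  · exact ⟨-d, -v, by omega, hprim (-m) (-v) (by simpa using hmv), by rw [neg_smul_neg, hsd]⟩
  · exact ⟨d, v, h, hprim m v hmv, hsd⟩

omit [Module.Free ℤ N] [Module.Finite ℤ N] in
lemma ray_smul {d : ℤ} (hd : 0 < d) (v : N) : ray (d • v) = ray v := by
  have hd' : (0 : ℝ) < d := by exact_mod_cast hd
  have h : (1 : ℝ) ⊗ₜ[ℤ] (d • v) = (d : ℝ) • ((1 : ℝ) ⊗ₜ[ℤ] v) := by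
    rw [← TensorProduct.smul_tmul, TensorProduct.smul_tmul']; simp
  ext x
  rw [mem_ray, mem_ray]
  constructor
  · rintro ⟨c, hc, rfl⟩
    exact ⟨c * d, by positivity, by rw [h, smul_smul]⟩
  · rintro ⟨c, hc, rfl⟩
    exact ⟨c / d, by positivity, by rw [h, smul_smul, div_mul_cancel₀ _ hd'.ne']⟩

omit [Module.Free ℤ N] in
/-- A strongly convex rational cone is generated by lattice vectors that span exposed rays. -/
lemma IsRationalPolyhedral.exists_generators {σ : PointedCone ℝ (ℝ ⊗[ℤ] N)}
    (hσ : IsRationalPolyhedral σ) (hsc : ∀ x ∈ σ, -x ∈ σ → x = 0) :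
    ∃ S : Finset N, σ = PointedCone.hull ℝ ((fun n : N ↦ (1 : ℝ) ⊗ₜ[ℤ] n) '' (S : Set N)) ∧
      ∀ s ∈ S, (1 : ℝ) ⊗ₜ[ℤ] s ≠ 0 ∧ IsFace (ray s) σ := by
  classical
  -- In an inclusion-minimal generating set no generator lies in the cone of the others, so each of
  -- them is exposed by `exists_dual_of_notMem_hull`.
  obtain ⟨S, hS, hmin⟩ := exists_minimal_of_wellFoundedLT (fun S : Finset N ↦
    σ = PointedCone.hull ℝ ((fun n : N ↦ (1 : ℝ) ⊗ₜ[ℤ] n) '' (S : Set N))) hσ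
  refine ⟨S, hS, fun s hs ↦ ?_⟩
  set T : Set (ℝ ⊗[ℤ] N) := (fun n : N ↦ (1 : ℝ) ⊗ₜ[ℤ] n) '' (S.erase s : Finset N) with hT
  have hins : insert ((1 : ℝ) ⊗ₜ[ℤ] s) T = (fun n : N ↦ (1 : ℝ) ⊗ₜ[ℤ] n) '' (S : Set N) := by
    rw [hT, ← Set.image_insert_eq, ← Finset.coe_insert, Finset.insert_erase hs]
  have hnot : (1 : ℝ) ⊗ₜ[ℤ] s ∉ PointedCone.hull ℝ T := by
    intro h
    have h1 : σ = PointedCone.hull ℝ T := by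
      rw [hS, ← hins]
      exact Submodule.span_insert_eq_span h
    exact Finset.notMem_erase s S (hmin h1 (Finset.erase_subset s S) hs)
  have hfin : T.Finite := (Finset.finite_toSet _).image _
  have hsc' := hsc
  rw [hS, ← hins] at hsc'
  obtain ⟨w, hw0, hw⟩ := exists_dual_of_notMem_hull hfin hnot hsc'
  have hw' : ∀ t ∈ T \ {0}, 0 < w t := fun t ht ↦ (hw t ht.1).resolve_right ht.2
  have hTT : PointedCone.hull ℝ T = PointedCone.hull ℝ (T \ {0}) :=
    (Submodule.span_sdiff_singleton_zero ..).symm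
  -- The form `w` sees only the summand `z`, and `w z = 0` forces `z = 0`. So the face `w = 0` is
  -- the ray of `s`.
  have hdec : ∀ x ∈ σ, ∃ a : ℝ, 0 ≤ a ∧ ∃ z ∈ PointedCone.hull ℝ T,
      x = a • ((1 : ℝ) ⊗ₜ[ℤ] s) + z := by
    intro x hx
    rw [hS, ← hins] at hx
    obtain ⟨a, z, hz, h⟩ := Submodule.mem_span_insert.1 hx
    exact ⟨a, a.2, z, hz, h⟩
  refine ⟨fun h ↦ hnot (h ▸ zero_mem _), w, fun x hx ↦ ?_, fun x ↦ ⟨fun hx ↦ ?_, ?_⟩⟩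
  · obtain ⟨a, ha, z, hz, rfl⟩ := hdec x hx
    rw [hTT] at hz
    rw [map_add, map_smul, hw0, smul_zero, zero_add]
    exact (nonneg_and_eq_zero_of_mem_hull hw' hz).1
  · obtain ⟨c, hc, rfl⟩ := mem_ray.1 hx
    refine ⟨PointedCone.smul_mem _ hc ?_, by rw [map_smul, hw0, smul_zero]⟩
    rw [hS]
    exact Submodule.subset_span ⟨s, hs, rfl⟩
  · rintro ⟨hx, hx0⟩
    obtain ⟨a, ha, z, hz, rfl⟩ := hdec x hx
    rw [hTT] at hz
    rw [map_add, map_smul, hw0, smul_zero, zero_add] at hx0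
    rw [(nonneg_and_eq_zero_of_mem_hull hw' hz).2 hx0, add_zero]
    exact mem_ray.2 ⟨a, ha, rfl⟩

end Lattice

/-! ### The rays of a fan and its zero cone. -/

namespace Fan

variable {N : Type u} [AddCommGroup N] [Module.Free ℤ N] [Module.Finite ℤ N] (Δ : Fan N)

/-- A cone of a fan is generated by the rays of the fan it contains. -/
lemma eq_hull_rays (σ : Δ.Cone) : σ.1 =
    PointedCone.hull ℝ ((fun n : N ↦ (1 : ℝ) ⊗ₜ[ℤ] n) ''
      {n | ∃ v : Δ.Ray, ray v.1 ≤ σ.1 ∧ v.1 = n}) := by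
  obtain ⟨S, hS, hface⟩ := (Δ.rational σ.1 σ.2).exists_generators (Δ.stronglyConvex σ.1 σ.2)
  apply le_antisymm
  · conv_lhs => rw [hS]
    refine Submodule.span_le.2 ?_
    rintro _ ⟨s, hs, rfl⟩
    obtain ⟨hs0, hf⟩ := hface s hs
    -- The generator need not be primitive, but its primitive vector spans the same exposed ray,
    -- which belongs to the fan because it is a face.
    obtain ⟨d, v, hd, hv, rfl⟩ := exists_pos_smul_primitive (s := s)
      (fun h ↦ hs0 (by rw [h, TensorProduct.tmul_zero]))
    rw [ray_smul hd] at hf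
    have hle : ray v ≤ σ.1 := fun x hx ↦ by
      obtain ⟨w, -, hw⟩ := hf
      exact ((hw x).1 hx).1
    have hmem : (1 : ℝ) ⊗ₜ[ℤ] (d • v) ∈ ray v := by
      rw [← ray_smul hd]; exact mem_ray.2 ⟨1, zero_le_one, (one_smul _ _).symm⟩
    refine Submodule.span_mono ?_ hmem
    rintro _ rfl
    exact ⟨v, ⟨⟨v, hv, Δ.face_mem _ σ.2 _ hf⟩, hle, rfl⟩, rfl⟩
  · refine Submodule.span_le.2 ?_
    rintro _ ⟨_, ⟨v, hv, rfl⟩, rfl⟩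
    exact hv (mem_ray.2 ⟨1, zero_le_one, (one_smul _ _).symm⟩)

omit [Module.Free ℤ N] [Module.Finite ℤ N] in
lemma tmul_mem_of_ray_le {v : N} {σ : PointedCone ℝ (ℝ ⊗[ℤ] N)} (h : ray v ≤ σ) :
    (1 : ℝ) ⊗ₜ[ℤ] v ∈ σ := h (mem_ray.2 ⟨1, zero_le_one, (one_smul _ _).symm⟩)

/-- By `eq_hull_rays` nonnegativity need only be tested on the rays. This matches `σ^∨` with the
sign conditions on exponents of Laurent monomials. -/
lemma mem_dualMonoid_iff (σ : Δ.Cone) (u : Module.Dual ℤ N) :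
    u ∈ dualMonoid σ.1 ↔ ∀ v : Δ.Ray, ray v.1 ≤ σ.1 → 0 ≤ u v.1 := by
  constructor
  · intro h v hv
    have := h _ (tmul_mem_of_ray_le hv)
    simpa using this
  · intro h
    rw [mem_dualMonoid, Δ.eq_hull_rays σ]
    refine nonneg_on_hull ?_
    rintro _ ⟨v, hv, rfl⟩
    simpa using h v hv

/-- A form that kills all rays kills all cones, so its kernel is everything by non-degeneracy. This
is the injectivity of `M → ℤ^Δ(1)`. -/
lemma eq_zero_of_forall_ray (hΔ : Δ.IsNondegenerate) {u : Module.Dual ℤ N}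
    (h : ∀ v : Δ.Ray, u v.1 = 0) : u = 0 := by
  have h1 := hΔ (LinearMap.ker (u.baseChange ℝ)) (fun σ hσ x hx ↦ by
    replace hx := (Δ.eq_hull_rays ⟨σ, hσ⟩).le hx
    rw [LinearMap.mem_ker]
    -- With `w = 0`, `zero_of_hull` says that a form vanishing on the generators vanishes on the
    -- cone.
    exact zero_of_hull (w := 0) (by simp) (by rintro _ ⟨v, -, rfl⟩ -; simp [h v]) x hx rfl)
  ext n
  have h2 : (1 : ℝ) ⊗ₜ[ℤ] n ∈ LinearMap.ker (u.baseChange ℝ) := by rw [h1]; trivial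
  simpa using h2

/-- There is an integral form that is positive on all rays of a given cone. -/
lemma exists_mem_dualMonoid_pos (σ : Δ.Cone) :
    ∃ u ∈ dualMonoid σ.1, (∀ v : Δ.Ray, ray v.1 ≤ σ.1 → 0 < u v.1) ∧
      ∀ x ∈ σ.1, u.baseChange ℝ x = 0 → x = 0 := by
  set T : Set (ℝ ⊗[ℤ] N) := (fun n : N ↦ (1 : ℝ) ⊗ₜ[ℤ] n) ''
      {n | ∃ v : Δ.Ray, ray v.1 ≤ σ.1 ∧ v.1 = n} with hT
  have hσ : σ.1 = PointedCone.hull ℝ T := Δ.eq_hull_rays σ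
  have hfin : T.Finite := by
    refine Set.Finite.image _ ((Set.finite_range (fun v : Δ.Ray ↦ v.1)).subset ?_)
    rintro _ ⟨v, -, rfl⟩
    exact ⟨v, rfl⟩
  have h0 : (0 : ℝ ⊗[ℤ] N) ∉ T := by
    rintro ⟨_, ⟨v, -, rfl⟩, h⟩
    obtain ⟨u, hu⟩ := v.2.1.exists_eq_one
    have := congrArg (u.baseChange ℝ) h
    simp [hu] at this
  have hsc := Δ.stronglyConvex σ.1 σ.2
  rw [hσ] at hsc
  obtain ⟨w, hw⟩ := exists_dual_pos T hfin h0 hsc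
  -- Since `0` is a face, it is cut out by an integral form; such a form is positive on every
  -- nonzero vector of `σ`.
  have hbot : IsFace ⊥ σ.1 := by
    refine ⟨w, fun x hx ↦ ?_, fun x ↦ ?_⟩
    · rw [hσ] at hx; exact (nonneg_and_eq_zero_of_mem_hull hw hx).1
    · rw [Submodule.mem_bot]
      refine ⟨by rintro rfl; simp, fun h ↦ ?_⟩
      rw [hσ] at h
      exact (nonneg_and_eq_zero_of_mem_hull hw h.1).2 h.2
  obtain ⟨u, hu, hu'⟩ := hbot.exists_integral (Δ.rational σ.1 σ.2)
  have hz : ∀ x ∈ σ.1, u.baseChange ℝ x = 0 → x = 0 := fun x hx h ↦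
    (Submodule.mem_bot _).1 ((hu' x).2 ⟨hx, h⟩)
  refine ⟨u, hu, fun v hv ↦ ?_, hz⟩
  refine lt_of_le_of_ne ((Δ.mem_dualMonoid_iff σ u).1 hu v hv) fun h ↦ ?_
  refine h0 ⟨v.1, ⟨v, hv, rfl⟩, ?_⟩
  exact hz _ (tmul_mem_of_ray_le hv) (by simp [← h])

lemma bot_mem_cones : (⊥ : PointedCone ℝ (ℝ ⊗[ℤ] N)) ∈ Δ.cones := by
  obtain ⟨σ, hσ⟩ := Δ.nonempty
  obtain ⟨u, hu, -, h0⟩ := Δ.exists_mem_dualMonoid_pos ⟨σ, hσ⟩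
  refine Δ.face_mem σ hσ _ ⟨u.baseChange ℝ, hu, fun x ↦ ?_⟩
  rw [Submodule.mem_bot]
  exact ⟨by rintro rfl; simp, fun h ↦ h0 x h.1 h.2⟩

/-- The zero cone of a fan, whose chart is the torus. -/
def zeroCone : Δ.Cone := ⟨⊥, Δ.bot_mem_cones⟩

lemma zeroCone_le (σ : Δ.Cone) : Δ.zeroCone ≤ σ := (bot_le : (⊥ : PointedCone ℝ _) ≤ σ.1)

lemma mem_dualMonoid_zeroCone (u : Module.Dual ℤ N) : u ∈ dualMonoid Δ.zeroCone.1 := by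
  intro x hx
  rw [(Submodule.mem_bot _).1 hx, map_zero]

end Fan
end Toric

/-! ### Laurent rings: factoriality and units. -/

namespace Toric

section MonoidAlgebras

variable {k : Type*} [Field k] {S S₂ : Type*} [AddCommMonoid S] [AddCommMonoid S₂]

/-- If a monoid `S₂` arises from `S` by inverting the element `e`, then the monoid algebra of `S₂`
arises from that of `S` by inverting `x^e`. -/
lemma isLocalizationAway_mapDomain {f : S →+ S₂} (hf : Function.Injective f) (e : S)
    (hneg : ∃ n, f e + n = 0) (hsurj : ∀ s', ∃ (n : ℕ) (s : S), f s = s' + n • f e)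
    [Algebra (AddMonoidAlgebra k S) (AddMonoidAlgebra k S₂)]
    (halg : ∀ a, algebraMap (AddMonoidAlgebra k S) (AddMonoidAlgebra k S₂) a =
      AddMonoidAlgebra.mapDomainAlgHom k k f a) :
    IsLocalization.Away (AddMonoidAlgebra.single e (1 : k)) (AddMonoidAlgebra k S₂) := by
  have hsingle : ∀ (s : S) (c : k), AddMonoidAlgebra.mapDomainAlgHom k k f
      (AddMonoidAlgebra.single s c) = AddMonoidAlgebra.single (f s) c := by simp
  refine IsLocalization.Away.mk _ ?_ ?_ ?_
  · obtain ⟨n, hn⟩ := hneg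
    rw [halg, hsingle]
    refine IsUnit.of_mul_eq_one (AddMonoidAlgebra.single n 1) ?_
    rw [AddMonoidAlgebra.single_mul_single, hn, one_mul, AddMonoidAlgebra.one_def]
  · intro g
    induction g using AddMonoidAlgebra.induction_linear with
    | zero => exact ⟨0, 0, by simp⟩
    | add f g hf hg =>
      obtain ⟨n, a, ha⟩ := hf
      obtain ⟨m, b, hb⟩ := hg
      refine ⟨n + m, a * AddMonoidAlgebra.single e (1 : k) ^ m +
        b * AddMonoidAlgebra.single e (1 : k) ^ n, ?_⟩
      rw [map_add, map_mul, map_mul, map_pow, map_pow, ← ha, ← hb]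
      ring
    | single m c =>
      obtain ⟨n, s, hs⟩ := hsurj m
      refine ⟨n, AddMonoidAlgebra.single s c, ?_⟩
      rw [halg, halg, hsingle, hsingle, AddMonoidAlgebra.single_pow,
        AddMonoidAlgebra.single_mul_single, one_pow, mul_one, hs]
  · intro a b hab
    rw [halg, halg] at hab
    exact ⟨0, by rw [AddMonoidAlgebra.mapDomain_injective hf hab]⟩

/-- The ring of Laurent polynomials is factorial. -/
lemma uniqueFactorizationMonoid_of_free {P : Type*} [AddCommGroup P] [Module.Free ℤ P]
    [Module.Finite ℤ P] : UniqueFactorizationMonoid (AddMonoidAlgebra k P) := by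
  classical
  let b := Module.finBasis ℤ P
  let n := Module.finrank ℤ P
  let f : (Fin n →₀ ℕ) →+ P :=
    { toFun s := ∑ i, (s i : ℤ) • b i
      map_zero' := by simp
      map_add' s t := by simp [add_smul, Finset.sum_add_distrib] }
  have hf_apply : ∀ s, f s = ∑ i, (s i : ℤ) • b i := fun _ ↦ rfl
  have hrepr : ∀ s i, b.repr (f s) i = s i := by
    intro s i
    rw [hf_apply, b.repr_sum_self]
  -- Inverting the product of all variables turns the polynomial ring into the Laurent ring, and
  -- localization preserves factoriality.
  let e : Fin n →₀ ℕ := Finsupp.equivFunOnFinite.symm fun _ ↦ 1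
  let : Algebra (MvPolynomial (Fin n) k) (AddMonoidAlgebra k P) :=
    (AddMonoidAlgebra.mapDomainAlgHom k k f).toRingHom.toAlgebra
  have : IsLocalization.Away (AddMonoidAlgebra.single e (1 : k) : MvPolynomial (Fin n) k)
      (AddMonoidAlgebra k P) := by
    refine isLocalizationAway_mapDomain (f := f) (fun s t h ↦ ?_) e ⟨-f e, add_neg_cancel _⟩
      (fun s' ↦ ?_) (fun _ ↦ rfl)
    · ext i
      have := congrArg (fun x ↦ b.repr x i) h
      simpa [hrepr] using this
    -- The sum of the absolute values of all coordinates bounds each of them, so this shift makes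
    -- every exponent nonnegative.
    · refine ⟨∑ i, (b.repr s' i).natAbs, Finsupp.equivFunOnFinite.symm fun i ↦
        (b.repr s' i + ∑ i, (b.repr s' i).natAbs).toNat, ?_⟩
      refine b.ext_elem fun i ↦ ?_
      have h1 : (b.repr s' i).natAbs ≤ ∑ i, (b.repr s' i).natAbs :=
        Finset.single_le_sum (f := fun i ↦ (b.repr s' i).natAbs) (fun _ _ ↦ Nat.zero_le _)
          (Finset.mem_univ i)
      rw [hrepr, map_add, map_nsmul, Finsupp.add_apply, Finsupp.smul_apply, hrepr]
      simp only [Finsupp.coe_equivFunOnFinite_symm, e]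
      simp only [Nat.cast_one, nsmul_eq_mul, mul_one]
      rw [Int.toNat_of_nonneg]
      omega
  exact UniqueFactorizationMonoid.of_isLocalization
    (Submonoid.powers (AddMonoidAlgebra.single e (1 : k) : MvPolynomial (Fin n) k))
    (AddMonoidAlgebra k P)

/-- The units of the algebra of a monoid with two unique sums are monomials. -/
lemma exists_eq_single_of_mul_eq_one [TwoUniqueSums S] {a b : AddMonoidAlgebra k S}
    (h : a * b = 1) : ∃ s c, c ≠ 0 ∧ a = AddMonoidAlgebra.single s c := by
  classical
  have ha : a ≠ 0 := left_ne_zero_of_mul_eq_one h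
  have hb : b ≠ 0 := right_ne_zero_of_mul_eq_one h
  -- A sum of exponents that arises in only one way gives a nonzero coefficient of `a * b = 1`, so
  -- it must be `0`.
  have key : ∀ p ∈ a.coeff.support ×ˢ b.coeff.support,
      UniqueAdd a.coeff.support b.coeff.support p.1 p.2 → p.1 + p.2 = 0 := by
    intro p hp hu
    by_contra hne
    have h1 : (a * b).coeff (p.1 + p.2) = a.coeff p.1 * b.coeff p.2 :=
      AddMonoidAlgebra.coeff_mul_add_of_uniqueAdd hu
    rw [h, AddMonoidAlgebra.one_def, AddMonoidAlgebra.coeff_single, Finsupp.single_apply,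
      if_neg (Ne.symm hne)] at h1
    rw [Finset.mem_product, Finsupp.mem_support_iff, Finsupp.mem_support_iff] at hp
    exact mul_ne_zero hp.1 hp.2 h1.symm
  have hca : 0 < a.coeff.support.card := Finset.card_pos.2 (Finsupp.support_nonempty_iff.2
    (by simpa using ha))
  have hcb : 0 < b.coeff.support.card := Finset.card_pos.2 (Finsupp.support_nonempty_iff.2
    (by simpa using hb))
  have hcard : a.coeff.support.card = 1 := by
    by_contra hne
    -- With two terms in `a` there would be two distinct pairs with unique sums. Both sums are `0`,
    -- which contradicts uniqueness.
    obtain ⟨p, hp, q, hq, hpq, hup, huq⟩ := TwoUniqueSums.uniqueAdd_of_one_lt_card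
      (A := a.coeff.support) (B := b.coeff.support)
      (by nlinarith [show 2 ≤ a.coeff.support.card by omega])
    have hq' := Finset.mem_product.1 hq
    obtain ⟨h1, h2⟩ := hup hq'.1 hq'.2 ((key q hq huq).trans (key p hp hup).symm)
    exact hpq (Prod.ext h1 h2).symm
  obtain ⟨s, c, hc, hac⟩ := Finsupp.card_support_eq_one'.1 hcard
  exact ⟨s, c, hc, AddMonoidAlgebra.coeff_injective hac⟩

end MonoidAlgebras
end Toric

/-! ### Orders of vanishing computed on an affine chart. -/

namespace Toric

section Ord

open AlgebraicGeometry.Scheme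

variable {X : Scheme.{u}} [IsIntegral X] [IsLocallyNoetherian X]

/-- For a regular germ the order is a length over a one-dimensional local ring; all orders below are
obtained from such lengths. -/
lemma ord_algebraMap_of_ord_eq {x : X} (hx : Order.coheight x = 1) {r : X.presheaf.stalk x}
    (hr : r ≠ 0) {n : ℕ} (hn : Ring.ord (X.presheaf.stalk x) r = n) :
    Scheme.ord (algebraMap (X.presheaf.stalk x) X.functionField r) x = n := by
  have : Ring.KrullDimLE 1 (X.presheaf.stalk x) := krullDimLE_of_coheight_le hx.le
  have h0 : algebraMap (X.presheaf.stalk x) X.functionField r ≠ 0 := by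
    rw [Ne, map_eq_zero_iff _ (IsFractionRing.injective (X.presheaf.stalk x) X.functionField)]
    exact hr
  rw [Scheme.ord_eq_iff hx h0]
  change Ring.ordFrac (X.presheaf.stalk x) _ = _
  rw [Ring.ordFrac_eq_ord _ hr, Ring.ordMonoidWithZeroHom_eq_coe _ (by simpa using hr) hn]

variable {R : CommRingCat.{u}} (j : Spec R ⟶ X) [IsOpenImmersion j]

/-- A function on an affine chart `j`, as a section of the structure sheaf on the image of `j`. -/
noncomputable def chartSection : R ≅ Γ(X, j ''ᵁ ⊤) :=
  (Scheme.ΓSpecIso R).symm ≪≫ (j.appIso ⊤).symm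

omit [IsIntegral X] [IsLocallyNoetherian X] in
lemma mem_basicOpen_chartSection (p : Spec R) (b : R) :
    j p ∈ X.basicOpen ((chartSection j).hom b) ↔ b ∉ p.asIdeal := by
  have h : X.basicOpen ((chartSection j).hom b) = j ''ᵁ ((Spec R).basicOpen ((ΓSpecIso R).inv b)) :=
    (Scheme.image_basicOpen j ((ΓSpecIso R).inv b)).symm
  rw [h, basicOpen_eq_of_affine]
  exact ⟨fun ⟨q, hq, e⟩ ↦ j.isOpenEmbedding.injective e ▸ hq, fun h ↦ ⟨p, h, rfl⟩⟩

omit [IsIntegral X] [IsLocallyNoetherian X] in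
lemma mem_image_top (p : Spec R) : j p ∈ j ''ᵁ ⊤ := ⟨p, trivial, rfl⟩

/-- The germ of a function on an affine chart. -/
noncomputable def chartGerm (p : Spec R) : R ⟶ X.presheaf.stalk (j p) :=
  (chartSection j).hom ≫ X.presheaf.germ (j ''ᵁ ⊤) (j p) (mem_image_top j p)

omit [IsIntegral X] [IsLocallyNoetherian X] in
-- A germ is a unit exactly where the section does not vanish. Thus questions about the stalk become
-- questions about the prime ideal of `R`.
lemma isUnit_chartGerm_iff (p : Spec R) (b : R) : IsUnit (chartGerm j p b) ↔ b ∉ p.asIdeal := by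
  rw [← mem_basicOpen_chartSection j, Scheme.mem_basicOpen _ _ _ (mem_image_top j p)]
  rfl

variable [Nontrivial R]

omit [IsIntegral X] [IsLocallyNoetherian X] in
instance : Nonempty (j ''ᵁ ⊤ : X.Opens) := by
  obtain ⟨p⟩ : Nonempty (PrimeSpectrum R) := inferInstance
  exact ⟨⟨j p, mem_image_top j p⟩⟩

/-- A function on an affine chart, as a rational function. -/
noncomputable def toFunctionField : R →+* X.functionField :=
  ((chartSection j).hom ≫ X.germToFunctionField (j ''ᵁ ⊤)).hom

omit [IsLocallyNoetherian X] in
lemma toFunctionField_eq_algebraMap (p : Spec R) (b : R) :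
    toFunctionField j b = algebraMap _ _ (chartGerm j p b) :=
  (Scheme.algebraMap_germ_eq_germToFunctionField X (mem_image_top j p) _).symm

omit [IsLocallyNoetherian X] in
lemma toFunctionField_injective : Function.Injective (toFunctionField j) := by
  have h : Function.Injective (chartSection j).hom :=
    (ConcreteCategory.bijective_of_isIso (chartSection j).hom).1
  exact (Scheme.germToFunctionField_injective (X := X) _).comp h

omit [IsLocallyNoetherian X] in
lemma exists_toFunctionField_div (f : X.functionField) :
    ∃ a b : R, b ≠ 0 ∧ f = toFunctionField j a / toFunctionField j b := by
  have := functionField_isFractionRing_of_isAffineOpen X (j ''ᵁ ⊤)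
    ((isAffineOpen_top (Spec R)).image_of_isOpenImmersion j)
  obtain ⟨a, b, hb, rfl⟩ := IsFractionRing.div_surjective Γ(X, j ''ᵁ ⊤) f
  have h : Function.Surjective (chartSection j).hom :=
    (ConcreteCategory.bijective_of_isIso (chartSection j).hom).2
  obtain ⟨a, rfl⟩ := h a
  obtain ⟨b, rfl⟩ := h b
  refine ⟨a, b, ?_, rfl⟩
  rintro rfl
  rw [map_zero] at hb
  exact nonZeroDivisors.ne_zero hb rfl

lemma ord_toFunctionField_of_notMem {p : Spec R} (hp : Order.coheight (j p) = 1) {b : R}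
    (hb : b ∉ p.asIdeal) : Scheme.ord (toFunctionField j b) (j p) = 0 := by
  have hu := (isUnit_chartGerm_iff j p b).2 hb
  rw [toFunctionField_eq_algebraMap j p]
  exact ord_algebraMap_of_ord_eq hp hu.ne_zero (n := 0) (by simp [Ring.ord_of_isUnit hu])

omit [IsLocallyNoetherian X] in
lemma chartGerm_ne_zero (p : Spec R) {b : R} (hb : b ≠ 0) : chartGerm j p b ≠ 0 := by
  intro h
  refine hb (toFunctionField_injective j ?_)
  rw [toFunctionField_eq_algebraMap j p, h, map_zero, map_zero]

lemma ord_toFunctionField_pos {p : Spec R} (hp : Order.coheight (j p) = 1) {b : R}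
    (hb : b ∈ p.asIdeal) (hb0 : b ≠ 0) : 0 < Scheme.ord (toFunctionField j b) (j p) := by
  have : Ring.KrullDimLE 1 (X.presheaf.stalk (j p)) := krullDimLE_of_coheight_le hp.le
  have hr := chartGerm_ne_zero j p hb0
  obtain ⟨n, hn⟩ := ENat.ne_top_iff_exists.1
    (Ring.ord_ne_top (a := chartGerm j p b) (mem_nonZeroDivisors_of_ne_zero hr))
  rw [toFunctionField_eq_algebraMap j p, ord_algebraMap_of_ord_eq hp hr hn.symm]
  -- Order `0` would mean that the quotient by the germ is zero, so that the germ is a unit.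
  rcases Nat.eq_zero_or_pos n with rfl | h
  · have h0 : Module.length (X.presheaf.stalk (j p)) (X.presheaf.stalk (j p) ⧸
      Ideal.span {chartGerm j p b}) = 0 := hn.symm
    rw [Module.length_eq_zero_iff, Submodule.Quotient.subsingleton_iff,
      Ideal.span_singleton_eq_top, isUnit_chartGerm_iff] at h0
    exact absurd hb h0
  · exact_mod_cast h

/-- A generator of the prime ideal generates the maximal ideal of the stalk, and the residue field
has length one. -/
lemma ord_toFunctionField_of_span {p : Spec R} (hp : Order.coheight (j p) = 1) {b : R}
    (hb : p.asIdeal = Ideal.span {b}) (hb0 : b ≠ 0) :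
    Scheme.ord (toFunctionField j b) (j p) = 1 := by
  have hU := (isAffineOpen_top (Spec R)).image_of_isOpenImmersion j
  have hr := chartGerm_ne_zero j p hb0
  rw [toFunctionField_eq_algebraMap j p]
  refine ord_algebraMap_of_ord_eq hp hr (n := 1) ?_
  have hmax : Ideal.span {chartGerm j p b} = IsLocalRing.maximalIdeal (X.presheaf.stalk (j p)) := by
    apply le_antisymm
    · rw [Ideal.span_singleton_le_iff_mem, IsLocalRing.mem_maximalIdeal, mem_nonunits_iff,
        isUnit_chartGerm_iff, not_not, hb]
      exact Ideal.mem_span_singleton_self b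
    -- Write the nonunit `r` as a fraction. Its numerator must lie in the prime ideal, so it is a
    -- multiple of `b`.
    · intro r hr
      let := TopCat.Presheaf.algebra_section_stalk X.presheaf
        (⟨j p, mem_image_top j p⟩ : (j ''ᵁ ⊤ : X.Opens))
      have := hU.isLocalization_stalk ⟨j p, mem_image_top j p⟩
      obtain ⟨g, s, hgs⟩ := IsLocalization.exists_mk'_eq
        (hU.primeIdealOf ⟨j p, mem_image_top j p⟩).asIdeal.primeCompl r
      obtain ⟨g, rfl⟩ := (ConcreteCategory.bijective_of_isIso (chartSection j).hom).2 g
      have hspec := IsLocalization.mk'_spec (X.presheaf.stalk (j p)) ((chartSection j).hom g) s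
      rw [hgs] at hspec
      have hu := IsLocalization.map_units (X.presheaf.stalk (j p)) s
      have hg : chartGerm j p g = r * algebraMap _ _ (s : Γ(X, j ''ᵁ ⊤)) := hspec.symm
      have hgp : g ∈ p.asIdeal := by
        by_contra h
        rw [← isUnit_chartGerm_iff j p, hg] at h
        exact (IsLocalRing.mem_maximalIdeal _).1 hr (isUnit_of_mul_isUnit_left h)
      rw [hb] at hgp
      obtain ⟨g', rfl⟩ := Ideal.mem_span_singleton.1 hgp
      rw [Ideal.mem_span_singleton]
      rw [map_mul] at hg
      obtain ⟨e, he⟩ := hu.exists_right_inv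
      exact ⟨chartGerm j p g' * e, by rw [← mul_assoc, hg, mul_assoc, he, mul_one]⟩
  rw [Ring.ord, Nat.cast_one, Module.length_eq_one_iff, hmax]
  exact isSimpleModule_iff_isCoatom.2 (IsLocalRing.maximalIdeal.isMaximal _).out

omit [IsLocallyNoetherian X] in
-- Restriction to a smaller chart does not change the germ at the generic point. Hence all charts
-- see the same rational functions.
lemma toFunctionField_comp {R' : CommRingCat.{u}} [Nontrivial R'] (i : R ⟶ R')
    [IsOpenImmersion (Spec.map i)] (j' : Spec R' ⟶ X) [IsOpenImmersion j'] (h : Spec.map i ≫ j = j')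
    (b : R) : toFunctionField j' (i b) = toFunctionField j b := by
  subst h
  change (i ≫ (ΓSpecIso R').inv ≫ ((Spec.map i ≫ j).appIso ⊤).inv ≫
    X.germToFunctionField ((Spec.map i ≫ j) ''ᵁ ⊤)) b =
    ((ΓSpecIso R).inv ≫ (j.appIso ⊤).inv ≫ X.germToFunctionField (j ''ᵁ ⊤)) b
  congr 2
  rw [ΓSpecIso_inv_naturality_assoc, Scheme.Hom.comp_appIso]
  simp only [Iso.trans_inv, Category.assoc]
  have h : Hom.appTop (Spec.map i) ≫ (Hom.appIso (Spec.map i) ⊤).inv =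
      (Spec R).presheaf.map (homOfLE le_top).op := Scheme.Hom.app_appIso_inv (Spec.map i) ⊤
  rw [reassoc_of% h, Scheme.Hom.appIso_inv_naturality_assoc]
  congr 2
  rw [Functor.mapIso_inv, Scheme.germToFunctionField, Scheme.germToFunctionField]
  erw [X.presheaf.germ_res, X.presheaf.germ_res]

end Ord
end Toric

/-! ### Divisors of characters and the relations in the class group. -/

namespace Toric.Fan

section ClassGroup

variable (k : Type u) [Field k] {N : Type u} [AddCommGroup N] [Module.Free ℤ N] [Module.Finite ℤ N]
  (Δ : Fan N)

/-- The functions on a chart of the toric variety, as rational functions. -/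
noncomputable def chartFunction (σ : Δ.Cone) :
    ChartRing k σ.1 →+* (Δ.toricVariety k).functionField :=
  toFunctionField (R := .of (ChartRing k σ.1)) (Δ.chartι k σ)

lemma chartFunction_injective (σ : Δ.Cone) : Function.Injective (Δ.chartFunction k σ) :=
  toFunctionField_injective (R := .of (ChartRing k σ.1)) (Δ.chartι k σ)

lemma chartFunction_chartRes {σ τ : Δ.Cone} (h : τ ≤ σ) (b : ChartRing k σ.1) :
    Δ.chartFunction k τ (chartRes k (show τ.1 ≤ σ.1 from h) b) = Δ.chartFunction k σ b := by
  have : IsOpenImmersion (Spec.map (CommRingCat.ofHom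
      (chartRes k (show τ.1 ≤ σ.1 from h)).toRingHom)) :=
    isOpenImmersion_chartMap k (show τ.1 ≤ σ.1 from h) (Δ.rational σ.1 σ.2) (isFace_of_le h)
  exact toFunctionField_comp (R := .of (ChartRing k σ.1)) (R' := .of (ChartRing k τ.1))
    (Δ.chartι k σ) (CommRingCat.ofHom (chartRes k (show τ.1 ≤ σ.1 from h)).toRingHom)
    (Δ.chartι k τ) (chartMap_chartι k Δ h) b

/-- The character `x^u` as a rational function. -/
noncomputable def character (u : Module.Dual ℤ N) : (Δ.toricVariety k).functionField :=
  Δ.chartFunction k Δ.zeroCone (AddMonoidAlgebra.single ⟨u, Δ.mem_dualMonoid_zeroCone u⟩ 1)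

lemma chartFunction_single (σ : Δ.Cone) (u : dualMonoid σ.1) :
    Δ.chartFunction k σ (AddMonoidAlgebra.single u 1) = Δ.character k u.1 := by
  rw [← Δ.chartFunction_chartRes k (Δ.zeroCone_le σ), chartRes_single]
  rfl

lemma character_add (u w : Module.Dual ℤ N) :
    Δ.character k (u + w) = Δ.character k u * Δ.character k w := by
  rw [character, character, character, ← map_mul, AddMonoidAlgebra.single_mul_single, one_mul]
  rfl

lemma character_ne_zero (u : Module.Dual ℤ N) : Δ.character k u ≠ 0 := by
  rw [character, map_ne_zero_iff _ (Δ.chartFunction_injective k Δ.zeroCone)]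
  simp

/-- The order of vanishing of the characters at a point. -/
noncomputable def characterOrd (x : Δ.toricVariety k) : Module.Dual ℤ N →+ ℤ :=
  AddMonoidHom.mk' (fun u ↦ Scheme.ord (Δ.character k u) x) fun u w ↦ by
    rw [character_add, Scheme.ord_mul (Δ.character_ne_zero k u) (Δ.character_ne_zero k w)]

lemma characterOrd_apply (x : Δ.toricVariety k) (u : Module.Dual ℤ N) :
    Δ.characterOrd k x u = Scheme.ord (Δ.character k u) x := rfl

lemma ord_chartFunction_of_notMem (σ : Δ.Cone) {p : PrimeSpectrum (ChartRing k σ.1)}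
    (hp : Order.coheight (Δ.chartι k σ p) = 1) {b : ChartRing k σ.1} (hb : b ∉ p.asIdeal) :
    Scheme.ord (Δ.chartFunction k σ b) (Δ.chartι k σ p) = 0 :=
  ord_toFunctionField_of_notMem (R := .of (ChartRing k σ.1)) (Δ.chartι k σ) hp hb

omit [Module.Free ℤ N] in
lemma height_of_coheight_chartι (σ : Δ.Cone) {p : PrimeSpectrum (ChartRing k σ.1)}
    (hp : Order.coheight (Δ.chartι k σ p) = 1) : p.asIdeal.height = 1 :=
  (idealHeight_eq_coheight (.of (ChartRing k σ.1)) _).trans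
    ((coheight_eq_of_isOpenImmersion (Δ.chartι k σ)).symm.trans hp)

omit [Module.Free ℤ N] in
lemma coheight_chartι_of_height (σ : Δ.Cone) {p : PrimeSpectrum (ChartRing k σ.1)}
    (hp : p.asIdeal.height = 1) : Order.coheight (Δ.chartι k σ p) = 1 :=
  (coheight_eq_of_isOpenImmersion (Δ.chartι k σ)).trans
    ((idealHeight_eq_coheight (.of (ChartRing k σ.1)) _).symm.trans hp)

lemma notMem_of_isUnit {R : Type*} [CommRing R] (p : PrimeSpectrum R) {b : R} (hb : IsUnit b) :
    b ∉ p.asIdeal := fun h ↦ p.isPrime.ne_top (Ideal.eq_top_of_isUnit_mem _ h hb)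

omit [Module.Free ℤ N] [Module.Finite ℤ N] in
lemma isUnit_single {σ : PointedCone ℝ (ℝ ⊗[ℤ] N)} {u : Module.Dual ℤ N} (hu : u ∈ dualMonoid σ)
    (hu' : -u ∈ dualMonoid σ) {c : k} (hc : c ≠ 0) :
    IsUnit (AddMonoidAlgebra.single ⟨u, hu⟩ c : ChartRing k σ) := by
  refine IsUnit.of_mul_eq_one (AddMonoidAlgebra.single ⟨-u, hu'⟩ c⁻¹) ?_
  rw [AddMonoidAlgebra.single_mul_single, AddMonoidAlgebra.one_def, mul_inv_cancel₀ hc]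
  congr 1
  ext1
  simp

omit [Module.Free ℤ N] [Module.Finite ℤ N] in
-- By integrality `⟨m, v⟩ > 0` means `⟨m, v⟩ ≥ 1`, so `m - u` is still nonnegative on the ray and
-- `x^u` divides `x^m`.
lemma rayIdeal_eq_span {v : N} {u : Module.Dual ℤ N} (hu : u v = 1) :
    rayIdeal k v = Ideal.span {(AddMonoidAlgebra.single
      ⟨u, mem_dualMonoid_ray.2 (by omega)⟩ 1 : ChartRing k (ray v))} := by
  apply le_antisymm
  · refine Ideal.span_le.2 ?_
    rintro f ⟨m, hm, rfl⟩
    have hm' : m.1 - u ∈ dualMonoid (ray v) := by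
      rw [mem_dualMonoid_ray, LinearMap.sub_apply]; omega
    refine Ideal.mem_span_singleton.2 ⟨AddMonoidAlgebra.single ⟨_, hm'⟩ 1, ?_⟩
    rw [AddMonoidAlgebra.single_mul_single, one_mul]
    congr 1
    ext1
    simp
  · refine Ideal.span_le.2 ?_
    rintro f rfl
    exact Ideal.subset_span ⟨_, by simp [hu], rfl⟩

/-- The character `x^u` vanishes to the order `⟨u, v⟩` along `Y(v)`. -/
lemma characterOrd_rayDivisor (v : Δ.Ray) (u : Module.Dual ℤ N) :
    Δ.characterOrd k (Δ.rayDivisor k v).1 u = u v.1 := by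
  obtain ⟨u₀, hu₀⟩ := v.2.1.exists_eq_one
  have h1 : Δ.characterOrd k (Δ.rayDivisor k v).1 u₀ = 1 := by
    rw [characterOrd_apply, ← Δ.chartFunction_single k v.cone ⟨u₀, mem_dualMonoid_ray.2 (by omega)⟩]
    exact ord_toFunctionField_of_span (R := .of (ChartRing k (ray v.1))) (Δ.chartι k v.cone)
      (Δ.rayDivisor k v).2 (rayIdeal_eq_span k hu₀) (by
        intro h
        exact one_ne_zero (AddMonoidAlgebra.single_eq_zero.1 h))
  -- If `⟨m, v⟩ = 0`, then `x^m` and its inverse are both regular on the chart of the ray.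
  have h0 : ∀ m : Module.Dual ℤ N, m v.1 = 0 → Δ.characterOrd k (Δ.rayDivisor k v).1 m = 0 := by
    intro m hm
    have hm1 : m ∈ dualMonoid (ray v.1) := mem_dualMonoid_ray.2 hm.ge
    have hm2 : -m ∈ dualMonoid (ray v.1) := mem_dualMonoid_ray.2 (by simp [hm])
    rw [characterOrd_apply, ← Δ.chartFunction_single k v.cone ⟨m, hm1⟩]
    exact Δ.ord_chartFunction_of_notMem k v.cone (Δ.rayDivisor k v).2
      (notMem_of_isUnit _ (isUnit_single k hm1 hm2 one_ne_zero))
  -- Up to a form that vanishes at `v`, `u` is `⟨u, v⟩` times `u₀`, which has order `1`.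
  have h2 := h0 (u - u v.1 • u₀) (by simp [hu₀])
  rw [map_sub, map_zsmul, h1] at h2
  simpa [sub_eq_zero] using h2

lemma characterOrd_of_mem_torus {p : PrimeSpectrum (ChartRing k Δ.zeroCone.1)}
    (hp : Order.coheight (Δ.chartι k Δ.zeroCone p) = 1) (u : Module.Dual ℤ N) :
    Δ.characterOrd k (Δ.chartι k Δ.zeroCone p) u = 0 :=
  Δ.ord_chartFunction_of_notMem k Δ.zeroCone hp (notMem_of_isUnit _
    (isUnit_single k _ (Δ.mem_dualMonoid_zeroCone _) one_ne_zero))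

/-- The coordinates of `v` are recovered as the orders of the coordinate characters along `Y(v)`. -/
lemma rayDivisor_injective : Function.Injective (Δ.rayDivisor k) := by
  intro v w h
  refine Subtype.ext ((Module.finBasis ℤ N).ext_elem fun i ↦ ?_)
  have h1 := Δ.characterOrd_rayDivisor k v ((Module.finBasis ℤ N).coord i)
  rw [h, characterOrd_rayDivisor] at h1
  exact h1.symm

omit [Module.Free ℤ N] [Module.Finite ℤ N] in
-- The map `rayRes` keeps exactly the coefficients at exponents with `⟨u, v⟩ = 0`, and `rayIdeal` is
-- its kernel.
lemma pos_of_mem_comap_rayIdeal {σ : PointedCone ℝ (ℝ ⊗[ℤ] N)} {v : N} (h : ray v ≤ σ)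
    {f : ChartRing k σ} (hf : chartRes k h f ∈ rayIdeal k v) :
    ∀ u ∈ f.coeff.support, 0 < u.1 v := by
  classical
  intro u hu
  refine lt_of_le_of_ne (mem_dualMonoid_ray.1 (dualMonoid_anti h u.2)) fun h0 ↦ ?_
  refine Finsupp.mem_support_iff.1 hu ?_
  have h1 : ∀ g : ChartRing k σ, (rayRes k v (chartRes k h g)).coeff u.1 = g.coeff u := by
    intro g
    induction g using AddMonoidAlgebra.induction_linear with
    | zero => simp
    | add f g hf hg => simp [hf, hg]
    | single m c =>
      have hs : rayRes k v (chartRes k h (AddMonoidAlgebra.single m c)) =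
          if m.1 v = 0 then AddMonoidAlgebra.single m.1 c else 0 := by
        rw [chartRes_single]
        simp [rayRes]
      rw [hs]
      split_ifs with hm
      · rw [AddMonoidAlgebra.coeff_single, AddMonoidAlgebra.coeff_single,
          Finsupp.single_apply, Finsupp.single_apply]
        simp only [Subtype.ext_iff]
      · have : m ≠ u := fun h ↦ hm (h ▸ h0.symm)
        simp [AddMonoidAlgebra.coeff_single, this]
  rw [← ker_rayRes] at hf
  rw [← h1, RingHom.mem_ker.1 hf]
  simp

/-- A prime divisor of a toric variety either is the divisor of a ray or meets the torus. -/
lemma eq_rayDivisor_or_mem_torus (x : PrimeDivisor (Δ.toricVariety k)) :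
    (∃ v, x = Δ.rayDivisor k v) ∨ ∃ p, Δ.chartι k Δ.zeroCone p = x.1 := by
  classical
  have : Finite Δ.Cone := Δ.finite.to_subtype
  obtain ⟨σ₀, y₀, hy₀⟩ := Δ.exists_chartι_eq k x.1
  -- Take a minimal cone whose chart contains the point: then the point lies in the chart of no
  -- proper face.
  obtain ⟨σ, ⟨p, hp⟩, hmin⟩ := exists_minimal_of_wellFoundedLT
    (fun σ : Δ.Cone ↦ ∃ p, Δ.chartι k σ p = x.1) ⟨σ₀, y₀, hy₀⟩
  by_cases hray : ∃ v : Δ.Ray, ray v.1 ≤ σ.1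
  · left
    obtain ⟨v, hv⟩ := hray
    refine ⟨v, Subtype.ext ?_⟩
    let Q : Ideal (ChartRing k σ.1) := (rayIdeal k v.1).comap (chartRes k hv).toRingHom
    have hQ : Q.IsPrime := Ideal.IsPrime.comap _
    -- If `x^u` did not vanish at `p`, then `p` would lie in the chart of the face `u = 0`. By
    -- minimality this face is all of `σ`, although `⟨u, v⟩ > 0` on a ray of `σ`.
    have hQp : Q ≤ p.asIdeal := by
      intro f hf
      have hpos := pos_of_mem_comap_rayIdeal k hv hf
      rw [← f.sum_coeff_single]
      refine Ideal.sum_mem _ fun u hu ↦ ?_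
      have hsingle : AddMonoidAlgebra.single u (f.coeff u) =
          AddMonoidAlgebra.single 0 (f.coeff u) * AddMonoidAlgebra.single u (1 : k) := by
        rw [AddMonoidAlgebra.single_mul_single, zero_add, mul_one]
      rw [hsingle]
      refine Ideal.mul_mem_left _ _ ?_
      by_contra hup
      let τ : PointedCone ℝ (ℝ ⊗[ℤ] N) := σ.1 ⊓
        PointedCone.ofSubmodule (LinearMap.ker (u.1.baseChange ℝ))
      have hτ : ∀ y, y ∈ τ ↔ y ∈ σ.1 ∧ u.1.baseChange ℝ y = 0 := fun y ↦ Iff.rfl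
      let τ' : Δ.Cone := ⟨τ, Δ.face_mem σ.1 σ.2 _ ⟨u.1.baseChange ℝ, u.2, hτ⟩⟩
      have hle : τ' ≤ σ := fun y hy ↦ ((hτ y).1 hy).1
      obtain ⟨q, hq⟩ := (mem_range_chartMap k (τ := τ) hle (Δ.rational σ.1 σ.2) u.2 hτ p).2 hup
      have hστ : σ ≤ τ' := hmin ⟨q, by
        rw [← hp, ← hq, ← chartMap_chartι k Δ hle]; rfl⟩ hle
      have h2 := ((hτ _).1 (hστ (tmul_mem_of_ray_le hv))).2
      have h3 := hpos u hu
      have h4 : u.1 v.1 = 0 := by simpa using h2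
      omega
    have hQ0 : Q ≠ ⊥ := by
      obtain ⟨u, hu, hpos, -⟩ := Δ.exists_mem_dualMonoid_pos σ
      intro h
      have : (AddMonoidAlgebra.single ⟨u, hu⟩ 1 : ChartRing k σ.1) ∈ Q := by
        refine Ideal.mem_comap.2 ?_
        change chartRes k hv (AddMonoidAlgebra.single ⟨u, hu⟩ 1) ∈ _
        rw [chartRes_single]
        exact Ideal.subset_span ⟨_, hpos v hv, rfl⟩
      rw [h, Ideal.mem_bot] at this
      exact one_ne_zero (AddMonoidAlgebra.single_eq_zero.1 this)
    -- A nonzero prime ideal inside a prime ideal of height one is equal to it.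
    have hpQ : Q = p.asIdeal := by
      have hh := Δ.height_of_coheight_chartι k σ (p := p) (by rw [hp]; exact x.2)
      refine hQp.eq_of_not_lt fun hlt ↦ ?_
      have := PrimeSpectrum.isPrime (R := ChartRing k σ.1) p
      have h1 : Q.height + 1 ≤ p.asIdeal.height := Ideal.height_add_one_le_of_lt_of_isPrime hlt
      rw [hh] at h1
      have h2 : Q.height = 0 := by
        by_contra hne
        have := Order.one_le_iff_ne_zero.2 hne
        have h3 : (1 : ℕ∞) + 1 ≤ 1 := le_trans (by gcongr) h1
        exact absurd h3 (by decide)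
      exact hQ0 (Ideal.height_eq_zero_iff_eq_bot.1 h2)
    have hpe : p = chartMap k hv (⟨rayIdeal k v.1, inferInstance⟩ :
        PrimeSpectrum (ChartRing k (ray v.1))) := PrimeSpectrum.ext hpQ.symm
    rw [← hp, hpe]
    exact congr($(chartMap_chartι k Δ (show v.cone ≤ σ from hv)) (⟨rayIdeal k v.1, inferInstance⟩ :
      PrimeSpectrum (ChartRing k (ray v.1))))
  · right
    -- A cone of the fan that contains no ray is generated by the empty set.
    have hσ : σ = Δ.zeroCone := by
      refine Subtype.ext ?_
      rw [Δ.eq_hull_rays σ]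
      have : {n | ∃ v : Δ.Ray, ray v.1 ≤ σ.1 ∧ v.1 = n} = ∅ := by
        ext n
        simp only [Set.mem_ofPred_eq, Set.mem_empty_iff_false, iff_false]
        rintro ⟨v, hv, -⟩
        exact hray ⟨v, hv⟩
      rw [this, Set.image_empty]
      exact Submodule.span_empty
    subst hσ
    exact ⟨p, hp⟩

instance : UniqueFactorizationMonoid (ChartRing k Δ.zeroCone.1) := by
  have := uniqueFactorizationMonoid_of_free (k := k) (P := Module.Dual ℤ N)
  let e : Module.Dual ℤ N ≃+ dualMonoid Δ.zeroCone.1 :=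
    { toFun u := ⟨u, Δ.mem_dualMonoid_zeroCone u⟩
      invFun u := u.1
      left_inv _ := rfl
      right_inv _ := rfl
      map_add' _ _ := rfl }
  exact (AddMonoidAlgebra.domCongr k k e).toMulEquiv.uniqueFactorizationMonoid this

instance : TwoUniqueSums (dualMonoid Δ.zeroCone.1) :=
  TwoUniqueSums.of_injective_addHom (AddHomClass.toAddHom (dualMonoid Δ.zeroCone.1).subtype)
    Subtype.val_injective inferInstance

/-- A rational function without zeros and poles on the torus is a multiple of a character. -/
lemma exists_character_of_ord_eq_zero {f : (Δ.toricVariety k).functionField} (hf : f ≠ 0)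
    (h : ∀ p, Order.coheight (Δ.chartι k Δ.zeroCone p) = 1 →
      Scheme.ord f (Δ.chartι k Δ.zeroCone p) = 0) :
    ∃ (u : Module.Dual ℤ N) (c : k), c ≠ 0 ∧ f = Δ.chartFunction k Δ.zeroCone
      (AddMonoidAlgebra.single ⟨u, Δ.mem_dualMonoid_zeroCone u⟩ c) := by
  obtain ⟨a, b, hb, rfl⟩ := exists_toFunctionField_div (R := .of (ChartRing k Δ.zeroCone.1))
    (Δ.chartι k Δ.zeroCone) f
  have inj := Δ.chartFunction_injective k Δ.zeroCone
  change Δ.chartFunction k Δ.zeroCone a / Δ.chartFunction k Δ.zeroCone b ≠ 0 at hf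
  change ChartRing k Δ.zeroCone.1 at a b
  have ha : a ≠ 0 := by rintro rfl; simp at hf
  -- Write the function as a fraction in lowest terms; numerator and denominator then have no common
  -- prime divisor.
  obtain ⟨a', b', c', hcop, rfl, rfl⟩ := UniqueFactorizationMonoid.exists_reduced_factors' a b hb
  have hc0 : c' ≠ 0 := left_ne_zero_of_mul ha
  have ha0 : a' ≠ 0 := right_ne_zero_of_mul ha
  have hb0 : b' ≠ 0 := right_ne_zero_of_mul hb
  have ne0 : ∀ {r}, r ≠ 0 → Δ.chartFunction k Δ.zeroCone r ≠ 0 := fun hr ↦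
    (map_ne_zero_iff _ inj).2 hr
  have hquot : Δ.chartFunction k Δ.zeroCone (c' * a') / Δ.chartFunction k Δ.zeroCone (c' * b') =
      Δ.chartFunction k Δ.zeroCone a' / Δ.chartFunction k Δ.zeroCone b' := by
    rw [map_mul, map_mul, mul_div_mul_left _ _ (ne0 hc0)]
  change ∃ (u : Module.Dual ℤ N) (c : k), c ≠ 0 ∧ Δ.chartFunction k Δ.zeroCone (c' * a') /
    Δ.chartFunction k Δ.zeroCone (c' * b') = _
  replace h : ∀ p, Order.coheight (Δ.chartι k Δ.zeroCone p) = 1 →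
      Scheme.ord (Δ.chartFunction k Δ.zeroCone a') (Δ.chartι k Δ.zeroCone p) =
      Scheme.ord (Δ.chartFunction k Δ.zeroCone b') (Δ.chartι k Δ.zeroCone p) := by
    intro p hp
    have h1 := h p hp
    change Scheme.ord (Δ.chartFunction k Δ.zeroCone (c' * a') /
      Δ.chartFunction k Δ.zeroCone (c' * b')) _ = 0 at h1
    rw [hquot] at h1
    have h2 := Scheme.ord_mul (x := Δ.chartι k Δ.zeroCone p) (div_ne_zero (ne0 ha0) (ne0 hb0))
      (ne0 hb0)
    rw [div_mul_cancel₀ _ (ne0 hb0), h1, zero_add] at h2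
    exact h2
  -- A prime factor `π` of `a` defines a point of codimension one where `a` has positive order.
  -- There `b` has order `0` by coprimality, against the equality of orders.
  have key : ∀ a b : ChartRing k Δ.zeroCone.1, a ≠ 0 →
      (∀ d, d ∣ a → d ∣ b → IsUnit d) → (∀ p, Order.coheight (Δ.chartι k Δ.zeroCone p) = 1 →
      Scheme.ord (Δ.chartFunction k Δ.zeroCone a) (Δ.chartι k Δ.zeroCone p) =
      Scheme.ord (Δ.chartFunction k Δ.zeroCone b) (Δ.chartι k Δ.zeroCone p)) → IsUnit a := by
    intro a b ha hcop h
    by_contra hu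
    obtain ⟨π, hπ, hπa⟩ := WfDvdMonoid.exists_irreducible_factor hu ha
    have hπ' := UniqueFactorizationMonoid.irreducible_iff_prime.1 hπ
    have hprime : (Ideal.span {π}).IsPrime := (Ideal.span_singleton_prime hπ.ne_zero).2 hπ'
    have := isNoetherianRing_chartRing k (Δ.rational _ Δ.zeroCone.2)
    have hheight : (Ideal.span {π}).height = 1 := by
      apply le_antisymm
      · have : (Ideal.span {π}).IsPrincipal := ⟨_, rfl⟩
        exact Ideal.height_le_one_of_isPrincipal_of_mem_minimalPrimes (Ideal.span {π})
          (Ideal.span {π}) (by rw [Ideal.minimalPrimes_eq_subsingleton_self]; rfl)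
      · rw [Order.one_le_iff_ne_zero]
        intro h0
        exact hπ.ne_zero (Ideal.span_singleton_eq_bot.1 (Ideal.height_eq_zero_iff_eq_bot.1 h0))
    let p : PrimeSpectrum (ChartRing k Δ.zeroCone.1) := ⟨Ideal.span {π}, hprime⟩
    have hp : Order.coheight (Δ.chartι k Δ.zeroCone p) = 1 :=
      Δ.coheight_chartι_of_height k Δ.zeroCone hheight
    have h1 : 0 < Scheme.ord (Δ.chartFunction k Δ.zeroCone a) (Δ.chartι k Δ.zeroCone p) :=
      ord_toFunctionField_pos (R := .of (ChartRing k Δ.zeroCone.1)) (Δ.chartι k Δ.zeroCone) hp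
        (Ideal.mem_span_singleton.2 hπa) ha
    have h2 := Δ.ord_chartFunction_of_notMem k Δ.zeroCone hp (b := b) (fun hb ↦
      hπ.not_isUnit (hcop π hπa (Ideal.mem_span_singleton.1 hb)))
    rw [h p hp, h2] at h1
    exact lt_irrefl _ h1
  have hua := key a' b' ha0 (fun d h1 h2 ↦ hcop h1 h2) h
  have hub := key b' a' hb0 (fun d h1 h2 ↦ hcop h2 h1) (fun p hp ↦ (h p hp).symm)
  obtain ⟨b'', hb''⟩ := hub.exists_right_inv
  obtain ⟨a'', ha''⟩ := hua.exists_right_inv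
  -- The quotient of the two units is a unit of the Laurent ring, hence a monomial.
  obtain ⟨u, c, hc, huc⟩ := exists_eq_single_of_mul_eq_one (a := a' * b'') (b := a'' * b') (by
    calc a' * b'' * (a'' * b') = (a' * a'') * (b' * b'') := by ring
      _ = 1 := by rw [ha'', hb'', one_mul])
  refine ⟨u.1, c, hc, ?_⟩
  rw [hquot, div_eq_iff (ne0 hb0)]
  have : (AddMonoidAlgebra.single ⟨u.1, Δ.mem_dualMonoid_zeroCone u.1⟩ c :
    ChartRing k Δ.zeroCone.1) = a' * b'' := huc.symm
  rw [this, ← map_mul]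
  congr 1
  rw [mul_assoc, mul_comm b'', hb'', mul_one]

/-- The relations between the classes of the torus-invariant prime divisors are given by the
characters. -/
lemma sum_smul_rayClass_eq_zero_iff [Fintype Δ.Ray] (s : Δ.Ray → ℤ) :
    ∑ v, s v • Δ.rayClass k v = 0 ↔ ∃ u : Module.Dual ℤ N, ∀ v : Δ.Ray, s v = u v.1 := by
  classical
  let D : WeilDivisor (Δ.toricVariety k) := ∑ v, Finsupp.single (Δ.rayDivisor k v) (s v)
  have hD : ∑ v, s v • Δ.rayClass k v = QuotientAddGroup.mk D := by
    rw [show (QuotientAddGroup.mk D : Δ.Cl k) = QuotientAddGroup.mk' _ D from rfl, map_sum]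
    refine Finset.sum_congr rfl fun v _ ↦ ?_
    rw [rayClass, show (QuotientAddGroup.mk (Finsupp.single (Δ.rayDivisor k v) 1) : Δ.Cl k) =
      QuotientAddGroup.mk' _ _ from rfl, ← map_zsmul]
    congr 1
    simp
  have hD1 : ∀ v, D (Δ.rayDivisor k v) = s v := by
    intro v
    simp only [D, Finsupp.finsetSum_apply, Finsupp.single_apply,
      (Δ.rayDivisor_injective k).eq_iff]
    simp
  have hD0 : ∀ x, (∀ v, x ≠ Δ.rayDivisor k v) → D x = 0 := by
    intro x hx
    simp only [D, Finsupp.finsetSum_apply, Finsupp.single_apply]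
    exact Finset.sum_eq_zero fun v _ ↦ if_neg (hx v).symm
  rw [hD, QuotientAddGroup.eq_zero_iff]
  constructor
  · rintro ⟨f, hf, hord⟩
    -- The divisor of `f` is supported on the `Y(v)`, and no `Y(v)` meets the torus: a character of
    -- order `1` along `Y(v)` would have order `0` there.
    obtain ⟨u, c, hc, rfl⟩ := Δ.exists_character_of_ord_eq_zero k hf (fun p hp ↦ by
      have h1 := hord ⟨_, hp⟩
      rw [← h1]
      refine hD0 _ fun v hv ↦ ?_
      obtain ⟨u, hu⟩ := v.2.1.exists_eq_one
      have h2 := Δ.characterOrd_of_mem_torus k hp u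
      have h3 := Δ.characterOrd_rayDivisor k v u
      rw [← hv] at h3
      rw [h2, hu] at h3
      exact zero_ne_one h3)
    refine ⟨u, fun v ↦ ?_⟩
    rw [← hD1, hord, ← Δ.characterOrd_rayDivisor k v u]
    -- The constant is split off; it is a unit on the chart of the ray and contributes order `0`.
    have hmul : (AddMonoidAlgebra.single ⟨u, Δ.mem_dualMonoid_zeroCone u⟩ c :
        ChartRing k Δ.zeroCone.1) = chartRes k (Δ.zeroCone_le v.cone)
        (AddMonoidAlgebra.single 0 c) *
          AddMonoidAlgebra.single ⟨u, Δ.mem_dualMonoid_zeroCone u⟩ 1 := by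
      rw [chartRes_single, AddMonoidAlgebra.single_mul_single, mul_one, map_zero, zero_add]
    have hunit : IsUnit (AddMonoidAlgebra.single 0 c : ChartRing k (ray v.1)) :=
      isUnit_single k (zero_mem _) (by rw [neg_zero]; exact zero_mem _) hc
    rw [hmul, map_mul, Δ.chartFunction_chartRes k (Δ.zeroCone_le v.cone)]
    refine (Scheme.ord_mul ((map_ne_zero_iff _ (Δ.chartFunction_injective k v.cone)).2 hunit.ne_zero)
      (Δ.character_ne_zero k u)).trans ?_
    have h0 : Scheme.ord (Δ.chartFunction k v.cone (AddMonoidAlgebra.single 0 c))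
        (Δ.rayDivisor k v).1 = 0 :=
      Δ.ord_chartFunction_of_notMem k v.cone (Δ.rayDivisor k v).2 (notMem_of_isUnit _ hunit)
    rw [h0, zero_add]
    rfl
  · rintro ⟨u, hu⟩
    refine ⟨Δ.character k u, Δ.character_ne_zero k u, fun x ↦ ?_⟩
    by_cases hx : ∃ v, x = Δ.rayDivisor k v
    · obtain ⟨v, rfl⟩ := hx
      rw [hD1, hu]
      exact (Δ.characterOrd_rayDivisor k v u).symm
    -- All remaining prime divisors meet the torus, where characters are units.
    · obtain ⟨p, hp⟩ := (Δ.eq_rayDivisor_or_mem_torus k x).resolve_left hx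
      rw [hD0 x (fun v hv ↦ hx ⟨v, hv⟩), ← hp]
      exact (Δ.characterOrd_of_mem_torus k (by rw [hp]; exact x.2) u).symm

end ClassGroup
end Toric.Fan

/-! ### Descent along surjections to integral schemes. -/

namespace Toric

section Descent

/-- For a surjective morphism to an integral scheme, the pullback of functions is injective. -/
lemma app_injective_of_surjective {Y X : Scheme.{u}} (p : Y ⟶ X) [Surjective p] [IsIntegral X]
    (W : X.Opens) : Function.Injective (p.app W) := by
  by_cases hW : Nonempty W
  · obtain ⟨y, hy⟩ := p.surjective (genericPoint X)
    have hyW : p y ∈ W := by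
      rw [hy]
      exact ((genericPoint_spec X).mem_open_set_iff W.isOpen).mpr (by simpa using hW)
    -- The stalk at the generic point is a field, so the stalk map is injective there; sections of
    -- an integral scheme embed into that stalk.
    have hfield : IsField (X.presheaf.stalk (p y)) :=
      isField_stalk_of_closure_mem_irreducibleComponents X _
        (by rw [hy]; simp [irreducibleComponents_eq_singleton])
    let := hfield.toField
    have h1 : Function.Injective (p.stalkMap y) := (p.stalkMap y).hom.injective
    have h2 := germ_injective_of_isIntegral X (p y) hyW
    intro s t hst
    apply h2
    apply h1
    rw [Scheme.Hom.germ_stalkMap_apply, Scheme.Hom.germ_stalkMap_apply, hst]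
  · have hW' : W = ⊥ := by
      exact TopologicalSpace.Opens.ext (Set.eq_empty_of_forall_notMem fun x hx ↦ hW ⟨⟨x, hx⟩⟩)
    subst hW'
    exact Function.injective_of_subsingleton _

/-- A surjective morphism to an integral scheme is an epimorphism. -/
lemma epi_of_surjective {Y X : Scheme.{u}} (p : Y ⟶ X) [Surjective p] [IsIntegral X] : Epi p where
  left_cancellation {Z} g g' h := by
    have hbase : g.base = g'.base := by
      ext x
      obtain ⟨y, rfl⟩ := p.surjective x
      exact congr($h y)
    refine Scheme.Hom.ext hbase fun U ↦ ?_
    have : Mono (p.app (g' ⁻¹ᵁ U)) :=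
      ConcreteCategory.mono_of_injective _ (app_injective_of_surjective p _)
    rw [← cancel_mono (p.app (g' ⁻¹ᵁ U)), Category.assoc, Scheme.Hom.naturality]
    have := Scheme.Hom.congr_app h U
    rw [Scheme.Hom.comp_app, Scheme.Hom.comp_app] at this
    rw [reassoc_of% this]
    refine (Category.assoc _ _ _).trans ?_
    exact (congrArg (fun z ↦ (g'.app U ≫ p.app (g' ⁻¹ᵁ U)) ≫ z)
      ((Y.presheaf.map_comp _ _).symm.trans (Y.presheaf.map_id _))).trans (Category.comp_id _)

/-- Surjectivity is stable under base change, so `q` is again a surjection to an integral scheme. An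
empty `W` is not integral and is treated apart. -/
lemma hom_ext_of_surjective {Y X W T Z : Scheme.{u}} (p : Y ⟶ X) [Surjective p] [IsIntegral X]
    (i : W ⟶ X) [IsOpenImmersion i] {a : T ⟶ Y} {q : T ⟶ W} (h : IsPullback a q p i)
    {g g' : W ⟶ Z} (hg : q ≫ g = q ≫ g') : g = g' := by
  by_cases hW : Nonempty W
  · have : IsIntegral W := isIntegral_of_isOpenImmersion i
    have : Surjective q := MorphismProperty.of_isPullback (P := @Surjective) h inferInstance
    have := epi_of_surjective q
    exact (cancel_epi q).1 hg
  · have : IsEmpty W := not_nonempty_iff.1 hW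
    exact isInitialOfIsEmpty.hom_ext _ _

/-- A morphism that factors locally through a surjective morphism to an integral scheme factors
globally. -/
lemma exists_factorization_of_local {Y X Z : Scheme.{u}} (p : Y ⟶ X) [Surjective p] [IsIntegral X]
    (f : Y ⟶ Z) (H : ∀ x : X, ∃ (W T : Scheme.{u}) (i : W ⟶ X) (a : T ⟶ Y) (q : T ⟶ W)
      (g : W ⟶ Z), IsOpenImmersion i ∧ x ∈ Set.range i ∧ IsPullback a q p i ∧ q ≫ g = a ≫ f) :
    ∃ g : X ⟶ Z, p ≫ g = f := by
  choose W T i a q g hi hx hpb hg using H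
  let 𝒰 : X.OpenCover := Scheme.Cover.mkOfCovers X W i (fun x ↦ ⟨x, hx x⟩) hi
  have key : ∀ {V S : Scheme.{u}} (x : X) (b : S ⟶ Y) (r : S ⟶ V) (c : V ⟶ W x),
      b ≫ p = r ≫ c ≫ i x → r ≫ c ≫ g x = b ≫ f := by
    intro V S x b r c h
    have h1 := (hpb x).lift_snd b (r ≫ c) (by simpa using h)
    have h2 := (hpb x).lift_fst b (r ≫ c) (by simpa using h)
    rw [← Category.assoc, ← h1, Category.assoc, hg, ← Category.assoc, h2]
  -- After pullback along `p` both sides become the restriction of `f`, and the pulled back `p` can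
  -- be cancelled.
  have hglue : ∀ x y, pullback.fst (𝒰.f x) (𝒰.f y) ≫ g x = pullback.snd (𝒰.f x) (𝒰.f y) ≫ g y := by
    intro x y
    have := hi x
    have := hi y
    refine hom_ext_of_surjective p (pullback.fst (i x) (i y) ≫ i x)
      (IsPullback.of_hasPullback p (pullback.fst (i x) (i y) ≫ i x)) ?_
    refine (key x (pullback.fst _ _) _ _ pullback.condition).trans
      (key y (pullback.fst _ _) _ _ ?_).symm
    rw [pullback.condition, pullback.condition]
    rfl
  refine ⟨𝒰.glueMorphisms g hglue, ?_⟩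
  refine Scheme.Cover.hom_ext (𝒰.pullback₁ p) _ _ fun x ↦ ?_
  have h1 : pullback.fst p (i x) ≫ p ≫ 𝒰.glueMorphisms g hglue = pullback.fst p (i x) ≫ f := by
    rw [pullback.condition_assoc]
    have h3 : i x ≫ 𝒰.glueMorphisms g hglue = g x := Scheme.Cover.ι_glueMorphisms 𝒰 g hglue x
    rw [h3]
    have := key x (pullback.fst p (i x)) (pullback.snd p (i x)) (𝟙 _)
      (by rw [pullback.condition, Category.id_comp])
    rwa [Category.id_comp] at this
  exact h1

end Descent
end Toric

/-! ### Affine quotients from a Reynolds operator. -/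

namespace Toric

section AffineQuotient

lemma exists_comp_eq_of_mem_range {R A B : Type*} [CommRing R] [CommRing A] [CommRing B]
    {j : B →+* A} (hj : Function.Injective j) {r : R →+* A} (h : ∀ x, r x ∈ j.range) :
    ∃ g : R →+* B, j.comp g = r := by
  choose g hg using h
  refine ⟨⟨⟨⟨g, hj ?_⟩, fun x y ↦ hj ?_⟩, hj ?_, fun x y ↦ hj ?_⟩, RingHom.ext hg⟩
  · simp [hg]
  · simp [hg]
  · simp [hg]
  · simp [hg]

/-- Two ring homomorphisms `ρ, ι : A → D` (a coaction and the trivial one), together with a ring `B`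
of invariants of `ρ` in `A` and a Reynolds operator `E : A → B`. -/
structure IsReynolds {A B D : Type*} [CommRing A] [CommRing B] [CommRing D] (ρ ι : A →+* D)
    (i : B →+* A) (E : A →+ B) : Prop where
  invariant : ∀ b, ρ (i b) = ι (i b)
  map_mul : ∀ b a, E (i b * a) = b * E a
  map_one : E 1 = 1
  eq_of_invariant : ∀ a, ρ a = ι a → i (E a) = a
  mem_of_mem_map : ∀ (I : Ideal A) (a : A), ρ a ∈ I.map ι → i (E a) ∈ I

namespace IsReynolds

variable {A B D : Type u} [CommRing A] [CommRing B] [CommRing D] {ρ ι : A →+* D} {i : B →+* A}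
  {E : A →+ B} (h : IsReynolds ρ ι i E)

include h

lemma map_apply (b : B) : E (i b) = b := by
  have := h.map_mul b 1
  rwa [mul_one, h.map_one, mul_one] at this

lemma injective : Function.Injective i := Function.LeftInverse.injective h.map_apply

/-- The Reynolds operator shows that extending `P` to `A` and contracting it again gives back `P`; a
prime ideal with this property is the contraction of a prime ideal. -/
lemma comap_surjective : Function.Surjective (PrimeSpectrum.comap i) := by
  intro P
  have hP : (P.asIdeal.map i).comap i = P.asIdeal := by
    refine le_antisymm (fun x hx ↦ ?_) Ideal.le_comap_map
    -- The largest ideal that `E` maps into `P`. It contains `P A` because `E` is `B`-linear.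
    let J : Ideal A :=
      { carrier := {a | ∀ a', E (a' * a) ∈ P.asIdeal}
        add_mem' := fun {a b} ha hb a' ↦ by
          rw [mul_add, map_add]; exact add_mem (ha a') (hb a')
        zero_mem' := fun a' ↦ by rw [mul_zero, map_zero]; exact zero_mem _
        smul_mem' := fun c a ha a' ↦ by
          rw [smul_eq_mul, ← mul_assoc]; exact ha (a' * c) }
    have hJ : P.asIdeal.map i ≤ J := by
      refine Ideal.map_le_iff_le_comap.2 fun b hb a' ↦ ?_
      rw [mul_comm, h.map_mul]
      exact Ideal.mul_mem_right _ _ hb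
    have := hJ hx 1
    rwa [one_mul, h.map_apply] at this
  obtain ⟨q, hq, hqP⟩ := (Ideal.comap_map_eq_self_iff_of_isPrime P.asIdeal).1 hP
  exact ⟨⟨q, hq⟩, PrimeSpectrum.ext hqP⟩

/-- Invariant morphisms have invariant affine neighbourhoods of the fibres of the quotient. -/
lemma exists_basicOpen_le {Z : Scheme.{u}} (f : Spec (.of A) ⟶ Z)
    (hf : Spec.map (CommRingCat.ofHom ρ) ≫ f = Spec.map (CommRingCat.ofHom ι) ≫ f)
    (P : PrimeSpectrum B) : ∃ V : Z.Opens, IsAffineOpen V ∧ ∃ a ∉ P.asIdeal,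
      ∀ q : PrimeSpectrum A, i a ∉ q.asIdeal → f q ∈ V := by
  by_contra! hcon
  let I (V : Z.affineOpens) : Ideal A := PrimeSpectrum.vanishingIdeal {q | f q ∉ V.1}
  have hI : ∀ (V : Z.affineOpens) (q : PrimeSpectrum A), I V ≤ q.asIdeal → f q ∉ V.1 := by
    intro V q hq
    have hcl : IsClosed {q : PrimeSpectrum A | f q ∉ V.1} :=
      (V.1.isOpen.preimage f.continuous).isClosed_compl
    have : q ∈ closure {q : PrimeSpectrum A | f q ∉ V.1} := by
      rw [← PrimeSpectrum.zeroLocus_vanishingIdeal_eq_closure]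
      exact hq
    rwa [hcl.closure_eq] at this
  -- The kernel of `θ V` defines the closure of the orbit of the complement of `f⁻¹ V`. Invariance
  -- of `f` keeps that orbit inside the closed complement. As the sets `f⁻¹ V` cover `Spec A`, these
  -- kernels generate the unit ideal.
  let θ (V : Z.affineOpens) : A →+* D ⧸ (I V).map ι := (Ideal.Quotient.mk _).comp ρ
  have htop : (⨆ V : Z.affineOpens, RingHom.ker (θ V)) = ⊤ := by
    by_contra hne
    obtain ⟨m, hm, hle⟩ := Ideal.exists_le_maximal _ hne
    let q : PrimeSpectrum A := ⟨m, hm.isPrime⟩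
    obtain ⟨_, ⟨V, hV, rfl⟩, hqV, -⟩ :=
      Z.isBasis_affineOpens.exists_subset_of_mem_open (Set.mem_univ (f q)) isOpen_univ
    let V' : Z.affineOpens := ⟨V, hV⟩
    have h1 : q ∈ closure (Set.range (PrimeSpectrum.comap (θ V'))) := by
      rw [PrimeSpectrum.closure_range_comap]
      exact (le_iSup (fun V ↦ RingHom.ker (θ V)) V').trans hle
    have hcl : IsClosed {q : PrimeSpectrum A | f q ∉ V} :=
      (V.isOpen.preimage f.continuous).isClosed_compl
    refine closure_minimal ?_ hcl h1 hqV
    rintro _ ⟨Q, rfl⟩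
    let Q' : PrimeSpectrum D := PrimeSpectrum.comap (Ideal.Quotient.mk _) Q
    have h2 : f (PrimeSpectrum.comap ρ Q') = f (PrimeSpectrum.comap ι Q') := congr($hf Q')
    change f (PrimeSpectrum.comap ρ Q') ∉ V
    rw [h2]
    refine hI V' _ fun a ha ↦ ?_
    change Ideal.Quotient.mk _ (ι a) ∈ Q.asIdeal
    rw [Ideal.Quotient.eq_zero_iff_mem.2 (Ideal.mem_map_of_mem ι ha)]
    exact zero_mem _
  -- For `a` in the kernel of `θ V`, `i (E a)` vanishes on the complement of `f⁻¹ V`, so `f` maps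
  -- the basic open set of `i (E a)` into `V`. By `hcon` this forces `E a ∈ P`. Applied to `1` this
  -- gives the contradiction.
  have hE : ∀ a ∈ (⨆ V : Z.affineOpens, RingHom.ker (θ V)), E a ∈ P.asIdeal := by
    intro a ha
    induction ha using Submodule.iSup_induction' with
    | mem V a ha =>
      have h1 : i (E a) ∈ I V := h.mem_of_mem_map _ _ (Ideal.Quotient.eq_zero_iff_mem.1 ha)
      by_contra h2
      obtain ⟨q, hq, hqV⟩ := hcon V.1 V.2 (E a) h2
      exact hq ((PrimeSpectrum.mem_vanishingIdeal _ _).1 h1 q hqV)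
    | zero => rw [map_zero]; exact zero_mem _
    | add a b _ _ ha hb => rw [map_add]; exact add_mem ha hb
  have h1 := hE 1 (by rw [htop]; trivial)
  rw [h.map_one] at h1
  exact P.isPrime.ne_top ((Ideal.eq_top_iff_one _).2 h1)

/-- On an invariant basic open subset, an invariant morphism to an affine scheme descends. -/
lemma exists_local_factorization {Z : Scheme.{u}} (f : Spec (.of A) ⟶ Z)
    (hf : Spec.map (CommRingCat.ofHom ρ) ≫ f = Spec.map (CommRingCat.ofHom ι) ≫ f)
    (V : Z.Opens) (hV : IsAffineOpen V) (a : B)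
    (ha : ∀ q : PrimeSpectrum A, i a ∉ q.asIdeal → f q ∈ V) :
    ∃ g : Spec (.of (Localization.Away a)) ⟶ Z,
      Spec.map (CommRingCat.ofHom (Localization.awayMap i a)) ≫ g =
        Spec.map (CommRingCat.ofHom (algebraMap A (Localization.Away (i a)))) ≫ f := by
  let A' := Localization.Away (i a)
  let D' := Localization.Away (ι (i a))
  let ι' : A' →+* D' := Localization.awayMap ι (i a)
  -- The element `i a` is invariant, so `ρ` extends to the localizations just as `ι` does.
  let ρ' : A' →+* D' := IsLocalization.Away.lift (i a) (g := (algebraMap D D').comp ρ) (by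
    rw [RingHom.comp_apply, h.invariant]
    exact IsLocalization.Away.algebraMap_isUnit _)
  have hι' : ι'.comp (algebraMap A A') = (algebraMap D D').comp ι :=
    IsLocalization.map_comp _
  have hρ' : ρ'.comp (algebraMap A A') = (algebraMap D D').comp ρ :=
    IsLocalization.Away.lift_comp _ _
  let fA : Spec (.of A') ⟶ Z := Spec.map (CommRingCat.ofHom (algebraMap A A')) ≫ f
  have hfA : Set.range fA ⊆ Set.range V.ι := by
    rintro _ ⟨q, rfl⟩
    refine (Set.ext_iff.mp (Scheme.Opens.range_ι V) _).2
      (ha (PrimeSpectrum.comap (algebraMap A A') q) ?_)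
    intro hq
    exact (PrimeSpectrum.isPrime (R := A') q).ne_top
      (Ideal.eq_top_of_isUnit_mem _ hq (IsLocalization.Away.algebraMap_isUnit (i a)))
  have : IsAffine V := hV
  let l : Spec (.of A') ⟶ V.toScheme := IsOpenImmersion.lift V.ι fA hfA
  have hl : l ≫ V.ι = fA := IsOpenImmersion.lift_fac V.ι fA hfA
  have hl' : Spec.map (CommRingCat.ofHom ρ') ≫ l = Spec.map (CommRingCat.ofHom ι') ≫ l := by
    rw [← cancel_mono V.ι, Category.assoc, Category.assoc, hl]
    simp only [fA]
    rw [← Spec.map_comp_assoc, ← Spec.map_comp_assoc, ← CommRingCat.ofHom_comp,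
      ← CommRingCat.ofHom_comp, hι', hρ', CommRingCat.ofHom_comp _ (algebraMap D D'),
      CommRingCat.ofHom_comp ι (algebraMap D D'), Spec.map_comp_assoc, Spec.map_comp_assoc, hf]
  -- Since `V` is affine, the morphism is a ring homomorphism `r`. It remains to see that its values
  -- come from the localization of `B`.
  obtain ⟨r, hr⟩ := Spec.map_surjective (l ≫ (Scheme.isoSpec V.toScheme).hom)
  have hr' : ρ'.comp r.hom = ι'.comp r.hom := by
    have : Spec.map (r ≫ CommRingCat.ofHom ρ') = Spec.map (r ≫ CommRingCat.ofHom ι') := by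
      rw [Spec.map_comp, Spec.map_comp, hr, reassoc_of% hl']
    exact congrArg CommRingCat.Hom.hom (Spec.map_injective this)
  have hinj : Function.Injective (Localization.awayMap i a) :=
    IsLocalization.map_injective_of_injective _ _ _ h.injective
  have hmem : ∀ x, r.hom x ∈ (Localization.awayMap i a).range := by
    intro x
    obtain ⟨n, b, hb⟩ := IsLocalization.Away.surj (i a) (r.hom x)
    have h1 : algebraMap D D' (ρ b) = algebraMap D D' (ι b) := by
      have e1 := congrArg ρ' hb
      have e2 := congrArg ι' hb
      rw [_root_.map_mul, map_pow] at e1 e2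
      have f1 : ∀ y, ρ' (algebraMap A A' y) = algebraMap D D' (ρ y) := fun y ↦ congr($hρ' y)
      have f2 : ∀ y, ι' (algebraMap A A' y) = algebraMap D D' (ι y) := fun y ↦ congr($hι' y)
      have f3 : ρ' (r.hom x) = ι' (r.hom x) := congr($hr' x)
      rw [f1, f1] at e1
      rw [f2, f2] at e2
      rw [← e1, ← e2, f3, h.invariant]
    obtain ⟨⟨_, m, rfl⟩, hm⟩ := (IsLocalization.eq_iff_exists (.powers (ι (i a))) D').1 h1
    -- The numerator `b` is invariant only after multiplication by a power of `i a`. The preimage of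
    -- `r x = b / (i a)^n` is therefore `E ((i a)^m b) / a^(m + n)`.
    have h2 : i (E (i a ^ m * b)) = i a ^ m * b := by
      refine h.eq_of_invariant _ ?_
      rw [_root_.map_mul ρ, _root_.map_mul ι, map_pow, map_pow, h.invariant]
      exact hm
    let y : Localization.Away a := IsLocalization.mk' _ (E (i a ^ m * b))
      (⟨a ^ (m + n), m + n, rfl⟩ : Submonoid.powers a)
    refine ⟨y, ?_⟩
    have hu : IsUnit (algebraMap A A' (i a)) := IsLocalization.Away.algebraMap_isUnit (i a)
    refine (hu.pow (m + n)).mul_left_cancel ?_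
    have h3 : algebraMap _ (Localization.Away a) (a ^ (m + n)) * y =
        algebraMap _ (Localization.Away a) (E (i a ^ m * b)) :=
      IsLocalization.mk'_spec' (Localization.Away a) (E (i a ^ m * b))
        (⟨a ^ (m + n), m + n, rfl⟩ : Submonoid.powers a)
    have h4 := congrArg (Localization.awayMap i a) h3
    have h5 : ∀ z, Localization.awayMap i a (algebraMap _ _ z) = algebraMap A A' (i z) :=
      fun z ↦ IsLocalization.map_eq _ _
    rw [_root_.map_mul, h5, h5, h2, map_pow, map_pow] at h4
    rw [h4, _root_.map_mul, map_pow, ← hb]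
    ring
  obtain ⟨g, hg⟩ := exists_comp_eq_of_mem_range hinj hmem
  refine ⟨Spec.map (CommRingCat.ofHom g) ≫ (Scheme.isoSpec V.toScheme).inv ≫ V.ι, ?_⟩
  rw [← Spec.map_comp_assoc, ← CommRingCat.ofHom_comp, hg]
  change Spec.map r ≫ _ = _
  rw [hr, Category.assoc, Iso.hom_inv_id_assoc, hl]

/-- An invariant morphism descends to the spectrum of the ring of invariants. -/
lemma exists_factorization [IsDomain B] {Z : Scheme.{u}} (f : Spec (.of A) ⟶ Z)
    (hf : Spec.map (CommRingCat.ofHom ρ) ≫ f = Spec.map (CommRingCat.ofHom ι) ≫ f) :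
    ∃ g : Spec (.of B) ⟶ Z, Spec.map (CommRingCat.ofHom i) ≫ g = f := by
  have : Surjective (Spec.map (CommRingCat.ofHom i)) := ⟨h.comap_surjective⟩
  refine exists_factorization_of_local _ f fun P ↦ ?_
  obtain ⟨V, hV, a, haP, ha⟩ := h.exists_basicOpen_le f hf P
  obtain ⟨g, hg⟩ := h.exists_local_factorization f hf V hV a ha
  refine ⟨_, _, Spec.map (CommRingCat.ofHom (algebraMap B (Localization.Away a))),
    Spec.map (CommRingCat.ofHom (algebraMap A (Localization.Away (i a)))),
    Spec.map (CommRingCat.ofHom (Localization.awayMap i a)), g, ?_, ?_, ?_, hg⟩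
  · exact IsOpenImmersion.of_isLocalization a
  · have : P ∈ Set.range (PrimeSpectrum.comap (algebraMap B (Localization.Away a))) := by
      rw [PrimeSpectrum.localization_away_comap_range (Localization.Away a) a]
      exact haP
    exact this
  · have : IsLocalization ((Submonoid.powers a).map i) (Localization.Away (i a)) := by
      rw [Submonoid.map_powers]; infer_instance
    exact isPullback_SpecMap_of_isPushout _ _ _ _ (CommRingCat.isPushout_of_isLocalization i
      (Localization.awayMap i a) (IsLocalization.map_comp _) (Submonoid.powers a))

end IsReynolds
end AffineQuotient
end Toric

/-! ### Gradings as coactions; projection to degree zero. -/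

namespace Toric

section Coaction

variable (k : Type u) [Field k] {S T C : Type u} [AddCommMonoid S] [AddCommMonoid T]
  [AddCommGroup C]

/-- The coaction of `k[C]` on `k[S]` that belongs to the grading `deg : S → C`. -/
noncomputable def degCoaction (deg : S →+ C) :
    AddMonoidAlgebra k S →ₐ[k] AddMonoidAlgebra k C ⊗[k] AddMonoidAlgebra k S :=
  AddMonoidAlgebra.lift k _ S
    { toFun s := AddMonoidAlgebra.single (deg s.toAdd) (1 : k) ⊗ₜ[k]
        AddMonoidAlgebra.single s.toAdd (1 : k)
      map_one' := by
        rw [toAdd_one, map_zero]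
        rfl
      map_mul' s t := by
        rw [toAdd_mul, map_add, Algebra.TensorProduct.tmul_mul_tmul,
          AddMonoidAlgebra.single_mul_single, AddMonoidAlgebra.single_mul_single, one_mul] }

lemma degCoaction_single (deg : S →+ C) (s : S) (c : k) :
    degCoaction k deg (AddMonoidAlgebra.single s c) =
      AddMonoidAlgebra.single (deg s) (1 : k) ⊗ₜ[k] AddMonoidAlgebra.single s c := by
  rw [degCoaction, AddMonoidAlgebra.lift_single]
  change c • (AddMonoidAlgebra.single (deg s) (1 : k) ⊗ₜ[k] AddMonoidAlgebra.single s (1 : k)) = _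
  rw [← TensorProduct.tmul_smul, AddMonoidAlgebra.smul_single, smul_eq_mul, mul_one]

variable {k}

/-- The projection of `k[C] ⊗ A` to the part of degree `0`. -/
noncomputable def coeffZero (A : Type u) [CommRing A] [Algebra k A] :
    AddMonoidAlgebra k C ⊗[k] A →ₗ[k] A :=
  (TensorProduct.lid k A).toLinearMap ∘ₗ LinearMap.rTensor A
    ((Finsupp.lapply 0 : (C →₀ k) →ₗ[k] k) ∘ₗ (AddMonoidAlgebra.coeffLinearEquiv k).toLinearMap)

lemma coeffZero_tmul {A : Type u} [CommRing A] [Algebra k A] (f : AddMonoidAlgebra k C) (a : A) :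
    coeffZero A (f ⊗ₜ a) = f.coeff 0 • a := by
  simp [coeffZero]

/-- Linearity over `A` is what sends the extension of an ideal of `A` to `k[C] ⊗ A` back into that
ideal. -/
lemma coeffZero_mul {A : Type u} [CommRing A] [Algebra k A] (d : AddMonoidAlgebra k C ⊗[k] A)
    (a : A) : coeffZero A (d * (1 ⊗ₜ a)) = coeffZero A d * a := by
  induction d with
  | zero => simp
  | add x y hx hy => rw [add_mul, map_add, hx, hy, map_add, add_mul]
  | tmul f b =>
    rw [Algebra.TensorProduct.tmul_mul_tmul, coeffZero_tmul, coeffZero_tmul, mul_one,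
      Algebra.smul_mul_assoc]

lemma coeffZero_one_tmul {A : Type u} [CommRing A] [Algebra k A] (a : A) :
    coeffZero A ((1 : AddMonoidAlgebra k C) ⊗ₜ[k] a) = a := by
  rw [coeffZero_tmul, AddMonoidAlgebra.one_def]
  simp

omit [AddCommMonoid S] in
lemma comapDomain_single_of_notMem_range {f : T → S} (hf : Function.Injective f) {s : S}
    (hs : s ∉ Set.range f) (c : k) :
    AddMonoidAlgebra.comapDomain f hf (AddMonoidAlgebra.single s c) = 0 := by
  ext t
  have : s ≠ f t := fun h ↦ hs ⟨t, h.symm⟩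
  simp [this]

/-- The monoid algebra of the submonoid of the elements of degree `0` is a ring of invariants. -/
lemma isReynolds_degCoaction {deg : S →+ C} {f : T →+ S} (hf : Function.Injective f)
    (hdeg : ∀ s, deg s = 0 ↔ s ∈ Set.range f) :
    IsReynolds (degCoaction k deg).toRingHom
      (Algebra.TensorProduct.includeRight :
        AddMonoidAlgebra k S →ₐ[k] AddMonoidAlgebra k C ⊗[k] AddMonoidAlgebra k S).toRingHom
      (AddMonoidAlgebra.mapDomainAlgHom k k f).toRingHom
      { toFun := AddMonoidAlgebra.comapDomain f hf
        map_zero' := AddMonoidAlgebra.comapDomain_zero _ _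
        map_add' := AddMonoidAlgebra.comapDomain_add _ _ } := by
  have hker : ∀ t, deg (f t) = 0 := fun t ↦ (hdeg _).2 ⟨t, rfl⟩
  -- Followed by the inclusion, `E` is the coaction followed by `coeffZero`; the last two Reynolds
  -- properties follow formally.
  have hE : ∀ a, AddMonoidAlgebra.mapDomainAlgHom k k f (AddMonoidAlgebra.comapDomain f hf a) =
      coeffZero _ (degCoaction k deg a) := by
    intro a
    induction a using AddMonoidAlgebra.induction_linear with
    | zero => simp
    | add a b ha hb => rw [AddMonoidAlgebra.comapDomain_add, map_add, map_add, map_add, ha, hb]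
    | single s c =>
      rw [degCoaction_single, coeffZero_tmul]
      by_cases hs : s ∈ Set.range f
      · obtain ⟨t, rfl⟩ := hs
        rw [hker]
        simp
      · rw [comapDomain_single_of_notMem_range hf hs]
        have : deg s ≠ 0 := fun h ↦ hs ((hdeg s).1 h)
        simp [this]
  refine ⟨fun b ↦ ?_, fun b a ↦ ?_, ?_, fun a ha ↦ ?_, fun I a ha ↦ ?_⟩
  · change degCoaction k deg (AddMonoidAlgebra.mapDomainAlgHom k k f b) =
      1 ⊗ₜ AddMonoidAlgebra.mapDomainAlgHom k k f b
    induction b using AddMonoidAlgebra.induction_linear with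
    | zero => simp
    | add a b ha hb => rw [map_add, map_add, ha, hb, TensorProduct.tmul_add]
    | single t c =>
      simp only [AddMonoidAlgebra.mapDomainAlgHom_apply, AddMonoidAlgebra.mapDomain_single]
      rw [degCoaction_single, hker]
      rfl
  · change AddMonoidAlgebra.comapDomain f hf (AddMonoidAlgebra.mapDomainAlgHom k k f b * a) =
      b * AddMonoidAlgebra.comapDomain f hf a
    induction b using AddMonoidAlgebra.induction_linear with
    | zero => simp
    | add b b' hb hb' => rw [map_add, add_mul, AddMonoidAlgebra.comapDomain_add, hb, hb', add_mul]
    | single t c =>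
      induction a using AddMonoidAlgebra.induction_linear with
      | zero => simp
      | add a a' ha ha' =>
        rw [mul_add, AddMonoidAlgebra.comapDomain_add, ha, ha', ← mul_add,
          AddMonoidAlgebra.comapDomain_add]
      | single s d =>
        simp only [AddMonoidAlgebra.mapDomainAlgHom_apply, AddMonoidAlgebra.mapDomain_single]
        rw [AddMonoidAlgebra.single_mul_single]
        by_cases hs : s ∈ Set.range f
        · obtain ⟨s, rfl⟩ := hs
          rw [← map_add, AddMonoidAlgebra.comapDomain_single_map,
            AddMonoidAlgebra.comapDomain_single_map, AddMonoidAlgebra.single_mul_single]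
        · rw [comapDomain_single_of_notMem_range hf hs, comapDomain_single_of_notMem_range hf,
            mul_zero]
          rw [← hdeg, map_add, hker, zero_add, hdeg]
          exact hs
  · change AddMonoidAlgebra.comapDomain f hf 1 = 1
    rw [AddMonoidAlgebra.one_def, ← map_zero f, AddMonoidAlgebra.comapDomain_single_map,
      AddMonoidAlgebra.one_def]
  · exact (hE a).trans ((congrArg (coeffZero _) ha).trans (coeffZero_one_tmul a))
  -- The extra factor `x` absorbs the scalars in the induction over the extended ideal; in the end
  -- `x = 1`.
  · have h1 : ∀ d ∈ I.map (Algebra.TensorProduct.includeRight :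
        AddMonoidAlgebra k S →ₐ[k] AddMonoidAlgebra k C ⊗[k] AddMonoidAlgebra k S).toRingHom,
        ∀ x, coeffZero _ (x * d) ∈ I := by
      intro d hd
      induction hd using Submodule.span_induction with
      | mem d hd =>
        obtain ⟨a, ha, rfl⟩ := hd
        exact fun x ↦ (coeffZero_mul x a).symm ▸ I.mul_mem_left _ ha
      | zero => intro x; rw [mul_zero, map_zero]; exact zero_mem _
      | add d d' _ _ hd hd' => intro x; rw [mul_add, map_add]; exact add_mem (hd x) (hd' x)
      | smul y d _ h => intro x; rw [smul_eq_mul, ← mul_assoc]; exact h _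
    have h2 := h1 _ ha 1
    rw [one_mul] at h2
    exact (hE a).symm ▸ h2

end Coaction
end Toric

/-! ### The charts of the Cox ring and their parts of degree zero. -/

namespace Toric
namespace Fan

section CoxCharts

variable (k : Type u) [Field k] {N : Type u} [AddCommGroup N] (Δ : Fan N)

variable {Δ} in
/-- The monoid of the exponents of the Laurent monomials in the rays that are regular on the chart of
the Cox ring that belongs to the cone `σ`. -/
def exponents (σ : Δ.Cone) : AddSubmonoid (Δ.Ray → ℤ) where
  carrier := {s | ∀ v : Δ.Ray, ray v.1 ≤ σ.1 → 0 ≤ s v}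
  zero_mem' _ _ := le_rfl
  add_mem' ha hb v hv := add_nonneg (ha v hv) (hb v hv)

variable {Δ} in
lemma exponents_anti {σ τ : Δ.Cone} (h : τ ≤ σ) : exponents σ ≤ exponents τ :=
  fun _ hs v hv ↦ hs v (hv.trans h)

variable {Δ} in
/-- The ring of the Laurent polynomials that are regular on the chart of the Cox ring that belongs to
the cone `σ`. -/
abbrev CoxChartRing (σ : Δ.Cone) : Type u := AddMonoidAlgebra k (exponents σ)

variable {Δ} in
/-- The inclusion of the exponents of monomials. -/
def natExponent (σ : Δ.Cone) : (Δ.Ray →₀ ℕ) →+ exponents σ where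
  toFun m := ⟨fun v ↦ m v, fun _ _ ↦ Int.natCast_nonneg _⟩
  map_zero' := by ext; simp
  map_add' m n := by ext; simp

variable {Δ} in
lemma natExponent_injective (σ : Δ.Cone) : Function.Injective (natExponent σ) := by
  intro m n h
  ext v
  exact Int.natCast_inj.1 (congrFun (congrArg Subtype.val h) v)

variable {Δ} in
/-- The inclusion of the Cox ring into the coordinate ring of a chart. -/
noncomputable def coxRes (σ : Δ.Cone) : MvPolynomial Δ.Ray k →ₐ[k] CoxChartRing k σ :=
  AddMonoidAlgebra.mapDomainAlgHom k k (natExponent σ)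

variable {Δ} in
lemma coxRes_monomial (σ : Δ.Cone) (m : Δ.Ray →₀ ℕ) (c : k) :
    coxRes k σ (MvPolynomial.monomial m c) = AddMonoidAlgebra.single (natExponent σ m) c :=
  AddMonoidAlgebra.mapDomain_single

variable {Δ} in
/-- The inclusion of the coordinate rings of two charts. -/
noncomputable def coxChartRes {σ τ : Δ.Cone} (h : τ ≤ σ) :
    CoxChartRing k σ →ₐ[k] CoxChartRing k τ :=
  AddMonoidAlgebra.mapDomainAlgHom k k (AddSubmonoid.inclusion (exponents_anti h))

variable {Δ} in
lemma coxChartRes_comp_coxRes {σ τ : Δ.Cone} (h : τ ≤ σ) :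
    (coxChartRes k h).comp (coxRes k σ) = coxRes k τ := by
  rw [coxChartRes, coxRes, coxRes, ← AddMonoidAlgebra.mapDomainAlgHom_comp]
  rfl

variable [Module.Free ℤ N] [Module.Finite ℤ N]

attribute [local instance] Fintype.ofFinite

variable {Δ} in
open Classical in
/-- The exponent of the monomial `v^σ̄`. -/
noncomputable def coxExponent (σ : Δ.Cone) : Δ.Ray →₀ ℕ :=
  Finsupp.equivFunOnFinite.symm fun v ↦ if ray v.1 ≤ σ.1 then 0 else 1

lemma prod_X_pow (m : Δ.Ray → ℕ) : ∏ v : Δ.Ray, (MvPolynomial.X v : MvPolynomial Δ.Ray k) ^ m v =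
    MvPolynomial.monomial (Finsupp.equivFunOnFinite.symm m) 1 := by
  rw [MvPolynomial.monomial_eq, map_one, one_mul, Finsupp.prod_fintype _ _ fun _ ↦ pow_zero _]
  rfl

lemma coxMonomial_eq (σ : Δ.Cone) :
    Δ.coxMonomial k σ = MvPolynomial.monomial (coxExponent σ) 1 := by
  classical
  rw [coxExponent, ← prod_X_pow, coxMonomial, Finset.prod_filter]
  refine Finset.prod_congr rfl fun v _ ↦ ?_
  split_ifs <;> simp

variable {Δ} in
/-- The exponent of the inverse of the monomial `v^σ̄`. -/
noncomputable def negCoxExponent (σ : Δ.Cone) : exponents σ :=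
  ⟨fun v ↦ -(coxExponent σ v), fun v hv ↦ by simp [coxExponent, hv]⟩

lemma natExponent_add_negCoxExponent (σ : Δ.Cone) :
    natExponent σ (coxExponent σ) + negCoxExponent σ = 0 := by
  ext v
  change (coxExponent σ v : ℤ) + -(coxExponent σ v) = 0
  ring

/-- Negative entries occur only at rays outside `σ`, where `coxExponent` is `1`. Shifting by the sum
of all absolute values makes every entry nonnegative. -/
lemma exists_natExponent_eq (σ : Δ.Cone) (s : exponents σ) :
    ∃ (n : ℕ) (m : Δ.Ray →₀ ℕ), natExponent σ m = s + n • natExponent σ (coxExponent σ) := by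
  refine ⟨∑ v, (s.1 v).natAbs, Finsupp.equivFunOnFinite.symm fun v ↦
    (s.1 v + (∑ v, (s.1 v).natAbs : ℕ) * coxExponent σ v).toNat, ?_⟩
  ext v
  change (((s.1 v + (∑ v, (s.1 v).natAbs : ℕ) * coxExponent σ v).toNat : ℕ) : ℤ) =
    s.1 v + (∑ v, (s.1 v).natAbs) • (coxExponent σ v : ℤ)
  rw [Int.toNat_of_nonneg, nsmul_eq_mul]
  by_cases hv : ray v.1 ≤ σ.1
  · have := s.2 v hv
    positivity
  · have h1 : coxExponent σ v = 1 := by simp [coxExponent, hv]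
    have h2 : (s.1 v).natAbs ≤ ∑ v, (s.1 v).natAbs :=
      Finset.single_le_sum (f := fun v ↦ (s.1 v).natAbs) (fun _ _ ↦ Nat.zero_le _)
        (Finset.mem_univ v)
    rw [h1]
    push_cast
    have h3 : ((s.1 v).natAbs : ℤ) ≤ ((∑ v, (s.1 v).natAbs : ℕ) : ℤ) := by exact_mod_cast h2
    push_cast at h3
    have := neg_abs_le (s.1 v)
    have := Int.natCast_natAbs (s.1 v)
    linarith

lemma isLocalizationAway_coxRes (σ : Δ.Cone) :
    letI := (coxRes k σ).toRingHom.toAlgebra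
    IsLocalization.Away (Δ.coxMonomial k σ) (CoxChartRing k σ) := by
  let := (coxRes k σ).toRingHom.toAlgebra
  rw [coxMonomial_eq]
  exact isLocalizationAway_mapDomain (natExponent_injective σ) (coxExponent σ)
    ⟨_, Δ.natExponent_add_negCoxExponent σ⟩ (Δ.exists_natExponent_eq σ) fun _ ↦ rfl

/-- The localization of the Cox ring at `v^σ̄` is a ring of Laurent polynomials. -/
noncomputable def coxEquiv (σ : Δ.Cone) :
    Localization.Away (Δ.coxMonomial k σ) ≃+* CoxChartRing k σ :=
  letI := (coxRes k σ).toRingHom.toAlgebra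
  haveI := Δ.isLocalizationAway_coxRes k σ
  (IsLocalization.algEquiv (.powers (Δ.coxMonomial k σ)) (Localization.Away (Δ.coxMonomial k σ))
    (CoxChartRing k σ)).toRingEquiv

lemma coxEquiv_algebraMap (σ : Δ.Cone) (x : Δ.CoxRing k) :
    Δ.coxEquiv k σ (algebraMap _ _ x) = coxRes k σ x :=
  letI := (coxRes k σ).toRingHom.toAlgebra
  haveI := Δ.isLocalizationAway_coxRes k σ
  (IsLocalization.algEquiv (.powers (Δ.coxMonomial k σ)) (Localization.Away (Δ.coxMonomial k σ))
    (CoxChartRing k σ)).commutes x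

/-- The map that evaluates linear forms at the rays. -/
def evalRays (σ : Δ.Cone) : dualMonoid σ.1 →+ exponents σ where
  toFun u := ⟨fun v ↦ u.1 v.1, (Δ.mem_dualMonoid_iff σ u.1).1 u.2⟩
  map_zero' := rfl
  map_add' _ _ := rfl

lemma evalRays_injective (hΔ : Δ.IsNondegenerate) (σ : Δ.Cone) :
    Function.Injective (Δ.evalRays σ) := by
  intro u w h
  refine Subtype.ext (sub_eq_zero.1 (Δ.eq_zero_of_forall_ray hΔ fun v ↦ ?_))
  rw [LinearMap.sub_apply, sub_eq_zero]
  exact congrFun (congrArg Subtype.val h) v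

/-- The homomorphism `x^u ↦ ∏ v ^ ⟨u, v⟩`. -/
noncomputable def chartToCox (σ : Δ.Cone) : ChartRing k σ.1 →ₐ[k] CoxChartRing k σ :=
  AddMonoidAlgebra.mapDomainAlgHom k k (Δ.evalRays σ)

lemma chartToCox_single (σ : Δ.Cone) (u : dualMonoid σ.1) (c : k) :
    Δ.chartToCox k σ (AddMonoidAlgebra.single u c) =
      AddMonoidAlgebra.single (Δ.evalRays σ u) c :=
  AddMonoidAlgebra.mapDomain_single

lemma coxChartRes_comp_chartToCox {σ τ : Δ.Cone} (h : τ ≤ σ) :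
    (coxChartRes k h).comp (Δ.chartToCox k σ) = (Δ.chartToCox k τ).comp (chartRes k h) := by
  rw [coxChartRes, chartToCox, chartToCox, chartRes, ← AddMonoidAlgebra.mapDomainAlgHom_comp,
    ← AddMonoidAlgebra.mapDomainAlgHom_comp]
  rfl

/-- The degree of a Laurent monomial. -/
noncomputable def exponentDegree (σ : Δ.Cone) : exponents σ →+ Δ.Cl k where
  toFun s := ∑ v, s.1 v • Δ.rayClass k v
  map_zero' := by simp
  map_add' s t := by
    rw [← Finset.sum_add_distrib]
    exact Finset.sum_congr rfl fun v _ ↦ add_zsmul _ _ _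

/-- This is the exactness of `M → ℤ^Δ(1) → Cl(X)`; the conditions `s_v ≥ 0` on the rays of `σ` say
that the linear form lies in `σ^∨`. -/
lemma exponentDegree_eq_zero_iff (σ : Δ.Cone) (s : exponents σ) :
    Δ.exponentDegree k σ s = 0 ↔ s ∈ Set.range (Δ.evalRays σ) := by
  refine (Δ.sum_smul_rayClass_eq_zero_iff k s.1).trans ⟨?_, ?_⟩
  · rintro ⟨u, hu⟩
    exact ⟨⟨u, (Δ.mem_dualMonoid_iff σ u).2 fun v hv ↦ hu v ▸ s.2 v hv⟩,
      Subtype.ext (funext fun v ↦ (hu v).symm)⟩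
  · rintro ⟨u, rfl⟩
    exact ⟨u.1, fun _ ↦ rfl⟩

lemma exponentDegree_natExponent (σ : Δ.Cone) (m : Δ.Ray →₀ ℕ) :
    Δ.exponentDegree k σ (natExponent σ m) = Finsupp.weight (Δ.rayClass k) m := by
  rw [Finsupp.weight_apply, Finsupp.sum_fintype _ _ (by simp)]
  exact Finset.sum_congr rfl fun v _ ↦ natCast_zsmul _ _

lemma single_mem_range_chartToCox (σ : Δ.Cone) {s : exponents σ} (hs : Δ.exponentDegree k σ s = 0)
    (c : k) : AddMonoidAlgebra.single s c ∈ (Δ.chartToCox k σ).range := by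
  obtain ⟨u, rfl⟩ := (Δ.exponentDegree_eq_zero_iff k σ s).1 hs
  exact ⟨AddMonoidAlgebra.single u c, Δ.chartToCox_single k σ u c⟩

lemma coxMonomial_mem (σ : Δ.Cone) : Δ.coxMonomial k σ ∈
    Δ.coxGrading k (Finsupp.weight (Δ.rayClass k) (coxExponent σ)) := by
  rw [coxMonomial_eq]
  exact MvPolynomial.isWeightedHomogeneous_monomial _ _ _ rfl

lemma coxEquiv_val_mk_mul (σ : Δ.Cone) (n : ℕ) (x : Δ.CoxRing k) (hx : x ∈
    Δ.coxGrading k (n • Finsupp.weight (Δ.rayClass k) (coxExponent σ))) :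
    Δ.coxEquiv k σ (HomogeneousLocalization.Away.mk (Δ.coxGrading k) (Δ.coxMonomial_mem k σ) n x
      hx).val * AddMonoidAlgebra.single (n • natExponent σ (coxExponent σ)) 1 = coxRes k σ x := by
  have h1 : Δ.coxEquiv k σ (algebraMap _ _ (Δ.coxMonomial k σ ^ n)) =
      AddMonoidAlgebra.single (n • natExponent σ (coxExponent σ)) 1 := by
    rw [map_pow, map_pow, coxEquiv_algebraMap, coxMonomial_eq, coxRes_monomial,
      AddMonoidAlgebra.single_pow, one_pow]
  rw [← h1, ← map_mul, HomogeneousLocalization.Away.val_mk, ← coxEquiv_algebraMap]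
  congr 1
  rw [Localization.mk_eq_mk']
  exact IsLocalization.mk'_spec _ x (⟨Δ.coxMonomial k σ ^ n, n, rfl⟩ : Submonoid.powers _)

lemma natExponent_add_nsmul (σ : Δ.Cone) (n : ℕ) :
    n • natExponent σ (coxExponent σ) + n • negCoxExponent σ = 0 := by
  rw [← nsmul_add, natExponent_add_negCoxExponent, nsmul_zero]

lemma coxEquiv_val_mk (σ : Δ.Cone) (n : ℕ) (x : Δ.CoxRing k) (hx : x ∈
    Δ.coxGrading k (n • Finsupp.weight (Δ.rayClass k) (coxExponent σ))) :
    Δ.coxEquiv k σ (HomogeneousLocalization.Away.mk (Δ.coxGrading k) (Δ.coxMonomial_mem k σ) n x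
      hx).val = coxRes k σ x * AddMonoidAlgebra.single (n • negCoxExponent σ) 1 := by
  rw [← coxEquiv_val_mk_mul k Δ σ n x hx, mul_assoc, AddMonoidAlgebra.single_mul_single,
    natExponent_add_nsmul, mul_one, ← AddMonoidAlgebra.one_def, mul_one]

/-- Every monomial of the homogeneous numerator has the degree of the denominator, so the fraction
is a sum of Laurent monomials of degree `0`. -/
lemma coxEquiv_val_mem_range (σ : Δ.Cone)
    (z : HomogeneousLocalization.Away (Δ.coxGrading k) (Δ.coxMonomial k σ)) :
    Δ.coxEquiv k σ z.val ∈ (Δ.chartToCox k σ).range := by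
  obtain ⟨n, x, hx, rfl⟩ := HomogeneousLocalization.Away.mk_surjective (Δ.coxGrading k)
    (Δ.coxMonomial_mem k σ) z
  rw [coxEquiv_val_mk, ← MvPolynomial.support_sum_monomial_coeff x, map_sum, Finset.sum_mul]
  refine sum_mem fun m hm ↦ ?_
  rw [coxRes_monomial, AddMonoidAlgebra.single_mul_single]
  refine Δ.single_mem_range_chartToCox k σ ?_ _
  have h1 : Finsupp.weight (Δ.rayClass k) m = n • Finsupp.weight (Δ.rayClass k) (coxExponent σ) :=
    hx (MvPolynomial.mem_support_iff.1 hm)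
  rw [map_add, exponentDegree_natExponent, h1, ← Δ.exponentDegree_natExponent k σ, ← map_nsmul,
    ← map_add, natExponent_add_nsmul, map_zero]

/-- Clearing denominators turns the image of `x^u` into a monomial with the degree of a power of
`v^σ̄`. -/
lemma chartToCox_mem_range (σ : Δ.Cone) (b : ChartRing k σ.1) :
    (Δ.coxEquiv k σ).symm (Δ.chartToCox k σ b) ∈ (Δ.degreeZeroIncl k σ).range := by
  induction b using AddMonoidAlgebra.induction_linear with
  | zero => rw [map_zero, map_zero]; exact zero_mem _
  | add a b ha hb => rw [map_add, map_add]; exact add_mem ha hb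
  | single u c =>
    obtain ⟨n, m, hm⟩ := Δ.exists_natExponent_eq σ (Δ.evalRays σ u)
    have hx : MvPolynomial.monomial m c ∈
        Δ.coxGrading k (n • Finsupp.weight (Δ.rayClass k) (coxExponent σ)) := by
      refine MvPolynomial.isWeightedHomogeneous_monomial _ _ _ ?_
      rw [← Δ.exponentDegree_natExponent k σ, hm, map_add,
        (Δ.exponentDegree_eq_zero_iff k σ _).2 ⟨u, rfl⟩, zero_add, map_nsmul,
        exponentDegree_natExponent]
    refine ⟨HomogeneousLocalization.Away.mk (Δ.coxGrading k) (Δ.coxMonomial_mem k σ) n _ hx, ?_⟩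
    rw [RingEquiv.eq_symm_apply]
    refine (Δ.coxEquiv_val_mk k σ n _ hx).trans ?_
    rw [coxRes_monomial, AddMonoidAlgebra.single_mul_single, hm, add_assoc, natExponent_add_nsmul,
      add_zero, mul_one, chartToCox_single]

/-- The isomorphism `k[σ^∨ ∩ M] ≅ (Cox(X)_{v^σ̄})_0`. -/
lemma exists_degreeZero_equiv (hΔ : Δ.IsNondegenerate) (σ : Δ.Cone) :
    ∃ φ : ChartRing k σ.1 ≃+* HomogeneousLocalization.Away (Δ.coxGrading k) (Δ.coxMonomial k σ),
      ∀ b, Δ.degreeZeroIncl k σ (φ b) = (Δ.coxEquiv k σ).symm (Δ.chartToCox k σ b) := by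
  have hinj : Function.Injective (Δ.degreeZeroIncl k σ) := HomogeneousLocalization.val_injective _
  have hinj' : Function.Injective (Δ.chartToCox k σ) :=
    AddMonoidAlgebra.mapDomain_injective (Δ.evalRays_injective hΔ σ)
  obtain ⟨g, hg⟩ := exists_comp_eq_of_mem_range hinj
    (r := (Δ.coxEquiv k σ).symm.toRingHom.comp (Δ.chartToCox k σ).toRingHom)
    (Δ.chartToCox_mem_range k σ)
  have hg' : ∀ b, Δ.degreeZeroIncl k σ (g b) = (Δ.coxEquiv k σ).symm (Δ.chartToCox k σ b) :=
    fun b ↦ congr($hg b)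
  refine ⟨RingEquiv.ofBijective g ⟨fun a b hab ↦ ?_, fun z ↦ ?_⟩, hg'⟩
  · apply hinj'
    apply (Δ.coxEquiv k σ).symm.injective
    rw [← hg', ← hg', hab]
  · obtain ⟨b, hb⟩ := Δ.coxEquiv_val_mem_range k σ z
    refine ⟨b, hinj ?_⟩
    rw [hg', RingEquiv.symm_apply_eq]
    exact hb

/-- On exponents this is the identity `t + max(-t, 0) = max(t, 0)` with `t = ⟨u, v⟩`. -/
lemma isMonomialIso_of_forall {σ : Δ.Cone} {φ : ChartRing k σ.1 ≃+*
      HomogeneousLocalization.Away (Δ.coxGrading k) (Δ.coxMonomial k σ)}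
    (hφ : ∀ b, Δ.degreeZeroIncl k σ (φ b) = (Δ.coxEquiv k σ).symm (Δ.chartToCox k σ b)) :
    Δ.IsMonomialIso k σ φ := by
  intro u c
  apply (Δ.coxEquiv k σ).injective
  have h1 : (φ (AddMonoidAlgebra.single u c)).val = (Δ.coxEquiv k σ).symm
    (Δ.chartToCox k σ (AddMonoidAlgebra.single u c)) := hφ _
  rw [h1, map_mul, RingEquiv.apply_symm_apply, coxEquiv_algebraMap, coxEquiv_algebraMap,
    prod_X_pow, prod_X_pow, MvPolynomial.C_mul_monomial, coxRes_monomial, coxRes_monomial,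
    chartToCox_single, AddMonoidAlgebra.single_mul_single, mul_one]
  congr 1
  ext v
  change u.1 v.1 + ((-(u.1 v.1)).toNat : ℤ) = (((u.1 v.1)).toNat : ℤ)
  omega

end CoxCharts
end Fan
end Toric

/-! ### Gluing the quotient map from the charts. -/

namespace Toric
namespace Fan

open MonoidalCategory CartesianMonoidalCategory
open scoped MonObj

section QuotientMap

variable (k : Type u) [Field k] {N : Type u} [AddCommGroup N] [Module.Free ℤ N] [Module.Finite ℤ N]
  (Δ : Fan N)

/-- The chart of `Spec Cox(X) ∖ V(J_X)` that belongs to the cone `σ`. -/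
noncomputable def coxChartι (σ : Δ.Cone) :
    Spec (.of (CoxChartRing k σ)) ⟶ (Δ.coxOpen k).toScheme :=
  Spec.map (CommRingCat.ofHom (Δ.coxEquiv k σ).toRingHom) ≫ Δ.coxChart k σ

lemma coxChart_ι (σ : Δ.Cone) : Δ.coxChart k σ ≫ (Δ.coxOpen k).ι =
    Spec.map (CommRingCat.ofHom
      (algebraMap (Δ.CoxRing k) (Localization.Away (Δ.coxMonomial k σ)))) :=
  IsOpenImmersion.lift_fac _ _ _

lemma coxChartι_ι (σ : Δ.Cone) : Δ.coxChartι k σ ≫ (Δ.coxOpen k).ι =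
    Spec.map (CommRingCat.ofHom (coxRes k σ).toRingHom) := by
  rw [coxChartι, Category.assoc, coxChart_ι, ← Spec.map_comp, ← CommRingCat.ofHom_comp]
  congr 2
  exact RingHom.ext (Δ.coxEquiv_algebraMap k σ)

lemma coxChart_eq (σ : Δ.Cone) : Δ.coxChart k σ =
    Spec.map (CommRingCat.ofHom (Δ.coxEquiv k σ).symm.toRingHom) ≫ Δ.coxChartι k σ := by
  rw [coxChartι, ← Spec.map_comp_assoc, ← CommRingCat.ofHom_comp]
  have : (Δ.coxEquiv k σ).symm.toRingHom.comp (Δ.coxEquiv k σ).toRingHom = RingHom.id _ :=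
    RingHom.ext (Δ.coxEquiv k σ).symm_apply_apply
  rw [this, CommRingCat.ofHom_id]
  exact ((congrArg (· ≫ _) (Spec.map_id _)).trans (Category.id_comp _)).symm

instance (σ : Δ.Cone) : IsOpenImmersion (Δ.coxChartι k σ) := by
  have : IsOpenImmersion (Δ.coxChartι k σ ≫ (Δ.coxOpen k).ι) := by
    rw [coxChartι_ι]
    let := (coxRes k σ).toRingHom.toAlgebra
    have := Δ.isLocalizationAway_coxRes k σ
    exact IsOpenImmersion.of_isLocalization (Δ.coxMonomial k σ)
  exact IsOpenImmersion.of_comp _ (Δ.coxOpen k).ι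

lemma mem_range_coxChartι (σ : Δ.Cone) (x : (Δ.coxOpen k).toScheme) :
    x ∈ Set.range (Δ.coxChartι k σ) ↔
      Δ.coxMonomial k σ ∉ PrimeSpectrum.asIdeal (R := Δ.CoxRing k) ((Δ.coxOpen k).ι x) := by
  let := (coxRes k σ).toRingHom.toAlgebra
  have := Δ.isLocalizationAway_coxRes k σ
  have e := PrimeSpectrum.localization_away_comap_range (CoxChartRing k σ) (Δ.coxMonomial k σ)
  refine Iff.trans ?_ (Set.ext_iff.mp e ((Δ.coxOpen k).ι x))
  have h : ∀ y, (Δ.coxOpen k).ι (Δ.coxChartι k σ y) =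
      Spec.map (CommRingCat.ofHom (coxRes k σ).toRingHom) y := fun y ↦
    congr($(Δ.coxChartι_ι k σ) y)
  constructor
  · rintro ⟨y, rfl⟩
    exact ⟨y, (h y).symm⟩
  · rintro ⟨y, hy⟩
    exact ⟨y, (Δ.coxOpen k).ι.isOpenEmbedding.injective ((h y).trans hy)⟩

lemma coxMonomial_notMem_iff (σ : Δ.Cone) (p : PrimeSpectrum (Δ.CoxRing k)) :
    Δ.coxMonomial k σ ∉ p.asIdeal ↔
      ∀ v : Δ.Ray, ¬ ray v.1 ≤ σ.1 → MvPolynomial.X v ∉ p.asIdeal := by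
  rw [coxMonomial, Ideal.IsPrime.prod_mem_iff]
  simp only [Finset.mem_filter, Finset.mem_univ, true_and, not_exists, not_and]

/-- A ray outside `σ ∩ τ` lies outside `σ` or outside `τ`, so each variable of the new monomial
divides one of the old ones. Overlaps of charts thus lie in the chart of the intersection. -/
lemma coxMonomial_inter_notMem {σ τ : Δ.Cone} {p : PrimeSpectrum (Δ.CoxRing k)}
    (hσ : Δ.coxMonomial k σ ∉ p.asIdeal) (hτ : Δ.coxMonomial k τ ∉ p.asIdeal) :
    Δ.coxMonomial k (σ.inter τ) ∉ p.asIdeal := by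
  rw [coxMonomial_notMem_iff] at hσ hτ ⊢
  intro v hv
  by_cases h : ray v.1 ≤ σ.1
  · exact hτ v fun h' ↦ hv (le_inf h h')
  · exact hσ v h

/-- The open cover of `Spec Cox(X) ∖ V(J_X)` by its charts. -/
noncomputable def coxCover : (Δ.coxOpen k).toScheme.OpenCover :=
  Scheme.Cover.mkOfCovers Δ.Cone (fun σ ↦ Spec (.of (CoxChartRing k σ))) (Δ.coxChartι k)
    (fun x ↦ by
      obtain ⟨σ, hσ⟩ := (Δ.exists_coxMonomial_notMem k ((Δ.coxOpen k).ι x)).1 x.2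
      exact ⟨σ, (Δ.mem_range_coxChartι k σ x).2 hσ⟩)
    (fun σ ↦ inferInstanceAs (IsOpenImmersion (Δ.coxChartι k σ)))

/-- The quotient map on a chart. -/
noncomputable def chartQuotient (σ : Δ.Cone) :
    Spec (.of (CoxChartRing k σ)) ⟶ Spec (.of (ChartRing k σ.1)) :=
  Spec.map (CommRingCat.ofHom (Δ.chartToCox k σ).toRingHom)

/-- The inclusion of charts. -/
noncomputable def coxChartMap {σ τ : Δ.Cone} (h : τ ≤ σ) :
    Spec (.of (CoxChartRing k τ)) ⟶ Spec (.of (CoxChartRing k σ)) :=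
  Spec.map (CommRingCat.ofHom (coxChartRes k h).toRingHom)

lemma coxChartMap_coxChartι {σ τ : Δ.Cone} (h : τ ≤ σ) :
    Δ.coxChartMap k h ≫ Δ.coxChartι k σ = Δ.coxChartι k τ := by
  rw [← cancel_mono (Δ.coxOpen k).ι, Category.assoc, coxChartι_ι, coxChartι_ι, coxChartMap,
    ← Spec.map_comp, ← CommRingCat.ofHom_comp]
  congr 2
  exact congrArg AlgHom.toRingHom (coxChartRes_comp_coxRes k h)

lemma coxChartMap_chartQuotient {σ τ : Δ.Cone} (h : τ ≤ σ) :
    Δ.coxChartMap k h ≫ Δ.chartQuotient k σ =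
      Δ.chartQuotient k τ ≫ chartMap k (show τ.1 ≤ σ.1 from h) := by
  rw [coxChartMap, chartQuotient, chartQuotient, chartMap, ← Spec.map_comp, ← Spec.map_comp,
    ← CommRingCat.ofHom_comp, ← CommRingCat.ofHom_comp]
  congr 2
  exact congrArg AlgHom.toRingHom (Δ.coxChartRes_comp_chartToCox k h)

lemma coxChartMap_chartQuotient_chartι {σ τ : Δ.Cone} (h : τ ≤ σ) :
    Δ.coxChartMap k h ≫ Δ.chartQuotient k σ ≫ Δ.chartι k σ =
      Δ.chartQuotient k τ ≫ Δ.chartι k τ := by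
  rw [← Category.assoc, coxChartMap_chartQuotient, Category.assoc,
    chartMap_chartι k Δ h]

/-- The overlap factors through the chart of `σ ∩ τ`, and there both maps restrict to the quotient
map of that chart. -/
lemma chartQuotient_agree (σ τ : Δ.Cone) :
    pullback.fst (Δ.coxChartι k σ) (Δ.coxChartι k τ) ≫ Δ.chartQuotient k σ ≫ Δ.chartι k σ =
      pullback.snd (Δ.coxChartι k σ) (Δ.coxChartι k τ) ≫ Δ.chartQuotient k τ ≫ Δ.chartι k τ := by
  let q := pullback.fst (Δ.coxChartι k σ) (Δ.coxChartι k τ) ≫ Δ.coxChartι k σ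
  have hq : Set.range q ⊆ Set.range (Δ.coxChartι k (σ.inter τ)) := by
    rintro _ ⟨x, rfl⟩
    refine (Δ.mem_range_coxChartι k _ _).2 (Δ.coxMonomial_inter_notMem k ?_ ?_)
    · exact (Δ.mem_range_coxChartι k σ _).1
        ⟨pullback.fst (Δ.coxChartι k σ) (Δ.coxChartι k τ) x, rfl⟩
    · refine (Δ.mem_range_coxChartι k τ _).1
        ⟨pullback.snd (Δ.coxChartι k σ) (Δ.coxChartι k τ) x, ?_⟩
      exact congr($((pullback.condition (f := Δ.coxChartι k σ) (g := Δ.coxChartι k τ)).symm) x)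
  let l := IsOpenImmersion.lift (Δ.coxChartι k (σ.inter τ)) q hq
  have hl : l ≫ Δ.coxChartι k (σ.inter τ) = q := IsOpenImmersion.lift_fac _ _ hq
  have hσ : σ.inter τ ≤ σ := show σ.1 ⊓ τ.1 ≤ σ.1 from inf_le_left
  have hτ : σ.inter τ ≤ τ := show σ.1 ⊓ τ.1 ≤ τ.1 from inf_le_right
  have h1 : l ≫ Δ.coxChartMap k hσ = pullback.fst (Δ.coxChartι k σ) (Δ.coxChartι k τ) := by
    rw [← cancel_mono (Δ.coxChartι k σ), Category.assoc, coxChartMap_coxChartι, hl]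
  have h2 : l ≫ Δ.coxChartMap k hτ = pullback.snd (Δ.coxChartι k σ) (Δ.coxChartι k τ) := by
    rw [← cancel_mono (Δ.coxChartι k τ), Category.assoc, coxChartMap_coxChartι, hl,
      ← pullback.condition]
  rw [← h1, ← h2, Category.assoc, Category.assoc, coxChartMap_chartQuotient_chartι,
    coxChartMap_chartQuotient_chartι]

/-- The quotient map `Spec Cox(X) ∖ V(J_X) ⟶ X`. -/
noncomputable def quotientMap : (Δ.coxOpen k).toScheme ⟶ Δ.toricVariety k :=
  (Δ.coxCover k).glueMorphisms (fun σ ↦ Δ.chartQuotient k σ ≫ Δ.chartι k σ)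
    (Δ.chartQuotient_agree k)

lemma coxChartι_quotientMap (σ : Δ.Cone) :
    Δ.coxChartι k σ ≫ Δ.quotientMap k = Δ.chartQuotient k σ ≫ Δ.chartι k σ :=
  (Δ.coxCover k).ι_glueMorphisms _ _ σ

lemma coxOpen_hom_ext {Z : Scheme.{u}} {f g : (Δ.coxOpen k).toScheme ⟶ Z}
    (h : ∀ σ, Δ.coxChartι k σ ≫ f = Δ.coxChartι k σ ≫ g) : f = g :=
  Scheme.Cover.hom_ext (Δ.coxCover k) _ _ h

omit [Module.Free ℤ N] in
lemma toricVariety_hom_ext {Z : Scheme.{u}} {f g : Δ.toricVariety k ⟶ Z}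
    (h : ∀ σ, Δ.chartι k σ ≫ f = Δ.chartι k σ ≫ g) : f = g :=
  colimit.hom_ext h

omit [Module.Free ℤ N] in
lemma chartι_toricVarietyStr (σ : Δ.Cone) : Δ.chartι k σ ≫ Δ.toricVarietyStr k =
    Spec.map (CommRingCat.ofHom (algebraMap k (ChartRing k σ.1))) :=
  colimit.ι_desc _ _

lemma quotientMap_toricVarietyStr :
    Δ.quotientMap k ≫ Δ.toricVarietyStr k = (Δ.coxU k).hom := by
  refine Δ.coxOpen_hom_ext k fun σ ↦ ?_
  change _ = Δ.coxChartι k σ ≫ (Δ.coxOpen k).ι ≫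
    Spec.map (CommRingCat.ofHom (algebraMap k (Δ.CoxRing k)))
  rw [← Category.assoc, coxChartι_quotientMap, Category.assoc, chartι_toricVarietyStr,
    ← Category.assoc, coxChartι_ι, chartQuotient, ← Spec.map_comp, ← Spec.map_comp,
    ← CommRingCat.ofHom_comp, ← CommRingCat.ofHom_comp]
  congr 2
  exact (Δ.chartToCox k σ).comp_algebraMap.trans (coxRes k σ).comp_algebraMap.symm

/-- The quotient map as a morphism of schemes over `k`. -/
noncomputable def quotientMapOver : Δ.coxU k ⟶ Δ.toricVarietyOver k :=
  Over.homMk (Δ.quotientMap k) (Δ.quotientMap_toricVarietyStr k)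

lemma coxChart_quotientMap {σ : Δ.Cone} {φ : ChartRing k σ.1 ≃+*
      HomogeneousLocalization.Away (Δ.coxGrading k) (Δ.coxMonomial k σ)}
    (hφ : ∀ b, Δ.degreeZeroIncl k σ (φ b) = (Δ.coxEquiv k σ).symm (Δ.chartToCox k σ b)) :
    Δ.coxChart k σ ≫ Δ.quotientMap k =
      Spec.map (CommRingCat.ofHom ((Δ.degreeZeroIncl k σ).comp φ.toRingHom)) ≫ Δ.chartι k σ := by
  have h : (Δ.degreeZeroIncl k σ).comp φ.toRingHom =
      (Δ.coxEquiv k σ).symm.toRingHom.comp (Δ.chartToCox k σ).toRingHom := RingHom.ext hφ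
  rw [h, CommRingCat.ofHom_comp, Spec.map_comp, Category.assoc, coxChart_eq, Category.assoc,
    coxChartι_quotientMap]
  rfl

end QuotientMap
end Fan
end Toric

/-! ### Invariance and the universal property. -/

namespace Toric
namespace Fan

open MonoidalCategory CartesianMonoidalCategory
open scoped MonObj

section Quotient

variable (k : Type u) [Field k] {N : Type u} [AddCommGroup N] [Module.Free ℤ N] [Module.Finite ℤ N]
  (Δ : Fan N)

/-- On a chart the restricted coaction is the one given by the degree of Laurent monomials; it
suffices to compare the variables. -/
lemma map_coxRes_comp_coaction (σ : Δ.Cone) :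
    (Algebra.TensorProduct.map (AlgHom.id k (AddMonoidAlgebra k (Δ.Cl k))) (coxRes k σ)).comp
      (Δ.coaction k) = (degCoaction k (Δ.exponentDegree k σ)).comp (coxRes k σ) := by
  refine MvPolynomial.algHom_ext fun v ↦ ?_
  have h1 : coxRes k σ (MvPolynomial.X v) =
    AddMonoidAlgebra.single (natExponent σ (Finsupp.single v 1)) 1 := coxRes_monomial k σ _ _
  rw [AlgHom.comp_apply, AlgHom.comp_apply, h1, degCoaction_single, exponentDegree_natExponent,
    coaction, MvPolynomial.aeval_X, Algebra.TensorProduct.map_tmul, h1, Finsupp.weight_single]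
  simp

/-- The scheme `G × (Spec Cox(X) ∖ V(J_X))`. -/
noncomputable def groupTensor : Scheme.{u} := (Δ.group k ⊗ Δ.coxU k).left

/-- The projection of `G × (Spec Cox(X) ∖ V(J_X))` to the first factor. -/
noncomputable def groupTensorFst : Δ.groupTensor k ⟶ Spec (.of (AddMonoidAlgebra k (Δ.Cl k))) :=
  (fst (Δ.group k) (Δ.coxU k)).left

/-- The projection of `G × (Spec Cox(X) ∖ V(J_X))` to the second factor. -/
noncomputable def groupTensorSnd : Δ.groupTensor k ⟶ (Δ.coxOpen k).toScheme :=
  (snd (Δ.group k) (Δ.coxU k)).left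

/-- The action of `G` as a morphism of schemes. -/
noncomputable def groupTensorAct : Δ.groupTensor k ⟶ (Δ.coxOpen k).toScheme := (Δ.actU k).left

lemma isPullback_groupTensor : IsPullback (Δ.groupTensorFst k) (Δ.groupTensorSnd k)
    (Spec.map (CommRingCat.ofHom (algebraMap k (AddMonoidAlgebra k (Δ.Cl k)))))
    ((Δ.coxOpen k).ι ≫ Spec.map (CommRingCat.ofHom (algebraMap k (Δ.CoxRing k)))) :=
  IsPullback.of_hasPullback (Δ.group k).hom (Δ.coxU k).hom

section

variable (A : Type u) [CommRing A] [Algebra k A]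

/-- The projection of `G × Spec A` to the first factor. -/
noncomputable abbrev tensorFst : Spec (.of (AddMonoidAlgebra k (Δ.Cl k) ⊗[k] A)) ⟶
    Spec (.of (AddMonoidAlgebra k (Δ.Cl k))) :=
  Spec.map (CommRingCat.ofHom (Algebra.TensorProduct.includeLeftRingHom :
    AddMonoidAlgebra k (Δ.Cl k) →+* AddMonoidAlgebra k (Δ.Cl k) ⊗[k] A))

/-- The projection of `G × Spec A` to the second factor. -/
noncomputable abbrev tensorSnd : Spec (.of (AddMonoidAlgebra k (Δ.Cl k) ⊗[k] A)) ⟶ Spec (.of A) :=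
  Spec.map (CommRingCat.ofHom (Algebra.TensorProduct.includeRight :
    A →ₐ[k] AddMonoidAlgebra k (Δ.Cl k) ⊗[k] A).toRingHom)

lemma isPullback_tensor : IsPullback (Δ.tensorFst k A) (Δ.tensorSnd k A)
    (Spec.map (CommRingCat.ofHom (algebraMap k (AddMonoidAlgebra k (Δ.Cl k)))))
    (Spec.map (CommRingCat.ofHom (algebraMap k A))) :=
  isPullback_SpecMap_of_isPushout _ _ _ _
    (CommRingCat.isPushout_tensorProduct k (AddMonoidAlgebra k (Δ.Cl k)) A)

end

lemma coxChartι_str (σ : Δ.Cone) : Δ.coxChartι k σ ≫ (Δ.coxOpen k).ι ≫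
    Spec.map (CommRingCat.ofHom (algebraMap k (Δ.CoxRing k))) =
      Spec.map (CommRingCat.ofHom (algebraMap k (CoxChartRing k σ))) := by
  rw [← Category.assoc, coxChartι_ι, ← Spec.map_comp, ← CommRingCat.ofHom_comp]
  congr 2
  exact (coxRes k σ).comp_algebraMap

/-- The inclusion of a chart into `G × (Spec Cox(X) ∖ V(J_X))`. -/
noncomputable def groupTensorChart (σ : Δ.Cone) :
    Spec (.of (AddMonoidAlgebra k (Δ.Cl k) ⊗[k] CoxChartRing k σ)) ⟶ Δ.groupTensor k :=
  (Δ.isPullback_groupTensor k).lift (Δ.tensorFst k _) (Δ.tensorSnd k _ ≫ Δ.coxChartι k σ) (by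
    rw [Category.assoc, coxChartι_str, (Δ.isPullback_tensor k _).w])

lemma groupTensorChart_fst (σ : Δ.Cone) :
    Δ.groupTensorChart k σ ≫ Δ.groupTensorFst k = Δ.tensorFst k _ :=
  IsPullback.lift_fst ..

lemma groupTensorChart_snd (σ : Δ.Cone) :
    Δ.groupTensorChart k σ ≫ Δ.groupTensorSnd k = Δ.tensorSnd k _ ≫ Δ.coxChartι k σ :=
  IsPullback.lift_snd ..

/-- Here `c` is the inclusion of `G × U` in `G × Spec Cox(X)`, the latter read as the spectrum of a
tensor product. The action on `U` thereby becomes a statement about rings. -/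
lemma groupTensorAct_ι : ∃ c : Δ.groupTensor k ⟶
      Spec (.of (AddMonoidAlgebra k (Δ.Cl k) ⊗[k] Δ.CoxRing k)),
    c ≫ Δ.tensorFst k _ = Δ.groupTensorFst k ∧
    c ≫ Δ.tensorSnd k _ = Δ.groupTensorSnd k ≫ (Δ.coxOpen k).ι ∧
    Δ.groupTensorAct k ≫ (Δ.coxOpen k).ι =
      c ≫ Spec.map (CommRingCat.ofHom (Δ.coaction k).toRingHom) := by
  let e := pullbackSpecIso k (AddMonoidAlgebra k (Δ.Cl k)) (Δ.CoxRing k)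
  let w : Δ.groupTensor k ⟶ pullback
      (Spec.map (CommRingCat.ofHom (algebraMap k (AddMonoidAlgebra k (Δ.Cl k)))))
      (Spec.map (CommRingCat.ofHom (algebraMap k (Δ.CoxRing k)))) :=
    (Δ.group k ◁ Δ.coxUι k).left
  refine ⟨w ≫ e.hom, ?_, ?_, ?_⟩
  · rw [Category.assoc, pullbackSpecIso_hom_fst]
    exact congr(($(whiskerLeft_fst (Δ.group k) (Δ.coxUι k))).left)
  · rw [Category.assoc, tensorSnd]
    refine (congrArg (w ≫ ·) (pullbackSpecIso_hom_snd k _ _)).trans ?_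
    exact congr(($(whiskerLeft_snd (Δ.group k) (Δ.coxUι k))).left)
  · rw [Category.assoc]
    exact congr(($(Δ.actU_coxUι k)).left)

lemma groupTensorChart_act (σ : Δ.Cone) : Δ.groupTensorChart k σ ≫ Δ.groupTensorAct k =
    Spec.map (CommRingCat.ofHom (degCoaction k (Δ.exponentDegree k σ)).toRingHom) ≫
      Δ.coxChartι k σ := by
  obtain ⟨c, h₁, h₂, h₃⟩ := Δ.groupTensorAct_ι k
  have hc : Δ.groupTensorChart k σ ≫ c = Spec.map (CommRingCat.ofHom (Algebra.TensorProduct.map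
      (AlgHom.id k (AddMonoidAlgebra k (Δ.Cl k))) (coxRes k σ)).toRingHom) := by
    apply (Δ.isPullback_tensor k (Δ.CoxRing k)).hom_ext
    · rw [Category.assoc, h₁, groupTensorChart_fst, tensorFst, tensorFst, ← Spec.map_comp,
        ← CommRingCat.ofHom_comp]
      congr 2
      refine RingHom.ext fun x ↦ ?_
      simp
    · rw [Category.assoc, h₂, ← Category.assoc, groupTensorChart_snd, Category.assoc, coxChartι_ι,
        tensorSnd, tensorSnd, ← Spec.map_comp, ← Spec.map_comp, ← CommRingCat.ofHom_comp,
        ← CommRingCat.ofHom_comp]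
      congr 2
  rw [← cancel_mono (Δ.coxOpen k).ι, Category.assoc, h₃, ← Category.assoc, hc, Category.assoc,
    coxChartι_ι, ← Spec.map_comp, ← Spec.map_comp, ← CommRingCat.ofHom_comp,
    ← CommRingCat.ofHom_comp]
  congr 2
  exact congrArg AlgHom.toRingHom (Δ.map_coxRes_comp_coaction k σ)

lemma groupTensor_hom_ext {Z : Scheme.{u}} {f g : Δ.groupTensor k ⟶ Z}
    (h : ∀ σ, Δ.groupTensorChart k σ ≫ f = Δ.groupTensorChart k σ ≫ g) : f = g := by
  refine Scheme.Cover.hom_ext ((Δ.coxCover k).pullback₁ (Δ.groupTensorSnd k)) _ _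
    fun (σ : Δ.Cone) ↦ ?_
  let a := pullback.fst (Δ.groupTensorSnd k) (Δ.coxChartι k σ)
  let b := pullback.snd (Δ.groupTensorSnd k) (Δ.coxChartι k σ)
  have hab : a ≫ Δ.groupTensorSnd k = b ≫ Δ.coxChartι k σ := pullback.condition
  change a ≫ f = a ≫ g
  have hw : (a ≫ Δ.groupTensorFst k) ≫
      Spec.map (CommRingCat.ofHom (algebraMap k (AddMonoidAlgebra k (Δ.Cl k)))) =
      b ≫ Spec.map (CommRingCat.ofHom (algebraMap k (CoxChartRing k σ))) := by
    rw [Category.assoc, (Δ.isPullback_groupTensor k).w, ← Category.assoc, hab, Category.assoc,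
      coxChartι_str]
  -- The preimage of a chart under the second projection maps to `G` times that chart, so agreement
  -- on these products suffices.
  let t := (Δ.isPullback_tensor k (CoxChartRing k σ)).lift (a ≫ Δ.groupTensorFst k) b hw
  have ht : t ≫ Δ.groupTensorChart k σ = a := by
    apply (Δ.isPullback_groupTensor k).hom_ext
    · rw [Category.assoc, groupTensorChart_fst]
      exact IsPullback.lift_fst ..
    · rw [Category.assoc, groupTensorChart_snd, hab, ← Category.assoc]
      exact congrArg (· ≫ _) (IsPullback.lift_snd ..)
  rw [← ht, Category.assoc, Category.assoc, h]

lemma isReynolds (hΔ : Δ.IsNondegenerate) (σ : Δ.Cone) :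
    ∃ E : CoxChartRing k σ →+ ChartRing k σ.1,
      IsReynolds (D := AddMonoidAlgebra k (Δ.Cl k) ⊗[k] CoxChartRing k σ)
        (degCoaction k (Δ.exponentDegree k σ)).toRingHom
      (Algebra.TensorProduct.includeRight : CoxChartRing k σ →ₐ[k]
        AddMonoidAlgebra k (Δ.Cl k) ⊗[k] CoxChartRing k σ).toRingHom
      (Δ.chartToCox k σ).toRingHom E :=
  ⟨_, isReynolds_degCoaction (Δ.evalRays_injective hΔ σ) (Δ.exponentDegree_eq_zero_iff k σ)⟩

/-- The Reynolds operator gives surjectivity, and the chart `U_σ` is integral. -/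
lemma epi_chartQuotient (hΔ : Δ.IsNondegenerate) (σ : Δ.Cone) : Epi (Δ.chartQuotient k σ) := by
  obtain ⟨E, hE⟩ := Δ.isReynolds k hΔ σ
  have : Surjective (Δ.chartQuotient k σ) := ⟨hE.comap_surjective⟩
  exact epi_of_surjective _

lemma epi_quotientMap (hΔ : Δ.IsNondegenerate) : Epi (Δ.quotientMap k) where
  left_cancellation f g h := by
    refine Δ.toricVariety_hom_ext k fun σ ↦ ?_
    have := Δ.epi_chartQuotient k hΔ σ
    rw [← cancel_epi (Δ.chartQuotient k σ), ← Category.assoc, ← Category.assoc,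
      ← coxChartι_quotientMap, Category.assoc, Category.assoc, h]

lemma groupTensorAct_quotientMap (hΔ : Δ.IsNondegenerate) :
    Δ.groupTensorAct k ≫ Δ.quotientMap k = Δ.groupTensorSnd k ≫ Δ.quotientMap k := by
  refine Δ.groupTensor_hom_ext k fun σ ↦ ?_
  obtain ⟨E, hE⟩ := Δ.isReynolds k hΔ σ
  rw [← Category.assoc, ← Category.assoc, groupTensorChart_act, groupTensorChart_snd,
    Category.assoc, Category.assoc, coxChartι_quotientMap, chartQuotient, ← Category.assoc,
    ← Category.assoc, ← Spec.map_comp, ← Spec.map_comp, ← CommRingCat.ofHom_comp,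
    ← CommRingCat.ofHom_comp]
  congr 3
  exact RingHom.ext hE.invariant

lemma exists_chart_factorization (hΔ : Δ.IsNondegenerate) {Z : Scheme.{u}}
    (f : (Δ.coxOpen k).toScheme ⟶ Z) (hf : Δ.groupTensorAct k ≫ f = Δ.groupTensorSnd k ≫ f)
    (σ : Δ.Cone) : ∃ g : Spec (.of (ChartRing k σ.1)) ⟶ Z,
      Δ.chartQuotient k σ ≫ g = Δ.coxChartι k σ ≫ f := by
  obtain ⟨E, hE⟩ := Δ.isReynolds k hΔ σ
  refine hE.exists_factorization _ ?_
  rw [← Category.assoc, ← groupTensorChart_act, Category.assoc, hf, ← Category.assoc,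
    groupTensorChart_snd, Category.assoc]

lemma exists_factorization (hΔ : Δ.IsNondegenerate) {Z : Scheme.{u}}
    (f : (Δ.coxOpen k).toScheme ⟶ Z) (hf : Δ.groupTensorAct k ≫ f = Δ.groupTensorSnd k ≫ f) :
    ∃ g : Δ.toricVariety k ⟶ Z, Δ.quotientMap k ≫ g = f := by
  choose g hg using Δ.exists_chart_factorization k hΔ f hf
  let c : Cocone (Δ.chartDiagram k) :=
    .mk Z
      { app := g
        -- The factorizations on a cone and on its face agree after composition with the quotient
        -- map of the face, where both give the restriction of `f`; that map is an epimorphism.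
        naturality := fun τ σ h ↦ by
          change chartMap k _ ≫ g σ = g τ ≫ 𝟙 _
          have := Δ.epi_chartQuotient k hΔ τ
          rw [Category.comp_id, ← cancel_epi (Δ.chartQuotient k τ), hg, ← Category.assoc,
            ← Δ.coxChartMap_chartQuotient k (leOfHom h), Category.assoc, hg, ← Category.assoc,
            coxChartMap_coxChartι] }
  let d : Δ.toricVariety k ⟶ Z := colimit.desc (Δ.chartDiagram k) c
  have hd : ∀ σ, Δ.chartι k σ ≫ d = g σ := fun σ ↦ colimit.ι_desc c σ
  refine ⟨d, Δ.coxOpen_hom_ext k fun σ ↦ ?_⟩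
  rw [← Category.assoc, coxChartι_quotientMap, Category.assoc, hd, hg]

/-- The toric variety is the categorical quotient of `Spec Cox(X) ∖ V(J_X)` by `G`. -/
theorem isCategoricalQuotient_quotientMapOver (hΔ : Δ.IsNondegenerate) :
    IsCategoricalQuotient (Δ.group k) (Δ.quotientMapOver k) where
  invariant := by
    ext1
    exact Δ.groupTensorAct_quotientMap k hΔ
  universal {Z} f hf := by
    have := Δ.epi_quotientMap k hΔ
    obtain ⟨g, hg⟩ := Δ.exists_factorization k hΔ f.left congr(($hf).left)
    refine ⟨Over.homMk g ?_, ?_, fun g' hg' ↦ ?_⟩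
    -- Compatibility of `g` with the structure morphisms can be tested after the epimorphism
    -- `quotientMap`.
    · rw [← cancel_epi (Δ.quotientMap k), ← Category.assoc, hg]
      exact (Over.w f).trans (Δ.quotientMap_toricVarietyStr k).symm
    · ext1
      exact hg
    · ext1
      rw [← cancel_epi (Δ.quotientMap k)]
      exact congr(($hg').left).trans hg.symm

end Quotient
end Fan
end Toric

theorem mainTheorem1 {k : Type u} [Field k] [IsAlgClosed k]
    {N : Type u} [AddCommGroup N] [Module.Free ℤ N] [Module.Finite ℤ N]
    (Δ : Toric.Fan N) (hΔ : Δ.IsNondegenerate) :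
    ∃ π : Δ.coxU k ⟶ Δ.toricVarietyOver k,
      Toric.IsCategoricalQuotient (Δ.group k) π ∧
      ∀ σ : Δ.Cone, ∃ φ : Toric.ChartRing k σ.1 ≃+*
          HomogeneousLocalization.Away (Δ.coxGrading k) (Δ.coxMonomial k σ),
        Δ.IsMonomialIso k σ φ ∧
        Δ.coxChart k σ ≫ π.left =
          Spec.map (CommRingCat.ofHom ((Δ.degreeZeroIncl k σ).comp φ.toRingHom)) ≫
            Δ.chartι k σ := by
  refine ⟨Δ.quotientMapOver k, Δ.isCategoricalQuotient_quotientMapOver k hΔ, fun σ ↦ ?_⟩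
  -- The relation `hφ` to `chartToCox` yields both the monomial formula and the description of `π`
  -- on the chart.
  obtain ⟨φ, hφ⟩ := Δ.exists_degreeZero_equiv k hΔ σ
  exact ⟨φ, Δ.isMonomialIso_of_forall k hφ, Δ.coxChart_quotientMap k hφ⟩
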